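/- **Setting.** Let $d\ge 2$, let $U$ be a strongly continuous unitary representation of the additive group $\mathbb R^d$ on a separable complex Hilbert space $\mathcal H$, let $P=(P_1,\dots,P_d)$ be its generators along the coordinate axes, $|P|^2=\sum_j P_j^2$, and let $\mathcal D\subset\mathcal H$ be the dense subspace of vectors $\psi$ for which $x\mapsto U(x)\psi$ is $C^\infty$. For an operator $F$ put $\alpha_x(F)=U(x)FU(x)^{-1}$. Let $\mathfrak F$ be the set of all linear operators $F$ in $\mathcal H$ with $\mathcal D\subset\operatorname{dom}F$ such that for some $n\in\mathbb N$ the function $x\mapsto(1+|P|^2)^{-n}\alpha_x(F)(1+|P|^2)^{-n}$ has values in the bounded operators (more precisely, the operator with matrix elements between vectors of $\mathcal D$ given by this expression is bounded) and is arbitrarily often differentiable in norm. Operators in $\mathfrak F$ are regarded as operators on $\mathcal D$, and $F^*$ denotes the Hilbert space adjoint of $F\restriction\mathcal D$. Fix an inner product (a symmetric non-degenerate bilinear form, possibly indefinite) $px=\sum_{i,j}p_i\eta_{ij}x_j$ on $\mathbb R^d$, and let $E$ be the spectral resolution of $U$ with respect to it, $U(x)=\int e^{ipx}\,dE(p)$.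 For a real $d\times d$ matrix $Q$ which is skew symmetric, $q\,Qp=-p\,Qq$ for all $p,q\in\mathbb R^d$, the warped convolution of $F\in\mathfrak F$ is the operator with domain $\mathcal D$ $$F_Q\,\psi=\int dE(p)\,\alpha_{Qp}(F)\,\psi,\qquad \psi\in\mathcal D,$$ where the integral is understood in the sense of distributions: for every Schwartz function $\chi$ with $\chi(0)=1$, $$F_Q\,\psi=\lim_{\varepsilon\searrow0}\ \frac{|\det\eta|}{(2\pi)^{d}}\int dx\;U(x)\int dp\;e^{-ipx}\,\chi(\varepsilon p)\,\alpha_{Qp}(F)\,\psi .$$ **Lemma 2.** Let $F\in\mathfrak F$ and let $Q$ be skew symmetric. Then $F_Q$ is defined on all of $\mathcal D$ and belongs to $\mathfrak F$; the adjoint $F^*$ belongs to $\mathfrak F$, so that $(F^*)_Q$ is likewise defined on $\mathcal D$; and $$(F_Q)^*\supset (F^*)_Q .$$ The same holds with $F^*$ the adjoint of $F$ on its full domain, whenever the domain of that adjoint contains $\mathcal D$. **Consequence.** Let the inner product be the Lorentz product $xy=x_0y_0-\sum_{i=1}^{d-1}x_iy_i$, let $\mathcal W_0=\{x\in\mathbb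 R^d: x_1\ge|x_0|\}$, let $\kappa>0$, and let $Q_\kappa$ be the $d\times d$ matrix whose only non-zero entries are $(Q_\kappa)_{01}=(Q_\kappa)_{10}=\kappa$. Let $\mathcal W=\Lambda\mathcal W_0+a$ be a wedge, with $\Lambda$ a Lorentz transformation and $a\in\mathbb R^d$, and let $\mathfrak A(\mathcal W)\subset\mathfrak F$ be a unital $*$-algebra of operators on $\mathcal D$ (with involution $A\mapsto A^*\restriction\mathcal D$). Let $Q=\Lambda Q_\kappa\Lambda^{-1}$. Then every $A_Q$, $A\in\mathfrak A(\mathcal W)$, maps $\mathcal D$ into $\mathcal D$, and the deformed wedge algebra $\mathfrak A_\kappa(\mathcal W)$, i.e. the polynomial algebra generated by all $A_Q$ with $A\in\mathfrak A(\mathcal W)$, is a unital $*$-algebra contained in $\mathfrak F$. -/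

import Mathlib

open MeasureTheory Filter Topology
open scoped ContDiff SchwartzMap InnerProductSpace

noncomputable section

namespace WarpedConvolution

/-- The space `ℝ^d`. -/
abbrev RVec (d : ℕ) : Type := EuclideanSpace ℝ (Fin d)

/-- The action of a real `d × d` matrix on `ℝ^d`. -/
def act {d : ℕ} (M : Matrix (Fin d) (Fin d) ℝ) (x : RVec d) : RVec d :=
  Matrix.toEuclideanCLM (n := Fin d) (𝕜 := ℝ) M x

/-- The bilinear form `p x = ∑ i j, p_i η_ij x_j` on `ℝ^d` with Gram matrix `η`; for symmetric
invertible `η` this is an arbitrary, possibly indefinite, inner product on `ℝ^d`. -/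
def pairing {d : ℕ} (η : Matrix (Fin d) (Fin d) ℝ) (p x : RVec d) : ℝ :=
  ∑ i, ∑ j, p i * η i j * x j

/-- `η` is the Gram matrix of an inner product on `ℝ^d`. -/
def IsGram {d : ℕ} (η : Matrix (Fin d) (Fin d) ℝ) : Prop :=
  η.IsSymm ∧ η.det ≠ 0

/-- `Q` is skew symmetric for the inner product `η`: `q Q p = - p Q q`. -/
def IsSkewFor {d : ℕ} (η Q : Matrix (Fin d) (Fin d) ℝ) : Prop :=
  ∀ p q : RVec d, pairing η q (act Q p) = - pairing η p (act Q q)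

/-- A strongly continuous unitary representation of the additive group `ℝ^d`. -/
structure TranslationRep (d : ℕ) (H : Type*) [NormedAddCommGroup H] [InnerProductSpace ℂ H] where
  /-- the unitary operators `U(x)` -/
  toFun : RVec d → (H ≃ₗᵢ[ℂ] H)
  map_add : ∀ (x y : RVec d) (ψ : H), toFun (x + y) ψ = toFun x (toFun y ψ)
  continuous_orbit : ∀ ψ : H, Continuous fun x => toFun x ψ

instance {d : ℕ} {H : Type*} [NormedAddCommGroup H] [InnerProductSpace ℂ H] :
    CoeFun (TranslationRep d H) (fun _ => RVec d → (H ≃ₗᵢ[ℂ] H)) := ⟨TranslationRep.toFun⟩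

section Smooth

variable {d : ℕ} {H : Type*} [NormedAddCommGroup H] [InnerProductSpace ℂ H]

/-- The space `𝒟` of vectors which transform smoothly under `U`. -/
def smoothVectors (U : TranslationRep d H) : Submodule ℂ H where
  carrier := {ψ | ContDiff ℝ ∞ fun x => U x ψ}
  zero_mem' := by
    simpa using (contDiff_const : ContDiff ℝ ∞ fun _ : RVec d => (0 : H))
  add_mem' := by
    intro a b ha hb
    simpa using ContDiff.add (show ContDiff ℝ ∞ fun x => U x a from ha)
      (show ContDiff ℝ ∞ fun x => U x b from hb)
  smul_mem' := by
    intro c a ha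
    simpa using ContDiff.const_smul c (show ContDiff ℝ ∞ fun x => U x a from ha)

lemma map_zero_apply (U : TranslationRep d H) (ψ : H) : U 0 ψ = ψ := by
  have h := U.map_add 0 0 ψ
  rw [add_zero] at h
  exact ((U 0).injective h).symm

lemma translate_mem (U : TranslationRep d H) (x : RVec d) {ψ : H} (h : ψ ∈ smoothVectors U) :
    U x ψ ∈ smoothVectors U := by
  have h1 : ContDiff ℝ ∞ fun y => U y ψ := h
  have h2 : ContDiff ℝ ∞ fun y : RVec d => U (y + x) ψ :=
    h1.comp (contDiff_id.add contDiff_const)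
  change ContDiff ℝ ∞ fun y => U y (U x ψ)
  simpa only [U.map_add] using h2

/-- The `j`-th standard basis vector of `ℝ^d`. -/
def basisVec (j : Fin d) : RVec d := EuclideanSpace.single j 1

lemma fderiv_orbit (U : TranslationRep d H) {ψ : H} (h : ψ ∈ smoothVectors U) (y v : RVec d) :
    U y (fderiv ℝ (fun x => U x ψ) 0 v) = fderiv ℝ (fun x => U x ψ) y v := by
  have h1 : ContDiff ℝ ∞ fun y => U y ψ := h
  have hd : Differentiable ℝ fun y => U y ψ := h1.differentiable (by simp)
  have e : (fun x => U (y + x) ψ) = fun x => U y (U x ψ) := by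
    funext x; exact U.map_add y x ψ
  have a1 : HasFDerivAt (fun x => U (y + x) ψ) (fderiv ℝ (fun x => U x ψ) y) 0 := by
    have h0 : HasFDerivAt (fun x => U x ψ) (fderiv ℝ (fun x => U x ψ) y) (y + 0) := by
      rw [add_zero]; exact (hd y).hasFDerivAt
    exact h0.comp (0 : RVec d) ((hasFDerivAt_id (𝕜 := ℝ) (0 : RVec d)).const_add y)
  have a2 : HasFDerivAt (fun x => U y (U x ψ))
      ((((U y).toContinuousLinearEquiv : H →L[ℂ] H).restrictScalars ℝ).comp
        (fderiv ℝ (fun x => U x ψ) 0)) 0 :=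
    (((U y).toContinuousLinearEquiv : H →L[ℂ] H).restrictScalars ℝ).hasFDerivAt.comp
      (0 : RVec d) (hd 0).hasFDerivAt
  rw [e] at a1
  have := a2.unique a1
  exact congrArg (fun T : RVec d →L[ℝ] H => T v) this

lemma fderiv_mem (U : TranslationRep d H) {ψ : H} (h : ψ ∈ smoothVectors U) (v : RVec d) :
    fderiv ℝ (fun x => U x ψ) 0 v ∈ smoothVectors U := by
  have h1 : ContDiff ℝ ∞ fun y => U y ψ := h
  change ContDiff ℝ ∞ fun y => U y (fderiv ℝ (fun x => U x ψ) 0 v)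
  simp only [fderiv_orbit U h]
  exact (h1.fderiv_right (m := ∞) (by simp)).clm_apply contDiff_const

/-- The generator `P_j = -i ∂_j U(x)|_{x = 0}` of `U` on `𝒟`. -/
def generator (U : TranslationRep d H) (j : Fin d) : Module.End ℂ (smoothVectors U) where
  toFun ψ := -Complex.I • ⟨fderiv ℝ (fun x => U x (ψ : H)) 0 (basisVec j), fderiv_mem U ψ.2 _⟩
  map_add' := by
    intro a b
    have ha : DifferentiableAt ℝ (fun x => U x (a : H)) 0 :=
      (show ContDiff ℝ ∞ fun x => U x (a : H) from a.2).differentiable (by simp) 0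
    have hb : DifferentiableAt ℝ (fun x => U x (b : H)) 0 :=
      (show ContDiff ℝ ∞ fun x => U x (b : H) from b.2).differentiable (by simp) 0
    rw [← smul_add]
    congr 1
    ext
    simp [fderiv_fun_add ha hb]
  map_smul' := by
    intro c a
    have ha : DifferentiableAt ℝ (fun x => U x (a : H)) 0 :=
      (show ContDiff ℝ ∞ fun x => U x (a : H) from a.2).differentiable (by simp) 0
    simp only [RingHom.id_apply]
    rw [smul_comm c]
    congr 1
    ext
    simp [fderiv_fun_const_smul ha c]

/-- The operator `1 + |P|^2` on `𝒟`, where `|P|^2` is the sum of the squares of the generators. -/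
def onePlusPSq (U : TranslationRep d H) : Module.End ℂ (smoothVectors U) :=
  1 + ∑ j, generator U j ^ 2

/-- The operator `α_x(F) = U(x) F U(x)⁻¹`, on its natural domain `U(x) dom F`
(note `U(x)⁻¹ = U(-x)`). -/
def alpha (U : TranslationRep d H) (x : RVec d) (F : H →ₗ.[ℂ] H) : H →ₗ.[ℂ] H where
  domain := F.domain.comap ((U (-x)).toLinearEquiv : H →ₗ[ℂ] H)
  toFun := ((U x).toLinearEquiv : H →ₗ[ℂ] H) ∘ₗ F.toFun ∘ₗ
    ((U (-x)).toLinearEquiv : H →ₗ[ℂ] H).restrict (fun _ h => h)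

lemma mem_alpha_domain (U : TranslationRep d H) {F : H →ₗ.[ℂ] H}
    (hF : smoothVectors U ≤ F.domain) (x : RVec d) (ψ : smoothVectors U) :
    (ψ : H) ∈ (alpha U x F).domain :=
  hF (translate_mem U (-x) ψ.2)

/-- The set `𝔉` of smooth operators. An operator `F` belongs to it if `𝒟 ⊆ dom F` and if for some
`n` the function `x ↦ (1 + |P|^2)^(-n) α_x(F) (1 + |P|^2)^(-n)` takes values in the bounded
operators and is arbitrarily often differentiable in norm. The value `B x` of this function is the
bounded operator with the matrix elements
`⟪(1 + |P|^2)^n φ, B x (1 + |P|^2)^n ψ⟫ = ⟪φ, α_x(F) ψ⟫` for `φ, ψ ∈ 𝒟`; it is unique since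
`(1 + |P|^2)^n` is symmetric on `𝒟` and maps `𝒟` onto the dense subspace `𝒟`. -/
structure IsSmoothOp (U : TranslationRep d H) (F : H →ₗ.[ℂ] H) : Prop where
  domain_le : smoothVectors U ≤ F.domain
  smooth : ∃ (n : ℕ) (B : RVec d → (H →L[ℂ] H)), ContDiff ℝ ∞ B ∧
    ∀ (x : RVec d) (φ ψ : smoothVectors U),
      ⟪((onePlusPSq U ^ n) φ : H), B x ((onePlusPSq U ^ n) ψ : H)⟫_ℂ
        = ⟪(φ : H), alpha U x F ⟨ψ, mem_alpha_domain U domain_le x ψ⟩⟫_ℂ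

end Smooth

section Spectral

variable {d : ℕ} {H : Type*} [NormedAddCommGroup H] [InnerProductSpace ℂ H]

/-- The spectral resolution `E` of `U`, given by `U(x) = ∫ e^{i p x} dE(p)`, as a distribution:
the integral `∫ dE(p) g(p)` of a vector valued test function `g` is, by Fourier inversion,
`(2π)^{-d} |det η| ∫ dx U(x) ∫ dp e^{-i p x} g(p)`, where `p x` is the inner product `η`. -/
def spectralIntegral (U : TranslationRep d H) (η : Matrix (Fin d) (Fin d) ℝ) (g : RVec d → H) : H :=
  (|η.det| / (2 * Real.pi) ^ d) •
    ∫ x : RVec d, U x (∫ p : RVec d, Complex.exp (-(pairing η p x : ℂ) * Complex.I) • g p)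

open scoped FourierTransform in
/-- Fourier inversion for the inner product `η`. -/
lemma fourier_inversion_pairing {η : Matrix (Fin d) (Fin d) ℝ} (hη : IsGram η)
    (f : 𝓢(RVec d, ℂ)) :
    Integrable (fun x : RVec d =>
      ∫ p : RVec d, Complex.exp (-(pairing η p x : ℂ) * Complex.I) • f p) ∧
    ∀ q : RVec d, (|η.det| / (2 * Real.pi) ^ d) •
      ∫ x : RVec d, Complex.exp ((pairing η q x : ℂ) * Complex.I) •
        ∫ p : RVec d, Complex.exp (-(pairing η p x : ℂ) * Complex.I) • f p = f q := by
  have hpi : (2 * Real.pi) ≠ 0 := by positivity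
  have hpair : ∀ p x : RVec d, pairing η p x =
      2 * Real.pi * inner ℝ p (Matrix.toEuclideanLin ((2 * Real.pi)⁻¹ • η) x) := by
    intro p x
    have h := Matrix.inner_toEuclideanCLM η p x
    have h2 : Matrix.toEuclideanLin ((2 * Real.pi)⁻¹ • η) x
        = (2 * Real.pi)⁻¹ • Matrix.toEuclideanCLM (n := Fin d) (𝕜 := ℝ) η x := by
      rw [map_smul]; rfl
    rw [h2, inner_smul_right, h, mul_inv_cancel_left₀ hpi]
    simp [pairing, dotProduct, Matrix.mulVec, Finset.mul_sum, mul_assoc]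
  have hdet : LinearMap.det (Matrix.toEuclideanLin ((2 * Real.pi)⁻¹ • η)) =
      ((2 * Real.pi) ^ d)⁻¹ * η.det := by
    rw [LinearMap.det_toLpLin, Matrix.det_smul, Fintype.card_fin, inv_pow]
  have hdet0 : LinearMap.det (Matrix.toEuclideanLin ((2 * Real.pi)⁻¹ • η)) ≠ 0 := by
    rw [hdet]; exact mul_ne_zero (inv_ne_zero (pow_ne_zero _ hpi)) hη.2
  set A := Matrix.toEuclideanLin ((2 * Real.pi)⁻¹ • η) with hA
  have hF : ∀ x : RVec d, (∫ p : RVec d, Complex.exp (-(pairing η p x : ℂ) * Complex.I) • f p)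
      = (𝓕 f) (A x) := by
    intro x
    rw [SchwartzMap.fourier_coe, Real.fourier_eq']
    congr 1; funext p
    rw [hpair]; push_cast; ring_nf
  have hemb : MeasurableEmbedding A :=
    (LinearEquiv.ofIsUnitDet (f := A) (v := (EuclideanSpace.basisFun (Fin d) ℝ).toBasis)
      (v' := (EuclideanSpace.basisFun (Fin d) ℝ).toBasis)
      (by rw [LinearMap.det_toMatrix]; exact hdet0.isUnit)).toContinuousLinearEquiv.toHomeomorph.measurableEmbedding
  have hmap := Measure.map_linearMap_addHaar_eq_smul_addHaar (volume : Measure (RVec d)) hdet0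
  simp only [hF]
  constructor
  · have h1 : Integrable (fun y => (𝓕 f : 𝓢(RVec d, ℂ)) y) (Measure.map A volume) := by
      rw [hmap]; exact (𝓕 f : 𝓢(RVec d, ℂ)).integrable.smul_measure ENNReal.ofReal_ne_top
    exact hemb.integrable_map_iff.1 h1
  · intro q
    have h1 : (∫ x : RVec d, Complex.exp ((pairing η q x : ℂ) * Complex.I) • (𝓕 f) (A x))
        = ∫ y, Complex.exp (((2 * Real.pi * inner ℝ y q : ℝ) : ℂ) * Complex.I) • (𝓕 f) y
            ∂(Measure.map A volume) := by
      rw [hemb.integral_map]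
      congr 1; funext x
      rw [hpair, real_inner_comm]
    rw [h1, hmap, integral_smul_measure, ← Real.fourierInv_eq', ← SchwartzMap.fourierInv_coe,
      FourierTransform.fourierInv_fourier_eq, hdet, ENNReal.toReal_ofReal (abs_nonneg _), smul_smul,
      abs_inv, abs_mul, abs_inv, abs_of_pos (show 0 < (2 * Real.pi) ^ d by positivity), mul_inv,
      inv_inv]
    have : |η.det| ≠ 0 := abs_ne_zero.2 hη.2
    field_simp
    simp

/-- If `μ` is the spectral measure of `U` in the vector `ψ`, i.e. `⟪ψ, U(x) ψ⟫ = ∫ e^{i p x} dμ(p)`,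
then `⟪ψ, (∫ dE(p) f(p)) ψ⟫ = ∫ f(p) dμ(p)` for every scalar test function `f`: the distribution `E`
defined above is the usual projection valued spectral measure of `U`. -/
lemma inner_spectralIntegral [CompleteSpace H] (U : TranslationRep d H)
    {η : Matrix (Fin d) (Fin d) ℝ}
    (hη : IsGram η) (ψ : H) (μ : Measure (RVec d)) [IsFiniteMeasure μ]
    (hμ : ∀ x, ⟪ψ, U x ψ⟫_ℂ = ∫ p, Complex.exp ((pairing η p x : ℂ) * Complex.I) ∂μ)
    (f : 𝓢(RVec d, ℂ)) :
    ⟪ψ, spectralIntegral U η fun p => f p • ψ⟫_ℂ = ∫ p, f p ∂μ := by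
  obtain ⟨hint, hinv⟩ := fourier_inversion_pairing hη f
  set F : RVec d → ℂ := fun x =>
    ∫ p : RVec d, Complex.exp (-(pairing η p x : ℂ) * Complex.I) • f p with hF
  have e1 : ∀ x : RVec d,
      U x (∫ p : RVec d, Complex.exp (-(pairing η p x : ℂ) * Complex.I) • f p • ψ)
        = F x • U x ψ := by
    intro x
    rw [← map_smul, hF, ← integral_smul_const]
    simp only [smul_assoc]
  have hU : Integrable fun x : RVec d => F x • U x ψ := by
    refine Integrable.smul_bdd (C := ‖ψ‖) hint ?_ ?_
    · exact (U.continuous_orbit ψ).aestronglyMeasurable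
    · exact Eventually.of_forall fun x => by simp
  have hprod : Integrable (fun z : RVec d × RVec d =>
      Complex.exp ((pairing η z.2 z.1 : ℂ) * Complex.I) * F z.1) (volume.prod μ) := by
    have h0 : Integrable (fun z : RVec d × RVec d => F z.1) (volume.prod μ) := hint.comp_fst μ
    refine h0.bdd_mul (c := 1) ?_ ?_
    · refine Continuous.aestronglyMeasurable ?_
      unfold pairing
      fun_prop
    · exact Eventually.of_forall fun z => by rw [Complex.norm_exp_ofReal_mul_I]
  unfold spectralIntegral
  simp only [e1]
  rw [inner_smul_right_eq_smul, ← integral_inner hU]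
  simp only [inner_smul_right, hμ]
  have e2 : ∀ x : RVec d, F x * ∫ p, Complex.exp ((pairing η p x : ℂ) * Complex.I) ∂μ
      = ∫ p, Complex.exp ((pairing η p x : ℂ) * Complex.I) * F x ∂μ := by
    intro x
    rw [integral_mul_const, mul_comm]
  simp only [e2]
  rw [integral_integral_swap hprod, ← integral_smul]
  congr 1; funext q
  exact hinv q

/-- `∫ dE(p) G(p) = v` in the sense of distributions, for a function `G` which need not decay:
for every test function `χ` with `χ 0 = 1` the integrals `∫ dE(p) χ(ε p) G(p)` are well defined
and converge to `v` for `ε ↘ 0`. -/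
def HasSpectralIntegral (U : TranslationRep d H) (η : Matrix (Fin d) (Fin d) ℝ)
    (G : RVec d → H) (v : H) : Prop :=
  ∀ χ : 𝓢(RVec d, ℂ), χ 0 = 1 →
    (∀ ε : ℝ, 0 < ε →
      Integrable (fun p : RVec d => χ (ε • p) • G p) ∧
      Integrable (fun x : RVec d => U x
        (∫ p : RVec d, Complex.exp (-(pairing η p x : ℂ) * Complex.I) • χ (ε • p) • G p))) ∧
    Tendsto (fun ε : ℝ => spectralIntegral U η fun p => χ (ε • p) • G p) (𝓝[>] 0) (𝓝 v)

lemma integrable_phase_smul {η : Matrix (Fin d) (Fin d) ℝ} {g : RVec d → H} (hg : Integrable g)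
    (x : RVec d) :
    Integrable fun p : RVec d => Complex.exp (-(pairing η p x : ℂ) * Complex.I) • g p := by
  refine (integrable_norm_iff ?_).1 ?_
  · refine AEStronglyMeasurable.smul (Continuous.aestronglyMeasurable ?_) hg.1
    unfold pairing
    fun_prop
  · have : (fun p : RVec d => ‖Complex.exp (-(pairing η p x : ℂ) * Complex.I) • g p‖)
        = fun p => ‖g p‖ := by
      funext p
      rw [norm_smul]
      have := Complex.norm_exp_ofReal_mul_I (-(pairing η p x))
      push_cast at this
      rw [this, one_mul]
    rw [this]
    exact hg.norm

lemma HasSpectralIntegral.add {U : TranslationRep d H} {η : Matrix (Fin d) (Fin d) ℝ}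
    {G G' : RVec d → H} {v v' : H} (h : HasSpectralIntegral U η G v)
    (h' : HasSpectralIntegral U η G' v') :
    HasSpectralIntegral U η (fun p => G p + G' p) (v + v') := by
  intro χ hχ
  obtain ⟨a, b⟩ := h χ hχ
  obtain ⟨a', b'⟩ := h' χ hχ
  have key : ∀ ε : ℝ, 0 < ε → ∀ x : RVec d,
      U x (∫ p : RVec d, Complex.exp (-(pairing η p x : ℂ) * Complex.I) •
          χ (ε • p) • (G p + G' p))
        = U x (∫ p : RVec d, Complex.exp (-(pairing η p x : ℂ) * Complex.I) • χ (ε • p) • G p)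
        + U x (∫ p : RVec d, Complex.exp (-(pairing η p x : ℂ) * Complex.I) • χ (ε • p) • G' p) := by
    intro ε hε x
    rw [← map_add, ← integral_add (integrable_phase_smul (a ε hε).1 x)
      (integrable_phase_smul (a' ε hε).1 x)]
    simp only [smul_add]
  refine ⟨fun ε hε => ⟨?_, ?_⟩, ?_⟩
  · simp only [smul_add]
    exact (a ε hε).1.add (a' ε hε).1
  · simp only [key ε hε]
    exact (a ε hε).2.add (a' ε hε).2
  · refine (b.add b').congr' ?_
    filter_upwards [self_mem_nhdsWithin] with ε hε
    have hε : 0 < ε := hε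
    unfold spectralIntegral
    rw [← smul_add, ← integral_add (a ε hε).2 (a' ε hε).2]
    simp only [key ε hε]

lemma HasSpectralIntegral.const_smul {U : TranslationRep d H} {η : Matrix (Fin d) (Fin d) ℝ}
    {G : RVec d → H} {v : H} (h : HasSpectralIntegral U η G v) (c : ℂ) :
    HasSpectralIntegral U η (fun p => c • G p) (c • v) := by
  intro χ hχ
  obtain ⟨a, b⟩ := h χ hχ
  have key : ∀ ε : ℝ, ∀ x : RVec d,
      U x (∫ p : RVec d, Complex.exp (-(pairing η p x : ℂ) * Complex.I) • χ (ε • p) • (c • G p))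
        = c • U x (∫ p : RVec d,
            Complex.exp (-(pairing η p x : ℂ) * Complex.I) • χ (ε • p) • G p) := by
    intro ε x
    rw [← map_smul, ← integral_smul]
    simp only [smul_comm c]
  refine ⟨fun ε hε => ⟨?_, ?_⟩, ?_⟩
  · simpa only [smul_comm c, Pi.smul_def] using (a ε hε).1.smul c
  · simp only [key ε]
    exact (a ε hε).2.smul c
  · refine (b.const_smul c).congr' ?_
    filter_upwards with ε
    unfold spectralIntegral
    simp only [key ε, integral_smul]
    rw [smul_comm]

lemma HasSpectralIntegral.unique {U : TranslationRep d H} {η : Matrix (Fin d) (Fin d) ℝ}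
    {G : RVec d → H} {v v' : H} (h : HasSpectralIntegral U η G v)
    (h' : HasSpectralIntegral U η G v') : v = v' := by
  let b : ContDiffBump (0 : RVec d) := ⟨1, 2, one_pos, one_lt_two⟩
  have h1 : HasCompactSupport fun x => ((b x : ℝ) : ℂ) :=
    b.hasCompactSupport.comp_left (g := fun r : ℝ => (r : ℂ)) (by simp)
  have h2 : ContDiff ℝ ∞ fun x => ((b x : ℝ) : ℂ) :=
    Complex.ofRealCLM.contDiff.comp b.contDiff
  have h3 : (h1.toSchwartzMap h2) 0 = 1 := by
    change ((b 0 : ℝ) : ℂ) = 1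
    rw [b.one_of_mem_closedBall (by simp [b.rIn_pos.le])]
    simp
  exact tendsto_nhds_unique (h _ h3).2 (h' _ h3).2

lemma hasSpectralIntegral_zero (U : TranslationRep d H) (η : Matrix (Fin d) (Fin d) ℝ) :
    HasSpectralIntegral U η (fun _ => 0) 0 := by
  intro χ _
  simp [spectralIntegral]

/-- `F_Q ψ = ∫ dE(p) α_{Qp}(F) ψ = v`. -/
def HasWarp (U : TranslationRep d H) (η Q : Matrix (Fin d) (Fin d) ℝ) (F : H →ₗ.[ℂ] H)
    (ψ v : H) : Prop :=
  ∃ G : RVec d → H, (∀ p, (ψ, G p) ∈ (alpha U (act Q p) F).graph) ∧ HasSpectralIntegral U η G v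

lemma HasWarp.unique {U : TranslationRep d H} {η Q : Matrix (Fin d) (Fin d) ℝ} {F : H →ₗ.[ℂ] H}
    {ψ v v' : H} (h : HasWarp U η Q F ψ v) (h' : HasWarp U η Q F ψ v') : v = v' := by
  obtain ⟨G, hG, hv⟩ := h
  obtain ⟨G', hG', hv'⟩ := h'
  have : G = G' := by
    funext p
    exact LinearPMap.mem_graph_snd_inj _ (hG p) (hG' p) rfl
  subst this
  exact hv.unique hv'

lemma HasWarp.add {U : TranslationRep d H} {η Q : Matrix (Fin d) (Fin d) ℝ} {F : H →ₗ.[ℂ] H}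
    {ψ v ψ' v' : H} (h : HasWarp U η Q F ψ v) (h' : HasWarp U η Q F ψ' v') :
    HasWarp U η Q F (ψ + ψ') (v + v') := by
  obtain ⟨G, hG, hv⟩ := h
  obtain ⟨G', hG', hv'⟩ := h'
  exact ⟨_, fun p => Submodule.add_mem _ (hG p) (hG' p), hv.add hv'⟩

lemma HasWarp.const_smul {U : TranslationRep d H} {η Q : Matrix (Fin d) (Fin d) ℝ}
    {F : H →ₗ.[ℂ] H} {ψ v : H} (h : HasWarp U η Q F ψ v) (c : ℂ) :
    HasWarp U η Q F (c • ψ) (c • v) := by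
  obtain ⟨G, hG, hv⟩ := h
  exact ⟨_, fun p => Submodule.smul_mem _ c (hG p), hv.const_smul c⟩

/-- The warped convolution `F_Q = ∫ dE(p) α_{Qp}(F)`. Its domain consists of those vectors
`ψ ∈ 𝒟` for which the integral `∫ dE(p) α_{Qp}(F) ψ` exists in the sense of distributions. -/
def warp (U : TranslationRep d H) (η Q : Matrix (Fin d) (Fin d) ℝ) (F : H →ₗ.[ℂ] H) :
    H →ₗ.[ℂ] H where
  domain :=
    { carrier := {ψ | ψ ∈ smoothVectors U ∧ ∃ v, HasWarp U η Q F ψ v}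
      zero_mem' := ⟨Submodule.zero_mem _, 0, fun _ => 0, fun _ => Submodule.zero_mem _,
        hasSpectralIntegral_zero U η⟩
      add_mem' := fun h h' => ⟨Submodule.add_mem _ h.1 h'.1, _, h.2.choose_spec.add h'.2.choose_spec⟩
      smul_mem' := fun c _ h => ⟨Submodule.smul_mem _ c h.1, _, h.2.choose_spec.const_smul c⟩ }
  toFun :=
    { toFun := fun ψ => ψ.2.2.choose
      map_add' := fun ψ ψ' => (ψ + ψ').2.2.choose_spec.unique
        (ψ.2.2.choose_spec.add ψ'.2.2.choose_spec)
      map_smul' := fun c ψ => (c • ψ).2.2.choose_spec.unique (ψ.2.2.choose_spec.const_smul c) }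

end Spectral

section Algebra

variable {d : ℕ} {H : Type*} [NormedAddCommGroup H] [InnerProductSpace ℂ H]

/-- A linear map `𝒟 → 𝒟`, regarded as an operator on `H` with domain `𝒟`. -/
def opOf (U : TranslationRep d H) (T : Module.End ℂ (smoothVectors U)) : H →ₗ.[ℂ] H where
  domain := smoothVectors U
  toFun := (smoothVectors U).subtype ∘ₗ T

/-- A unital algebra `𝔄` of operators on `𝒟` is a unital *-subalgebra of `𝔉`: its elements belong
to `𝔉`, and with `A` it contains the restriction of the Hilbert space adjoint `A*` to `𝒟`. -/
structure IsSmoothStarAlgebra [CompleteSpace H] (U : TranslationRep d H)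
    (𝔄 : Subalgebra ℂ (Module.End ℂ (smoothVectors U))) : Prop where
  smooth : ∀ A ∈ 𝔄, IsSmoothOp U (opOf U A)
  star_mem : ∀ A ∈ 𝔄, ∃ B ∈ 𝔄, opOf U B ≤ (opOf U A).adjoint

/-- The polynomial algebra generated by the warped operators `A_Q`, `A ∈ 𝔄`. -/
def deformedAlgebra (U : TranslationRep d H) (η Q : Matrix (Fin d) (Fin d) ℝ)
    (𝔄 : Subalgebra ℂ (Module.End ℂ (smoothVectors U))) :
    Subalgebra ℂ (Module.End ℂ (smoothVectors U)) :=
  Algebra.adjoin ℂ {T | ∃ A ∈ 𝔄, opOf U T = warp U η Q (opOf U A)}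

end Algebra

section Minkowski

variable {d : ℕ}

/-- The Gram matrix `diag(1, -1, …, -1)` of the Lorentz inner product
`x y = x_0 y_0 - ∑_{i ≥ 1} x_i y_i`. -/
def lorentzForm (d : ℕ) : Matrix (Fin d) (Fin d) ℝ :=
  Matrix.diagonal fun i => if (i : ℕ) = 0 then 1 else -1

/-- `Λ` is a Lorentz transformation. -/
def IsLorentz (Λ : Matrix (Fin d) (Fin d) ℝ) : Prop :=
  Λ.transpose * lorentzForm d * Λ = lorentzForm d

/-- The standard wedge `𝒲₀ = {x : x_1 ≥ |x_0|}` in `d ≥ 2` dimensions. -/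
def standardWedge (hd : 2 ≤ d) : Set (RVec d) :=
  {x | |x ⟨0, by omega⟩| ≤ x ⟨1, by omega⟩}

/-- The image `λ 𝒲₀ = Λ 𝒲₀ + a` of the standard wedge under `λ = (Λ, a)`. -/
def wedge (hd : 2 ≤ d) (Λ : Matrix (Fin d) (Fin d) ℝ) (a : RVec d) : Set (RVec d) :=
  (fun x => act Λ x + a) '' standardWedge hd

/-- The matrix `Q_κ`, whose only nonzero entries are `(Q_κ)_01 = (Q_κ)_10 = κ`. -/
def Qmat (d : ℕ) (κ : ℝ) : Matrix (Fin d) (Fin d) ℝ :=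
  fun i j => if ((i : ℕ) = 0 ∧ (j : ℕ) = 1) ∨ ((i : ℕ) = 1 ∧ (j : ℕ) = 0) then κ else 0

/-- The deformed wedge algebra `𝔄_κ(𝒲)` of the wedge `𝒲 = λ 𝒲₀`, `λ = (Λ, a)`: the polynomial
algebra generated by the operators `A_Q`, `A ∈ 𝔄(𝒲)`, with `Q = Λ Q_κ Λ⁻¹`. -/
def deformedWedgeAlgebra {H : Type*} [NormedAddCommGroup H] [InnerProductSpace ℂ H]
    (hd : 2 ≤ d) (U : TranslationRep d H) (κ : ℝ)
    (𝔄 : Set (RVec d) → Subalgebra ℂ (Module.End ℂ (smoothVectors U)))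
    (Λ : Matrix (Fin d) (Fin d) ℝ) (a : RVec d) :
    Subalgebra ℂ (Module.End ℂ (smoothVectors U)) :=
  deformedAlgebra U (lorentzForm d) (Λ * Qmat d κ * Λ⁻¹) (𝔄 (wedge hd Λ a))

end Minkowski

end WarpedConvolution

end

open MeasureTheory Filter Topology
open scoped ContDiff SchwartzMap InnerProductSpace

noncomputable section

namespace WarpedConvolution

/-! ### Translations, generators and powers of `1 + |P|^2` on smooth vectors -/

section Basics

variable {d : ℕ} {H : Type*} [NormedAddCommGroup H] [InnerProductSpace ℂ H]

/-! Write `A = 1 + |P|^2`. On `𝒟` the smooth operators are exactly the products `C A^m`, where `C`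
is bounded and `x ↦ α_x(C)` is smooth in norm (`isSmoothOp_iff`). Such a `C` preserves `𝒟` and
satisfies the Leibniz rule `P_j C = C P_j + [P_j, C]` with `[P_j, C]` again smooth and bounded.
Since `P_j A⁻¹` is bounded, `A C = C' A` for another smooth bounded `C'`. Powers of `A` can
therefore be moved through `C`, and because `A` commutes with translations, everything reduces to
warping `C`.

Existence of `∫ dE(p) α_{Qp}(C) ψ` rests on integration by parts (`spectralIntegral_generator`):
under the spectral integral a momentum factor `p_j` may be traded for `P_j` acting on the integrand.
Applied to `1 + |p|^2`, this replaces `α_{Qp}(C) ψ` by `(1 + |p|^2)^(-k) α_{Qp}(C') A^k ψ`. For `k =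
d + 1` the integrand and its derivatives of every order are `O((1 + |p|)^(-(d+1)))`, so its Fourier
transform is absolutely integrable, the cutoff can be removed by dominated convergence, and the
result is `W A^k ψ` with `W` bounded. A Taylor estimate uniform in `p` shows that `x ↦ α_x(W)` is
smooth in norm, so the warped operator is smooth again.

For the adjoint, insert cutoffs `h(p)`, `k(q)` on both sides. The matrix element of `∫ dE(p) h(p)
α_{Qp}(C) ∫ dE(q) k(q)` is an integral of the correlation function `⟪φ, U(x) C U(y) ψ⟫` shifted by
`(Qp, -Qp)`. Undoing the shift leaves the phase unchanged because `p Qp = 0`, and produces the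
kernel of `e^{-ipx - iqy - iqQp}`. Skew symmetry makes this kernel invariant under conjugation
combined with `(x, y) ↦ (-y, -x)` and exchange of `h` and `k`; the correlation function has the same
symmetry with `C` replaced by its adjoint. This is `IsSmoothBdd.inner_spectralIntegral_adjoint`.
Removing the cutoffs one after the other gives the relation for bounded `C`, and moving powers of
`A` across the spectral integral gives it for all of `𝔉` (`IsSmoothOp.inner_warp`).

The normal form `C A^m` also shows that smooth operators on `𝒟` are closed under sums and products,
so the star property passes from generators to the generated algebra. For wedges it only remains to
see that `Λ Q_κ Λ⁻¹` is skew for the Lorentz form. -/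

lemma neg_apply_apply (U : TranslationRep d H) (x : RVec d) (ψ : H) : U (-x) (U x ψ) = ψ := by
  rw [← U.map_add, neg_add_cancel, map_zero_apply]

lemma apply_neg_apply (U : TranslationRep d H) (x : RVec d) (ψ : H) : U x (U (-x) ψ) = ψ := by
  rw [← U.map_add, add_neg_cancel, map_zero_apply]

lemma apply_comm (U : TranslationRep d H) (x y : RVec d) (ψ : H) :
    U x (U y ψ) = U y (U x ψ) := by
  rw [← U.map_add, ← U.map_add, add_comm]

lemma inner_apply_left (U : TranslationRep d H) (x : RVec d) (φ ψ : H) :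
    ⟪U x φ, ψ⟫_ℂ = ⟪φ, U (-x) ψ⟫_ℂ := by
  rw [← (U x).inner_map_map φ, apply_neg_apply]

lemma inner_apply_right (U : TranslationRep d H) (x : RVec d) (φ ψ : H) :
    ⟪φ, U x ψ⟫_ℂ = ⟪U (-x) φ, ψ⟫_ℂ := by
  rw [inner_apply_left, neg_neg]

/-- Strong continuity is only separate continuity; joint continuity follows because all `U(x)` are
isometries, so the change of the vector is controlled uniformly in `x`. -/
lemma continuous_apply {X : Type*} [TopologicalSpace X] (U : TranslationRep d H)
    {f : X → RVec d} {g : X → H} (hf : Continuous f) (hg : Continuous g) :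
    Continuous fun t => U (f t) (g t) := by
  rw [continuous_iff_continuousAt]
  intro t
  have h1 : Tendsto (fun s => U (f s) (g t)) (𝓝 t) (𝓝 (U (f t) (g t))) :=
    (((U.continuous_orbit (g t)).comp hf).tendsto t)
  have h2 : Tendsto (fun s => U (f s) (g s - g t)) (𝓝 t) (𝓝 0) := by
    rw [tendsto_zero_iff_norm_tendsto_zero]
    simp only [LinearIsometryEquiv.norm_map]
    rw [← tendsto_zero_iff_norm_tendsto_zero]
    simpa using (hg.tendsto t).sub_const (g t)
  have := h1.add h2
  simpa [ContinuousAt, map_sub] using this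

/-- The action of a translation on the space of smooth vectors. -/
def translate (U : TranslationRep d H) (x : RVec d) : Module.End ℂ (smoothVectors U) :=
  ((U x).toLinearEquiv : H →ₗ[ℂ] H).restrict fun _ h => translate_mem U x h

@[simp] lemma coe_translate (U : TranslationRep d H) (x : RVec d) (ψ : smoothVectors U) :
    (translate U x ψ : H) = U x ψ := rfl

lemma contDiff_orbit (U : TranslationRep d H) (ψ : smoothVectors U) :
    ContDiff ℝ ∞ fun x => U x (ψ : H) := ψ.2

lemma coe_generator (U : TranslationRep d H) (j : Fin d) (ψ : smoothVectors U) :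
    (generator U j ψ : H) = -Complex.I • fderiv ℝ (fun x => U x (ψ : H)) 0 (basisVec j) := rfl

lemma fderiv_orbit_basisVec (U : TranslationRep d H) (ψ : smoothVectors U) (j : Fin d)
    (x : RVec d) :
    fderiv ℝ (fun x => U x (ψ : H)) x (basisVec j) = Complex.I • U x (generator U j ψ : H) := by
  rw [coe_generator, map_smul, smul_smul, fderiv_orbit U ψ.2]
  simp

lemma hasLineDerivAt_orbit (U : TranslationRep d H) (ψ : smoothVectors U) (j : Fin d)
    (x : RVec d) :
    HasLineDerivAt ℝ (fun x => U x (ψ : H)) (Complex.I • U x (generator U j ψ : H)) x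
      (basisVec j) := by
  rw [← fderiv_orbit_basisVec]
  exact ((contDiff_orbit U ψ).differentiable (by simp) x).hasFDerivAt.hasLineDerivAt _

lemma generator_eq_of_hasLineDerivAt (U : TranslationRep d H) (ψ : smoothVectors U) (j : Fin d)
    {v : H} (h : HasLineDerivAt ℝ (fun x => U x (ψ : H)) v 0 (basisVec j)) :
    (generator U j ψ : H) = -Complex.I • v := by
  have h1 := hasLineDerivAt_orbit U ψ j 0
  rw [map_zero_apply] at h1
  rw [← h1.unique h, smul_smul]
  simp

lemma generator_translate (U : TranslationRep d H) (j : Fin d) (x : RVec d)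
    (ψ : smoothVectors U) :
    generator U j (translate U x ψ) = translate U x (generator U j ψ) := by
  ext
  have h := fderiv_orbit_basisVec U ψ j x
  have h2 : fderiv ℝ (fun y => U y (U x (ψ : H))) 0 (basisVec j)
      = fderiv ℝ (fun y => U y (ψ : H)) x (basisVec j) := by
    have : (fun y => U y (U x (ψ : H))) = fun y => (fun z => U z (ψ : H)) (y + x) := by
      funext y; exact (U.map_add y x ψ).symm
    rw [this, fderiv_comp_add_right (f := fun z => U z (ψ : H)) x, zero_add]
  rw [coe_generator, coe_translate, h2, h, smul_smul, coe_translate]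
  simp

/-- Unitarity makes `⟪U(t)φ, U(t)ψ⟫` constant; its derivative at `t = 0` gives the symmetry of
`P_j`. -/
lemma inner_generator (U : TranslationRep d H) (j : Fin d) (φ ψ : smoothVectors U) :
    ⟪(generator U j φ : H), (ψ : H)⟫_ℂ = ⟪(φ : H), (generator U j ψ : H)⟫_ℂ := by
  have h1 := (contDiff_orbit U φ).differentiable (by simp) 0
  have h2 := (contDiff_orbit U ψ).differentiable (by simp) 0
  have h3 := fderiv_inner_apply (𝕜 := ℂ) h1 h2 (basisVec j)
  have h4 : (fun t => ⟪U t (φ : H), U t (ψ : H)⟫_ℂ) = fun _ => ⟪(φ : H), (ψ : H)⟫_ℂ := by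
    funext t; simp
  rw [h4, fderiv_orbit_basisVec, fderiv_orbit_basisVec] at h3
  simp only [map_zero_apply, inner_smul_right, inner_smul_left, Complex.conj_I] at h3
  simp only [fderiv_fun_const, Pi.zero_apply, zero_apply] at h3
  have h5 : Complex.I * (⟪(φ : H), (generator U j ψ : H)⟫_ℂ
    - ⟪(generator U j φ : H), (ψ : H)⟫_ℂ) = 0 := by rw [h3]; ring
  rcases mul_eq_zero.1 h5 with h | h
  · exact absurd h Complex.I_ne_zero
  · exact (sub_eq_zero.1 h).symm

lemma coe_onePlusPSq (U : TranslationRep d H) (ψ : smoothVectors U) :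
    (onePlusPSq U ψ : H) = ψ + ∑ j, (generator U j (generator U j ψ) : H) := by
  simp [onePlusPSq, pow_two, LinearMap.add_apply, LinearMap.sum_apply]

lemma onePlusPSq_translate (U : TranslationRep d H) (x : RVec d) (ψ : smoothVectors U) :
    onePlusPSq U (translate U x ψ) = translate U x (onePlusPSq U ψ) := by
  ext
  rw [coe_onePlusPSq, coe_translate, coe_translate, coe_onePlusPSq, map_add, map_sum]
  simp [generator_translate]

lemma onePlusPSq_pow_translate (U : TranslationRep d H) (n : ℕ) (x : RVec d)
    (ψ : smoothVectors U) :
    (onePlusPSq U ^ n) (translate U x ψ) = translate U x ((onePlusPSq U ^ n) ψ) := by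
  induction n generalizing ψ with
  | zero => simp
  | succ n ih => rw [pow_succ, Module.End.mul_apply, onePlusPSq_translate, ih, Module.End.mul_apply]

lemma inner_onePlusPSq (U : TranslationRep d H) (φ ψ : smoothVectors U) :
    ⟪(onePlusPSq U φ : H), (ψ : H)⟫_ℂ = ⟪(φ : H), (onePlusPSq U ψ : H)⟫_ℂ := by
  simp only [coe_onePlusPSq, inner_add_left, inner_add_right, sum_inner, inner_sum,
    inner_generator]

lemma inner_onePlusPSq_pow (U : TranslationRep d H) (n : ℕ) (φ ψ : smoothVectors U) :
    ⟪((onePlusPSq U ^ n) φ : H), (ψ : H)⟫_ℂ = ⟪(φ : H), ((onePlusPSq U ^ n) ψ : H)⟫_ℂ := by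
  induction n generalizing φ ψ with
  | zero => simp
  | succ n ih =>
    rw [pow_succ, Module.End.mul_apply, ih, inner_onePlusPSq, ← Module.End.mul_apply, ← pow_succ',
      pow_succ]

lemma re_inner_onePlusPSq (U : TranslationRep d H) (ψ : smoothVectors U) :
    Complex.re ⟪(ψ : H), (onePlusPSq U ψ : H)⟫_ℂ
      = ‖(ψ : H)‖ ^ 2 + ∑ j, ‖(generator U j ψ : H)‖ ^ 2 := by
  simp only [coe_onePlusPSq, inner_add_right, inner_sum, Complex.add_re, Complex.re_sum]
  congr 1
  · exact inner_self_eq_norm_sq (𝕜 := ℂ) (ψ : H)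
  · refine Finset.sum_congr rfl fun j _ => ?_
    rw [← inner_generator]
    exact inner_self_eq_norm_sq (𝕜 := ℂ) (generator U j ψ : H)

lemma norm_le_norm_onePlusPSq (U : TranslationRep d H) (ψ : smoothVectors U) :
    ‖(ψ : H)‖ ≤ ‖(onePlusPSq U ψ : H)‖ := by
  have h1 := re_inner_onePlusPSq U ψ
  have h2 : Complex.re ⟪(ψ : H), (onePlusPSq U ψ : H)⟫_ℂ ≤ ‖(ψ : H)‖ * ‖(onePlusPSq U ψ : H)‖ :=
    re_inner_le_norm (𝕜 := ℂ) _ _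
  have h3 : 0 ≤ ∑ j, ‖(generator U j ψ : H)‖ ^ 2 := Finset.sum_nonneg fun _ _ => sq_nonneg _
  rcases (norm_nonneg (ψ : H)).eq_or_lt with h | h
  · rw [← h]; positivity
  · nlinarith

/-- This is the boundedness of `P_j (1 + |P|^2)⁻¹`, which keeps the commutator of `1 + |P|^2` with a
smooth bounded operator under control. -/
lemma norm_generator_le (U : TranslationRep d H) (j : Fin d) (ψ : smoothVectors U) :
    ‖(generator U j ψ : H)‖ ≤ ‖(onePlusPSq U ψ : H)‖ := by
  have h1 := re_inner_onePlusPSq U ψ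
  have h2 : Complex.re ⟪(ψ : H), (onePlusPSq U ψ : H)⟫_ℂ ≤ ‖(ψ : H)‖ * ‖(onePlusPSq U ψ : H)‖ :=
    re_inner_le_norm (𝕜 := ℂ) _ _
  have h3 : ‖(generator U j ψ : H)‖ ^ 2 ≤ ∑ j, ‖(generator U j ψ : H)‖ ^ 2 :=
    Finset.single_le_sum (f := fun j => ‖(generator U j ψ : H)‖ ^ 2)
      (fun _ _ => sq_nonneg _) (Finset.mem_univ j)
  have h4 := norm_le_norm_onePlusPSq U ψ
  have := norm_nonneg (ψ : H)
  refine abs_le_of_sq_le_sq' ?_ (norm_nonneg _) |>.2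
  nlinarith

/-- With `A = 1 + |P|^2`, symmetry gives `⟪ψ, A^(n+2) ψ⟫ = ⟪Aψ, A^n Aψ⟫`, so the induction advances
two powers at a time from the cases `0` and `1`. -/
lemma norm_sq_le_re_inner_onePlusPSq_pow (U : TranslationRep d H) (n : ℕ)
    (ψ : smoothVectors U) :
    ‖(ψ : H)‖ ^ 2 ≤ Complex.re ⟪(ψ : H), ((onePlusPSq U ^ n) ψ : H)⟫_ℂ := by
  induction n using Nat.strong_induction_on generalizing ψ with
  | _ n ih =>
    match n with
    | 0 => exact (inner_self_eq_norm_sq (𝕜 := ℂ) (ψ : H)).ge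
    | 1 =>
      rw [pow_one, re_inner_onePlusPSq]
      exact le_add_of_nonneg_right (Finset.sum_nonneg fun _ _ => sq_nonneg _)
    | n + 2 =>
      have h := ih n (by omega) (onePlusPSq U ψ)
      rw [pow_succ' (onePlusPSq U), Module.End.mul_apply, ← inner_onePlusPSq,
        pow_succ (onePlusPSq U), Module.End.mul_apply]
      refine le_trans ?_ h
      gcongr
      exact norm_le_norm_onePlusPSq U ψ

/-- The unitary operator `U(x)` as a bounded operator. -/
def opU (U : TranslationRep d H) (x : RVec d) : H →L[ℂ] H :=
  ((U x).toContinuousLinearEquiv : H →L[ℂ] H)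

@[simp] lemma opU_apply (U : TranslationRep d H) (x : RVec d) (ψ : H) : opU U x ψ = U x ψ := rfl

/-- `(1 + |P|^2)^n` as a map from smooth vectors to the Hilbert space. -/
def onePlusPSqPow (U : TranslationRep d H) (n : ℕ) : smoothVectors U →ₗ[ℂ] H :=
  (smoothVectors U).subtype ∘ₗ (onePlusPSq U ^ n)

@[simp] lemma onePlusPSqPow_apply (U : TranslationRep d H) (n : ℕ) (ψ : smoothVectors U) :
    onePlusPSqPow U n ψ = ((onePlusPSq U ^ n) ψ : H) := rfl

lemma alpha_apply (U : TranslationRep d H) (x : RVec d) (F : H →ₗ.[ℂ] H) (ψ : H)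
    (h : ψ ∈ (alpha U x F).domain) :
    alpha U x F ⟨ψ, h⟩ = U x (F ⟨U (-x) ψ, h⟩) := rfl

end Basics

/-! ### Density of smooth vectors and of the range of `(1 + |P|^2)^n` -/

section Density

variable {d : ℕ} {H : Type*} [NormedAddCommGroup H] [InnerProductSpace ℂ H] [CompleteSpace H]

lemma apply_integral {X : Type*} [MeasurableSpace X] {μ : Measure X} (U : TranslationRep d H)
    (x : RVec d) {f : X → H} (hf : Integrable f μ) : U x (∫ t, f t ∂μ) = ∫ t, U x (f t) ∂μ :=
  ((opU U x).integral_comp_comm hf).symm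

/-- Smearing with a bump function produces smooth vectors arbitrarily close to a given vector,
inside every invariant orthogonal complement. -/
lemma exists_smoothVector_near (U : TranslationRep d H) (M : Submodule ℂ H)
    (hU : ∀ x, ∀ v ∈ Mᗮ, U x v ∈ Mᗮ) {v : H} (hv : v ∈ Mᗮ) {ε : ℝ}
    (hε : 0 < ε) : ∃ u ∈ smoothVectors U, u ∈ Mᗮ ∧ dist u v < ε := by
  let b : ℕ → ContDiffBump (0 : RVec d) := fun n =>
    ⟨1 / (n + 2), 1 / (n + 1), by positivity, by gcongr; norm_num⟩
  have hb : Tendsto (fun n => (b n).rOut) atTop (𝓝 0) := tendsto_one_div_add_atTop_nhds_zero_nat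
  have hcont : Continuous fun x => U x v := U.continuous_orbit v
  -- The smeared vector is the value at `0` of the convolution of the bump with the orbit of `v`; as
  -- the support shrinks it tends to `U(0)v = v`.
  have hlim := ContDiffBump.convolution_tendsto_right_of_continuous (μ := volume) hb hcont 0
  rw [map_zero_apply] at hlim
  obtain ⟨n, hn⟩ := (Metric.tendsto_atTop.1 hlim ε hε)
  have hint : Integrable fun t => (b n).normed volume t • U (0 - t) v := by
    refine Continuous.integrable_of_hasCompactSupport ?_ ?_
    · exact ((b n).contDiff_normed (n := ⊤)).continuous.smul
        (hcont.comp (continuous_const.sub continuous_id))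
    · exact (b n).hasCompactSupport_normed.smul_right
  refine ⟨_, ?_, ?_, hn n le_rfl⟩
  · have hs := (b n).hasCompactSupport_normed (μ := volume) |>.contDiff_convolution_left
      (ContinuousLinearMap.lsmul ℝ ℝ) ((b n).contDiff_normed (μ := volume) (n := ⊤))
      (hcont.locallyIntegrable (μ := volume))
    -- The orbit of the smeared vector is the full convolution as a function of `y`, which inherits
    -- smoothness from the bump.
    have e : (fun y => U y (convolution ((b n).normed volume) (fun x => U x v)
        (ContinuousLinearMap.lsmul ℝ ℝ) volume 0)) =
        convolution ((b n).normed volume) (fun x => U x v) (ContinuousLinearMap.lsmul ℝ ℝ)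
          volume := by
      funext y
      simp only [convolution, ContinuousLinearMap.lsmul_apply]
      rw [apply_integral U y hint]
      congr 1; funext t
      have : U y ((b n).normed volume t • U (0 - t) v) = (b n).normed volume t • U y (U (0 - t) v) :=
        ((opU U y).restrictScalars ℝ).map_smul _ _
      rw [this, ← U.map_add]
      congr 3; abel
    change ContDiff ℝ ∞ _
    rw [e]
    exact hs
  · rw [Submodule.mem_orthogonal]
    intro m hm
    simp only [convolution, ContinuousLinearMap.lsmul_apply]
    rw [← integral_inner hint]
    refine integral_eq_zero_of_ae (Eventually.of_forall fun t => ?_)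
    have h0 : ⟪m, U (0 - t) v⟫_ℂ = 0 := (Submodule.mem_orthogonal _ _).1 (hU _ v hv) m hm
    change ⟪m, (b n).normed volume t • U (0 - t) v⟫_ℂ = 0
    rw [inner_smul_right_eq_smul, h0, smul_zero]

lemma dense_smoothVectors (U : TranslationRep d H) : Dense (smoothVectors U : Set H) := by
  intro v
  rw [Metric.mem_closure_iff]
  intro ε hε
  obtain ⟨u, hu, -, h⟩ := exists_smoothVector_near U ⊥ (by simp) (v := v) (by simp) hε
  exact ⟨u, hu, by rwa [dist_comm]⟩

/-- The orthogonal complement of the range is translation invariant, so a vector `v ≠ 0` in it has a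
smooth vector `u` of the complement within distance `‖v‖`, hence `u ≠ 0`. But `⟪u, (1 + |P|^2)^n u⟫
= 0` contradicts the lower bound `‖u‖^2`. -/
lemma denseRange_onePlusPSqPow (U : TranslationRep d H) (n : ℕ) :
    DenseRange (onePlusPSqPow U n) := by
  set M : Submodule ℂ H := LinearMap.range (onePlusPSqPow U n) with hM
  have hU : ∀ x, ∀ v ∈ Mᗮ, U x v ∈ Mᗮ := by
    intro x v hv
    rw [Submodule.mem_orthogonal] at hv ⊢
    rintro _ ⟨ψ, rfl⟩
    rw [inner_apply_right, onePlusPSqPow_apply, ← coe_translate, ← onePlusPSq_pow_translate]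
    exact hv _ ⟨_, rfl⟩
  have hbot : Mᗮ = ⊥ := by
    rw [Submodule.eq_bot_iff]
    intro v hv
    by_contra hne
    obtain ⟨u, hu, huM, hd⟩ := exists_smoothVector_near U M hU hv (norm_pos_iff.2 hne)
    have h1 := norm_sq_le_re_inner_onePlusPSq_pow U n ⟨u, hu⟩
    have h2 : ⟪((onePlusPSq U ^ n) ⟨u, hu⟩ : H), u⟫_ℂ = 0 :=
      (Submodule.mem_orthogonal _ _).1 huM _ ⟨⟨u, hu⟩, rfl⟩
    rw [← inner_onePlusPSq_pow, h2] at h1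
    have h3 : u = 0 := by
      have : ‖u‖ ^ 2 ≤ 0 := by simpa using h1
      exact norm_eq_zero.1 (pow_eq_zero_iff two_ne_zero |>.1 (le_antisymm this (sq_nonneg _)))
    rw [h3, dist_zero_left] at hd
    exact lt_irrefl _ hd
  have := (Submodule.dense_iff_topologicalClosure_eq_top.2
    ((Submodule.topologicalClosure_eq_top_iff).2 hbot))
  rw [DenseRange, ← LinearMap.coe_range]
  exact this

lemma ext_onePlusPSqPow (U : TranslationRep d H) (n : ℕ) {A B : H →L[ℂ] H}
    (h : ∀ ψ : smoothVectors U, A ((onePlusPSq U ^ n) ψ : H) = B ((onePlusPSq U ^ n) ψ : H)) :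
    A = B := by
  ext v
  exact congrFun ((denseRange_onePlusPSqPow U n).equalizer A.continuous B.continuous
    (funext h)) v

lemma exists_extension (U : TranslationRep d H) (n : ℕ) (T : smoothVectors U →ₗ[ℂ] H) {c : ℝ}
    (hT : ∀ ψ, ‖T ψ‖ ≤ c * ‖((onePlusPSq U ^ n) ψ : H)‖) :
    ∃ A : H →L[ℂ] H, ∀ ψ : smoothVectors U, A ((onePlusPSq U ^ n) ψ : H) = T ψ :=
  ⟨T.extendOfNorm (onePlusPSqPow U n), fun ψ =>
    LinearMap.extendOfNorm_eq (denseRange_onePlusPSqPow U n) ⟨c, hT⟩ ψ⟩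

end Density

/-! ### Bounded operators with norm-smooth translates -/

section SmoothBounded

variable {d : ℕ} {H : Type*} [NormedAddCommGroup H] [InnerProductSpace ℂ H]

/-- `α_x(C) = U(x) C U(x)⁻¹` for a bounded operator `C`. -/
def conjOp (U : TranslationRep d H) (x : RVec d) (C : H →L[ℂ] H) : H →L[ℂ] H :=
  opU U x ∘L C ∘L opU U (-x)

@[simp] lemma conjOp_apply (U : TranslationRep d H) (x : RVec d) (C : H →L[ℂ] H) (ψ : H) :
    conjOp U x C ψ = U x (C (U (-x) ψ)) := rfl

lemma conjOp_conjOp (U : TranslationRep d H) (x y : RVec d) (C : H →L[ℂ] H) :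
    conjOp U x (conjOp U y C) = conjOp U (x + y) C := by
  ext ψ
  simp only [conjOp_apply, ← U.map_add]
  congr 3; abel_nf

@[simp] lemma conjOp_zero (U : TranslationRep d H) (C : H →L[ℂ] H) : conjOp U 0 C = C := by
  ext ψ; simp [map_zero_apply]

lemma conjOp_neg_self (U : TranslationRep d H) (x : RVec d) (C : H →L[ℂ] H) :
    conjOp U (-x) (conjOp U x C) = C := by
  rw [conjOp_conjOp]; simp

lemma conjOp_mul (U : TranslationRep d H) (x : RVec d) (C D : H →L[ℂ] H) :
    conjOp U x (C * D) = conjOp U x C * conjOp U x D := by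
  ext ψ; simp [neg_apply_apply]

lemma norm_conjOp_le (U : TranslationRep d H) (x : RVec d) (C : H →L[ℂ] H) :
    ‖conjOp U x C‖ ≤ ‖C‖ := by
  refine ContinuousLinearMap.opNorm_le_bound _ (norm_nonneg _) fun ψ => ?_
  rw [conjOp_apply, LinearIsometryEquiv.norm_map]
  exact (C.le_opNorm _).trans_eq (by rw [LinearIsometryEquiv.norm_map])

/-- Conjugation by `U(x)` as a linear isometry of the bounded operators. -/
def conjIsom (U : TranslationRep d H) (x : RVec d) : (H →L[ℂ] H) →ₗᵢ[ℝ] (H →L[ℂ] H) where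
  toFun := conjOp U x
  map_add' C D := by ext ψ; simp
  map_smul' c C := by
    ext ψ
    exact ((opU U x).restrictScalars ℝ).map_smul c _
  norm_map' C := by
    refine le_antisymm (norm_conjOp_le U x C) ?_
    have := norm_conjOp_le U (-x) (conjOp U x C)
    rwa [conjOp_neg_self] at this

@[simp] lemma conjIsom_apply (U : TranslationRep d H) (x : RVec d) (C : H →L[ℂ] H) :
    conjIsom U x C = conjOp U x C := rfl

/-- The bounded operators which transform smoothly in norm under translations. -/
def IsSmoothBdd (U : TranslationRep d H) (C : H →L[ℂ] H) : Prop :=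
  ContDiff ℝ ∞ fun x => conjOp U x C

/-- Restriction of scalars for bounded operators. -/
def realOp : (H →L[ℂ] H) →L[ℝ] (H →L[ℝ] H) := ContinuousLinearMap.restrictScalarsL ℂ H H ℝ ℝ

@[simp] lemma realOp_apply (C : H →L[ℂ] H) (ψ : H) : realOp C ψ = C ψ := rfl

lemma contDiff_op_apply {E : Type*} [NormedAddCommGroup E] [NormedSpace ℝ E] {n : WithTop ℕ∞}
    {C : E → (H →L[ℂ] H)} {ψ : E → H}
    (hC : ContDiff ℝ n C) (hψ : ContDiff ℝ n ψ) : ContDiff ℝ n fun t => C t (ψ t) :=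
  ((realOp (H := H)).contDiff.comp hC).clm_apply hψ

namespace IsSmoothBdd

variable {U : TranslationRep d H} {C D : H →L[ℂ] H}

lemma add (hC : IsSmoothBdd U C) (hD : IsSmoothBdd U D) : IsSmoothBdd U (C + D) := by
  have := ContDiff.add (show ContDiff ℝ ∞ _ from hC) (show ContDiff ℝ ∞ _ from hD)
  simpa only [IsSmoothBdd, ← conjIsom_apply, map_add] using this

lemma smul (hC : IsSmoothBdd U C) (c : ℂ) : IsSmoothBdd U (c • C) := by
  have := ContDiff.const_smul c (show ContDiff ℝ ∞ _ from hC)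
  have e : (fun x => conjOp U x (c • C)) = fun x => c • conjOp U x C := by
    funext x; ext ψ; simp
  rw [IsSmoothBdd, e]
  exact this

lemma mul (hC : IsSmoothBdd U C) (hD : IsSmoothBdd U D) : IsSmoothBdd U (C * D) := by
  have := ContDiff.mul (show ContDiff ℝ ∞ _ from hC) (show ContDiff ℝ ∞ _ from hD)
  simpa only [IsSmoothBdd, conjOp_mul] using this

lemma of_commute (h : ∀ x, ∀ ψ, C (U x ψ) = U x (C ψ)) : IsSmoothBdd U C := by
  have e : (fun x => conjOp U x C) = fun _ => C := by
    funext x; ext ψ; rw [conjOp_apply, ← h, apply_neg_apply]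
  rw [IsSmoothBdd, e]
  exact contDiff_const

lemma sum {ι : Type*} {s : Finset ι} {C : ι → (H →L[ℂ] H)} (h : ∀ i ∈ s, IsSmoothBdd U (C i)) :
    IsSmoothBdd U (∑ i ∈ s, C i) := by
  have := ContDiff.sum (s := s) (f := fun i x => conjOp U x (C i)) (n := ∞) (𝕜 := ℝ) h
  simpa only [IsSmoothBdd, ← conjIsom_apply, map_sum] using this

lemma conj (hC : IsSmoothBdd U C) (x : RVec d) : IsSmoothBdd U (conjOp U x C) := by
  simp only [IsSmoothBdd, conjOp_conjOp]
  exact ContDiff.comp (g := fun y => conjOp U y C) hC (contDiff_id.add contDiff_const)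

/-- The derivative of `x ↦ α_x(C)` is again covariant. -/
lemma fderiv_conjOp (hC : IsSmoothBdd U C) (x v : RVec d) :
    fderiv ℝ (fun y => conjOp U y C) x v = conjOp U x (fderiv ℝ (fun y => conjOp U y C) 0 v) := by
  have hd : DifferentiableAt ℝ (fun y => conjOp U y C) 0 :=
    (show ContDiff ℝ ∞ _ from hC).differentiable (by simp) 0
  have e : (fun y => (fun z => conjOp U z C) (x + y)) = fun y => conjIsom U x (conjOp U y C) := by
    funext y; simp [conjOp_conjOp]
  have h1 := fderiv_comp_add_left (𝕜 := ℝ) (f := fun z => conjOp U z C) x (x := 0)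
  rw [e, add_zero] at h1
  rw [← h1]
  have h2 := ((conjIsom U x).toContinuousLinearMap.hasFDerivAt.comp (0 : RVec d)
    hd.hasFDerivAt).fderiv
  exact congrArg (fun T : RVec d →L[ℝ] (H →L[ℂ] H) => T v) h2

lemma fderiv (hC : IsSmoothBdd U C) (v : RVec d) :
    IsSmoothBdd U (fderiv ℝ (fun y => conjOp U y C) 0 v) := by
  simp only [IsSmoothBdd, ← hC.fderiv_conjOp]
  exact ((show ContDiff ℝ ∞ _ from hC).fderiv_right (m := ∞) (by simp)).clm_apply contDiff_const

/-- `U(x) C ψ = α_x(C) U(x) ψ` is a product of two smooth functions of `x`. -/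
lemma apply_mem (hC : IsSmoothBdd U C) {ψ : H} (hψ : ψ ∈ smoothVectors U) :
    C ψ ∈ smoothVectors U := by
  have := contDiff_op_apply (show ContDiff ℝ ∞ _ from hC)
    (show ContDiff ℝ ∞ fun x => U x ψ from hψ)
  simp only [conjOp_apply, neg_apply_apply] at this
  exact this

/-- The action of a smooth bounded operator on smooth vectors. -/
def toEnd (hC : IsSmoothBdd U C) : Module.End ℂ (smoothVectors U) :=
  (C : H →ₗ[ℂ] H).restrict fun _ h => hC.apply_mem h

@[simp] lemma coe_toEnd (hC : IsSmoothBdd U C) (ψ : smoothVectors U) :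
    (hC.toEnd ψ : H) = C ψ := rfl

/-- The product rule for `α_x(C) U(x) ψ` at `x = 0`. The second term is the commutator `[P_j, C] =
-i ∂_j α_x(C)` at `x = 0`, again smooth and bounded. -/
lemma generator_toEnd (hC : IsSmoothBdd U C) (j : Fin d) (ψ : smoothVectors U) :
    generator U j (hC.toEnd ψ) = hC.toEnd (generator U j ψ) +
      ((hC.fderiv (basisVec j)).smul (-Complex.I)).toEnd ψ := by
  ext
  have h1 : HasFDerivAt (fun x => realOp (conjOp U x C))
      (realOp ∘L _root_.fderiv ℝ (fun y => conjOp U y C) 0) 0 :=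
    (realOp (H := H)).hasFDerivAt.comp (0 : RVec d)
      ((show ContDiff ℝ ∞ _ from hC).differentiable (by simp) 0).hasFDerivAt
  have h2 := ((contDiff_orbit U ψ).differentiable (by simp) 0).hasFDerivAt
  have h3 := (h1.clm_apply h2).hasLineDerivAt (basisVec j)
  have e : (fun x => realOp (conjOp U x C) (U x (ψ : H))) = fun x => U x (hC.toEnd ψ : H) := by
    funext x; simp [neg_apply_apply]
  rw [e] at h3
  rw [generator_eq_of_hasLineDerivAt U _ j h3]
  simp [map_zero_apply, fderiv_orbit_basisVec, smul_smul]

end IsSmoothBdd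

end SmoothBounded

/-! ### Adjoints, commutation with `1 + |P|^2`, and the normal form of smooth operators -/

section SmoothBoundedComplete

variable {d : ℕ} {H : Type*} [NormedAddCommGroup H] [InnerProductSpace ℂ H] [CompleteSpace H]
variable {U : TranslationRep d H} {C D : H →L[ℂ] H}

lemma adjoint_opU (U : TranslationRep d H) (x : RVec d) :
    (opU U x).adjoint = opU U (-x) := by
  refine ((ContinuousLinearMap.eq_adjoint_iff _ _).2 fun φ ψ => ?_).symm
  rw [opU_apply, opU_apply, inner_apply_left, neg_neg]

lemma conjOp_adjoint (U : TranslationRep d H) (x : RVec d) (C : H →L[ℂ] H) :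
    conjOp U x C.adjoint = (conjOp U x C).adjoint := by
  simp only [conjOp, ContinuousLinearMap.adjoint_comp, adjoint_opU, neg_neg]
  rfl

lemma IsSmoothBdd.adjoint (hC : IsSmoothBdd U C) : IsSmoothBdd U C.adjoint := by
  have := (starL' ℝ : (H →L[ℂ] H) ≃L[ℝ] (H →L[ℂ] H)).contDiff.comp
    (show ContDiff ℝ ∞ _ from hC)
  simpa only [IsSmoothBdd, conjOp_adjoint, ContinuousLinearMap.star_eq_adjoint,
    Function.comp_def, starL'_apply] using this

/-- Produces bounded functions of `P`, such as `(1 + |P|^2)^(-n)` and `P_j (1 + |P|^2)⁻¹`, without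
functional calculus. They commute with translations, so their orbits are constant and smoothness is
automatic. -/
lemma exists_extension_isSmoothBdd (U : TranslationRep d H) (n : ℕ)
    (T : Module.End ℂ (smoothVectors U)) {c : ℝ}
    (hT : ∀ ψ, ‖(T ψ : H)‖ ≤ c * ‖((onePlusPSq U ^ n) ψ : H)‖)
    (hU : ∀ x ψ, T (translate U x ψ) = translate U x (T ψ)) :
    ∃ A : H →L[ℂ] H, IsSmoothBdd U A ∧
      ∀ ψ : smoothVectors U, A ((onePlusPSq U ^ n) ψ : H) = (T ψ : H) := by
  obtain ⟨A, hA⟩ := exists_extension U n ((smoothVectors U).subtype ∘ₗ T) hT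
  refine ⟨A, IsSmoothBdd.of_commute fun x v => ?_, hA⟩
  have : A ∘L opU U x = opU U x ∘L A := by
    refine ext_onePlusPSqPow U n fun ψ => ?_
    simp only [ContinuousLinearMap.comp_apply, opU_apply]
    rw [hA, ← coe_translate, ← onePlusPSq_pow_translate, hA]
    simp [hU]
  exact congrArg (fun B : H →L[ℂ] H => B v) this

lemma exists_onePlusPSq_inverse (U : TranslationRep d H) (n : ℕ) :
    ∃ K : H →L[ℂ] H, IsSmoothBdd U K ∧
      ∀ ψ : smoothVectors U, K ((onePlusPSq U ^ n) ψ : H) = ψ := by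
  refine exists_extension_isSmoothBdd U n 1 (c := 1) (fun ψ => ?_) fun x ψ => rfl
  rw [one_mul]
  induction n with
  | zero => simp
  | succ n ih =>
    rw [pow_succ', Module.End.mul_apply]
    exact ih.trans (norm_le_norm_onePlusPSq U _)

/-- Moving `1 + |P|^2` through a smooth bounded operator. -/
lemma IsSmoothBdd.exists_onePlusPSq_comm (hC : IsSmoothBdd U C) :
    ∃ (C' : H →L[ℂ] H) (_ : IsSmoothBdd U C'), ∀ ψ : smoothVectors U,
      (onePlusPSq U (hC.toEnd ψ) : H) = C' (onePlusPSq U ψ) := by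
  obtain ⟨K, hK, hK1⟩ := exists_onePlusPSq_inverse U 1
  have hP : ∀ j : Fin d, ∃ A : H →L[ℂ] H, IsSmoothBdd U A ∧
      ∀ ψ : smoothVectors U, A ((onePlusPSq U ^ 1) ψ : H) = (generator U j ψ : H) := fun j =>
    exists_extension_isSmoothBdd U 1 (generator U j) (c := 1)
      (fun ψ => by rw [one_mul, pow_one]; exact norm_generator_le U j ψ)
      (generator_translate U j)
  choose A hA hA1 using hP
  simp only [pow_one] at hK1 hA1
  have hC1 := fun j => (hC.fderiv (basisVec j)).smul (-Complex.I)
  have hC2 := fun j => ((hC1 j).fderiv (basisVec j)).smul (-Complex.I)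
  -- Applying the Leibniz rule twice gives `P_j^2 C = C P_j^2 + 2 C_j P_j + C_jj` with iterated
  -- commutators `C_j`, `C_jj`; here `A j = P_j (1 + |P|^2)⁻¹` and `K = (1 + |P|^2)⁻¹`.
  refine ⟨_, hC.add (IsSmoothBdd.sum (s := Finset.univ)
    (fun j _ => (((hC1 j).mul (hA j)).add ((hC1 j).mul (hA j))).add ((hC2 j).mul hK))), fun ψ => ?_⟩
  rw [coe_onePlusPSq]
  simp only [hC.generator_toEnd, map_add, (hC1 _).generator_toEnd, Submodule.coe_add,
    IsSmoothBdd.coe_toEnd, add_apply, sum_apply,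
    mul_apply_eq_comp, hK1, hA1]
  rw [coe_onePlusPSq, map_add, map_sum, add_assoc, ← Finset.sum_add_distrib]
  congr 2; funext j
  abel

lemma IsSmoothBdd.exists_onePlusPSq_pow_comm (hC : IsSmoothBdd U C) (n : ℕ) :
    ∃ (C' : H →L[ℂ] H) (_ : IsSmoothBdd U C'), ∀ ψ : smoothVectors U,
      ((onePlusPSq U ^ n) (hC.toEnd ψ) : H) = C' ((onePlusPSq U ^ n) ψ) := by
  induction n with
  | zero => exact ⟨C, hC, fun ψ => rfl⟩
  | succ n ih =>
    obtain ⟨C', hC', h⟩ := ih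
    obtain ⟨C'', hC'', h'⟩ := hC'.exists_onePlusPSq_comm
    refine ⟨C'', hC'', fun ψ => ?_⟩
    rw [pow_succ', Module.End.mul_apply, Module.End.mul_apply, ← h']
    congr 2
    ext
    rw [h]; rfl

/-- The smooth operators are, on the smooth vectors, the products of a smooth bounded operator and
a power of `1 + |P|^2`. -/
theorem isSmoothOp_iff (U : TranslationRep d H) (F : H →ₗ.[ℂ] H) :
    IsSmoothOp U F ↔ ∃ h : smoothVectors U ≤ F.domain, ∃ (m : ℕ) (C : H →L[ℂ] H),
      IsSmoothBdd U C ∧ ∀ ψ : smoothVectors U, F ⟨ψ, h ψ.2⟩ = C ((onePlusPSq U ^ m) ψ : H) := by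
  constructor
  · rintro ⟨hle, n, B, hB, hBF⟩
    -- The matrix elements on the dense range of `(1 + |P|^2)^n` determine `B x`, so covariance need
    -- not be assumed: `B` is the orbit of the single operator `B 0`.
    have hcov : ∀ x, B x = conjOp U x (B 0) := by
      intro x
      refine ext_onePlusPSqPow U n fun ψ => ?_
      refine (denseRange_onePlusPSqPow U n).eq_of_inner_right ℂ ?_
      intro φ
      rw [onePlusPSqPow_apply, hBF, conjOp_apply, inner_apply_right, ← coe_translate,
        ← coe_translate, ← onePlusPSq_pow_translate, ← onePlusPSq_pow_translate, hBF,
        coe_translate, ← inner_apply_right, alpha_apply, alpha_apply]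
      simp [map_zero_apply]
    have hC : IsSmoothBdd U (B 0) := by
      simpa only [IsSmoothBdd, ← hcov] using hB
    -- On `𝒟`, `F` is `(1 + |P|^2)^n B(0) (1 + |P|^2)^n`; moving the left power through `B 0`
    -- doubles the exponent on the right.
    obtain ⟨C', hC', h⟩ := hC.exists_onePlusPSq_pow_comm n
    refine ⟨hle, n + n, C', hC', fun ψ => ?_⟩
    rw [pow_add, Module.End.mul_apply, ← h]
    refine (dense_smoothVectors U).eq_of_inner_right ℂ fun φ hφ => ?_
    have := hBF 0 ⟨φ, hφ⟩ ψ
    rw [← hC.coe_toEnd, inner_onePlusPSq_pow, alpha_apply] at this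
    rw [this]
    simp [map_zero_apply]
  · rintro ⟨hle, m, C, hC, h⟩
    obtain ⟨K, hK, hK1⟩ := exists_onePlusPSq_inverse U m
    -- `K` inverts `(1 + |P|^2)^m`, so its adjoint cancels the power on the left vector of the
    -- matrix element.
    refine ⟨hle, m, fun x => K.adjoint * conjOp U x C,
      contDiff_const.mul (show ContDiff ℝ ∞ _ from hC), fun x φ ψ => ?_⟩
    rw [mul_apply_eq_comp, ContinuousLinearMap.adjoint_inner_right, hK1, alpha_apply,
      conjOp_apply, ← coe_translate, ← onePlusPSq_pow_translate, ← h]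
    rfl

end SmoothBoundedComplete

/-! ### Calculus of functions whose derivatives all obey one polynomial bound -/

section Symbols

variable {d : ℕ} {ι κ E F G : Type*} [NormedAddCommGroup E] [NormedSpace ℝ E]
  [NormedAddCommGroup F] [NormedSpace ℝ F] [NormedAddCommGroup G] [NormedSpace ℝ G]

/-- The derivatives of order `j` of a family of functions grow at most like `(1 + |p|)^n`,
uniformly in the family. -/
def HasSymbolBound (n : ℤ) (f : ι → RVec d → E) (j : ℕ) : Prop :=
  ∃ C, 0 ≤ C ∧ ∀ i p, ‖iteratedFDeriv ℝ j (f i) p‖ ≤ C * (1 + ‖p‖) ^ n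

/-- Families of smooth functions all of whose derivatives grow at most like `(1 + |p|)^n`,
uniformly in the family. -/
structure SymbolFam (n : ℤ) (f : ι → RVec d → E) : Prop where
  contDiff : ∀ i, ContDiff ℝ ∞ (f i)
  bound : ∀ j, HasSymbolBound n f j

lemma hasSymbolBound_of_le {n : ℤ} {f : ι → RVec d → E} {j : ℕ} (C : ℝ)
    (h : ∀ i p, ‖iteratedFDeriv ℝ j (f i) p‖ ≤ C * (1 + ‖p‖) ^ n) : HasSymbolBound n f j :=
  ⟨|C|, abs_nonneg C, fun i p => (h i p).trans (by gcongr; exact le_abs_self C)⟩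

/-- The Leibniz rule at a fixed order `j`, using only orders up to `j`. This form serves the
induction in `SymbolFam.inv`, where higher orders are not yet known. -/
lemma HasSymbolBound.bilinear (B : E →L[ℝ] F →L[ℝ] G) {n m : ℤ} {f : ι → RVec d → E}
    {g : ι → RVec d → F} (hf : ∀ i, ContDiff ℝ ∞ (f i)) (hg : ∀ i, ContDiff ℝ ∞ (g i)) (j : ℕ)
    (hfb : ∀ k ≤ j, HasSymbolBound n f k) (hgb : ∀ k ≤ j, HasSymbolBound m g k) :
    HasSymbolBound (n + m) (fun i p => B (f i p) (g i p)) j := by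
  -- Constants for orders above `j` are set to `0`, so that one choice function covers all `k`.
  have hfb' : ∀ k, ∃ C, 0 ≤ C ∧ (k ≤ j → ∀ i p, ‖iteratedFDeriv ℝ k (f i) p‖ ≤
      C * (1 + ‖p‖) ^ n) := fun k => by
    by_cases hk : k ≤ j
    · obtain ⟨C, h0, h⟩ := hfb k hk
      exact ⟨C, h0, fun _ => h⟩
    · exact ⟨0, le_rfl, fun h => absurd h hk⟩
  have hgb' : ∀ k, ∃ C, 0 ≤ C ∧ (k ≤ j → ∀ i p, ‖iteratedFDeriv ℝ k (g i) p‖ ≤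
      C * (1 + ‖p‖) ^ m) := fun k => by
    by_cases hk : k ≤ j
    · obtain ⟨C, h0, h⟩ := hgb k hk
      exact ⟨C, h0, fun _ => h⟩
    · exact ⟨0, le_rfl, fun h => absurd h hk⟩
  choose a ha0 ha using hfb'
  choose b hb0 hb using hgb'
  refine ⟨‖B‖ * ∑ k ∈ Finset.range (j + 1), (j.choose k : ℝ) * a k * b (j - k), ?_, fun i p => ?_⟩
  · exact mul_nonneg (norm_nonneg B) (Finset.sum_nonneg fun k _ =>
      mul_nonneg (mul_nonneg (by positivity) (ha0 _)) (hb0 _))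
  · refine (B.norm_iteratedFDeriv_le_of_bilinear (hf i) (hg i) p (n := j)
      (mod_cast le_top)).trans ?_
    rw [mul_assoc, Finset.sum_mul]
    refine mul_le_mul_of_nonneg_left (Finset.sum_le_sum fun k hk => ?_) (norm_nonneg B)
    have hk' : k ≤ j := by simpa [Nat.lt_succ_iff] using hk
    have h1 := ha k hk' i p
    have h2 := hb (j - k) (Nat.sub_le _ _) i p
    have hpos : (0 : ℝ) < 1 + ‖p‖ := by positivity
    have h3 := ha0 k
    calc (j.choose k : ℝ) * ‖iteratedFDeriv ℝ k (f i) p‖ * ‖iteratedFDeriv ℝ (j - k) (g i) p‖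
        ≤ (j.choose k : ℝ) * (a k * (1 + ‖p‖) ^ n) * (b (j - k) * (1 + ‖p‖) ^ m) := by gcongr
      _ = (j.choose k : ℝ) * a k * b (j - k) * (1 + ‖p‖) ^ (n + m) := by
          rw [zpow_add₀ hpos.ne']; ring

namespace SymbolFam

variable {n m : ℤ} {f : ι → RVec d → E}

lemma mono (hf : SymbolFam n f) (h : n ≤ m) : SymbolFam m f := by
  refine ⟨hf.contDiff, fun j => ?_⟩
  obtain ⟨C, h0, hC⟩ := hf.bound j
  refine ⟨C, h0, fun i p => (hC i p).trans ?_⟩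
  gcongr
  simp

lemma reindex (hf : SymbolFam n f) (g : κ → ι) : SymbolFam n fun k => f (g k) :=
  ⟨fun _ => hf.contDiff _, fun j => let ⟨C, h0, h⟩ := hf.bound j; ⟨C, h0, fun _ => h _⟩⟩

lemma add {g : ι → RVec d → E} (hf : SymbolFam n f) (hg : SymbolFam n g) :
    SymbolFam n fun i p => f i p + g i p := by
  refine ⟨fun i => (hf.contDiff i).add (hg.contDiff i), fun j => ?_⟩
  obtain ⟨C, h0, hC⟩ := hf.bound j
  obtain ⟨D, h0', hD⟩ := hg.bound j
  refine ⟨C + D, by positivity, fun i p => ?_⟩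
  rw [fun_iteratedFDeriv_add_apply (((hf.contDiff i).of_le (mod_cast le_top)).contDiffAt)
    (((hg.contDiff i).of_le (mod_cast le_top)).contDiffAt), add_mul]
  exact (norm_add_le _ _).trans (add_le_add (hC i p) (hD i p))

lemma bilinear (B : E →L[ℝ] F →L[ℝ] G) {g : ι → RVec d → F} (hf : SymbolFam n f)
    (hg : SymbolFam m g) : SymbolFam (n + m) fun i p => B (f i p) (g i p) :=
  ⟨fun i => B.isBoundedBilinearMap.contDiff.comp₂ (hf.contDiff i) (hg.contDiff i), fun j =>
    HasSymbolBound.bilinear B hf.contDiff hg.contDiff j (fun _ _ => hf.bound _)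
      fun _ _ => hg.bound _⟩

lemma clm (L : E →L[ℝ] F) (hf : SymbolFam n f) : SymbolFam n fun i p => L (f i p) := by
  refine ⟨fun i => L.contDiff.comp (hf.contDiff i), fun j => ?_⟩
  obtain ⟨C, h0, hC⟩ := hf.bound j
  refine ⟨‖L‖ * C, by positivity, fun i p => ?_⟩
  refine (L.norm_iteratedFDeriv_comp_left (hf.contDiff i).contDiffAt (mod_cast le_top)).trans ?_
  rw [mul_assoc]
  gcongr
  exact hC i p

/-- For order `0` the weight is constant, so arbitrary, even unbounded, shifts `a k` cost nothing;
only the linear parts must be uniformly bounded. -/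
lemma comp_affine (hf : SymbolFam 0 f) (g : κ → ι) (a : κ → RVec d) (L : κ → RVec d →L[ℝ] RVec d)
    {c : ℝ} (hL : ∀ k, ‖L k‖ ≤ c) : SymbolFam 0 fun k p => f (g k) (a k + L k p) := by
  refine ⟨fun k => (hf.contDiff _).comp (contDiff_const.add (L k).contDiff), fun j => ?_⟩
  obtain ⟨C, h0, hC⟩ := hf.bound j
  refine hasSymbolBound_of_le (C * c ^ j) fun k p => ?_
  have h1 : ContDiff ℝ ∞ fun q => f (g k) (a k + q) :=
    (hf.contDiff _).comp (contDiff_const.add contDiff_id)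
  have h2 := (L k).iteratedFDeriv_comp_right h1 p (i := j) (mod_cast le_top)
  change ‖iteratedFDeriv ℝ j ((fun q => f (g k) (a k + q)) ∘ L k) p‖ ≤ _
  rw [h2, iteratedFDeriv_comp_add_left]
  refine (ContinuousMultilinearMap.norm_compContinuousLinearMap_le _ _).trans ?_
  simp only [Finset.prod_const, Finset.card_univ, Fintype.card_fin, zpow_zero, mul_one]
  have := hC (g k) (a k + L k p)
  simp only [zpow_zero, mul_one] at this
  gcongr
  exact hL k

lemma const {v : ι → E} {M : ℝ} (h : ∀ i, ‖v i‖ ≤ M) :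
    SymbolFam (d := d) 0 fun i _ => v i := by
  refine ⟨fun i => contDiff_const, fun j => hasSymbolBound_of_le M fun i p => ?_⟩
  rcases Nat.eq_zero_or_pos j with rfl | hj
  · simpa using h i
  · rw [iteratedFDeriv_const_of_ne hj.ne']
    simpa using (norm_nonneg _).trans (h i)

/-- Differentiation is not required to improve decay: the derivatives of `α_{Qp}(C)` in `p` are
merely bounded, and the class is made to contain them. -/
lemma fderiv (hf : SymbolFam n f) : SymbolFam n fun i => fderiv ℝ (f i) := by
  refine ⟨fun i => (hf.contDiff i).fderiv_right (m := ∞) (by simp), fun j => ?_⟩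
  obtain ⟨C, h0, hC⟩ := hf.bound (j + 1)
  exact ⟨C, h0, fun i p => by rw [norm_iteratedFDeriv_fderiv]; exact hC i p⟩

lemma linear (L : RVec d →L[ℝ] E) : SymbolFam 1 fun (_ : ι) p => L p := by
  refine ⟨fun i => L.contDiff, fun j => ?_⟩
  refine ⟨‖L‖, norm_nonneg _, fun i p => ?_⟩
  rw [zpow_one]
  match j with
  | 0 =>
    rw [norm_iteratedFDeriv_zero]
    refine (L.le_opNorm p).trans ?_
    gcongr; linarith
  | 1 =>
    rw [← norm_iteratedFDeriv_fderiv, norm_iteratedFDeriv_zero, L.fderiv]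
    nlinarith [norm_nonneg L, norm_nonneg p]
  | j + 2 =>
    rw [← norm_iteratedFDeriv_fderiv]
    have : _root_.fderiv ℝ L = fun _ => L := by funext q; exact L.fderiv
    rw [this, iteratedFDeriv_const_of_ne (by omega)]
    simp only [Pi.zero_apply, norm_zero]
    positivity

lemma schwartz (n : ℤ) (χ : 𝓢(RVec d, E)) : SymbolFam n fun (_ : ι) p => χ p := by
  refine ⟨fun i => χ.smooth ⊤, fun j => ?_⟩
  refine hasSymbolBound_of_le (2 ^ n.natAbs * ((Finset.Iic (n.natAbs, j)).sup
    fun m => SchwartzMap.seminorm ℝ m.1 m.2) χ) fun i p => ?_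
  have h := SchwartzMap.one_add_le_sup_seminorm_apply (𝕜 := ℝ) (m := (n.natAbs, j)) le_rfl le_rfl
    χ p
  have hpos : (0 : ℝ) < 1 + ‖p‖ := by positivity
  have h1 : (1 + ‖p‖) ^ (-(n.natAbs : ℤ)) ≤ (1 + ‖p‖) ^ n :=
    zpow_le_zpow_right₀ (by simp) (by omega)
  have h2 : ‖iteratedFDeriv ℝ j χ p‖ ≤ (2 ^ n.natAbs * ((Finset.Iic (n.natAbs, j)).sup
    fun m => SchwartzMap.seminorm ℝ m.1 m.2) χ) * (1 + ‖p‖) ^ (-(n.natAbs : ℤ)) := by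
    rw [zpow_neg, zpow_natCast, ← div_eq_mul_inv, le_div_iff₀ (by positivity), mul_comm]
    exact h
  refine h2.trans ?_
  gcongr

/-- A covariant smooth function has uniformly bounded derivatives. -/
lemma of_covariant {f : RVec d → E} (hf : ContDiff ℝ ∞ f) (T : RVec d → E →ₗᵢ[ℝ] E)
    (h : ∀ x y, f (x + y) = T x (f y)) : SymbolFam 0 fun (_ : ι) => f := by
  refine ⟨fun _ => hf, fun j => ⟨‖iteratedFDeriv ℝ j f 0‖, norm_nonneg _, fun i x => ?_⟩⟩
  have h1 := (T x).norm_iteratedFDeriv_comp_left (hf.contDiffAt (x := 0)) (i := j)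
    (mod_cast le_top)
  have h2 : (T x) ∘ f = fun y => f (x + y) := by funext y; exact (h x y).symm
  rw [h2, iteratedFDeriv_comp_add_left, add_zero] at h1
  rw [h1]; simp

lemma norm_le (hf : SymbolFam n f) : ∃ C, 0 ≤ C ∧ ∀ i p, ‖f i p‖ ≤ C * (1 + ‖p‖) ^ n := by
  simpa only [HasSymbolBound, norm_iteratedFDeriv_zero] using hf.bound 0

lemma mul_complex {f g : ι → RVec d → ℂ} (hf : SymbolFam n f) (hg : SymbolFam m g) :
    SymbolFam (n + m) fun i p => f i p * g i p :=
  bilinear (ContinuousLinearMap.mul ℝ ℂ) hf hg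

lemma smul_complex {V : Type*} [NormedAddCommGroup V] [NormedSpace ℂ V] {f : ι → RVec d → ℂ}
    {g : ι → RVec d → V}
    (hf : SymbolFam n f) (hg : SymbolFam m g) : SymbolFam (n + m) fun i p => f i p • g i p :=
  bilinear (ContinuousLinearMap.lsmul ℝ ℂ) hf hg

/-- Strong induction on the order of the derivative, from `d(w⁻¹) = -w⁻² dw`: the right side has
order `-k - k + k = -k` and involves only lower derivatives of `w⁻¹`. -/
lemma inv {w : RVec d → ℝ} {k : ℕ} (hw : SymbolFam k fun (_ : Unit) => w) {c : ℝ} (hc : 0 < c)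
    (hwc : ∀ p, c * (1 + ‖p‖) ^ (k : ℤ) ≤ w p) :
    SymbolFam (-k) fun (_ : ι) p => (w p)⁻¹ := by
  have hpos : ∀ p, 0 < w p := fun p => lt_of_lt_of_le (by positivity) (hwc p)
  have hcd : ContDiff ℝ ∞ fun p => (w p)⁻¹ := (hw.contDiff ()).inv fun p => (hpos p).ne'
  refine SymbolFam.reindex (f := fun (_ : Unit) p => (w p)⁻¹) (g := fun _ => ())
    ⟨fun _ => hcd, fun j => ?_⟩
  induction j using Nat.strong_induction_on with
  | _ j ih =>
    match j with
    | 0 =>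
      refine hasSymbolBound_of_le c⁻¹ fun i p => ?_
      rw [norm_iteratedFDeriv_zero, norm_inv, Real.norm_eq_abs, abs_of_pos (hpos p), zpow_neg,
        ← mul_inv]
      exact inv_anti₀ (by positivity) (hwc p)
    | j + 1 =>
      have h2 := HasSymbolBound.bilinear (ContinuousLinearMap.lsmul ℝ ℝ) (n := -k + -k) (m := k)
        (f := fun (_ : Unit) p => (w p)⁻¹ * (w p)⁻¹) (g := fun _ => _root_.fderiv ℝ w)
        (fun _ : Unit => hcd.mul hcd) hw.fderiv.contDiff j
        (fun l hl => HasSymbolBound.bilinear (ContinuousLinearMap.mul ℝ ℝ) (n := -k) (m := -k)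
          (fun _ : Unit => hcd) (fun _ => hcd) l (fun i hi => ih i (by omega))
          (fun i hi => ih i (by omega)))
        (fun l _ => hw.fderiv.bound l)
      obtain ⟨C, h0, hC⟩ := h2
      refine ⟨C, h0, fun i p => ?_⟩
      have hC' := hC () p
      rw [show (-k + -k + k : ℤ) = -k by ring] at hC'
      rw [← norm_iteratedFDeriv_fderiv]
      have e : _root_.fderiv ℝ (fun p => (w p)⁻¹)
          = -fun p => ContinuousLinearMap.lsmul ℝ ℝ ((w p)⁻¹ * (w p)⁻¹) (_root_.fderiv ℝ w p) := by
        funext p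
        have hd := (((hw.contDiff ()).differentiable (by simp)) p).hasFDerivAt
        have h5 := ((hasDerivAt_inv (hpos p).ne').comp_hasFDerivAt p hd).fderiv
        change _root_.fderiv ℝ (fun p => (w p)⁻¹) p = _ at h5
        rw [h5]
        simp [pow_two]
      rw [e, iteratedFDeriv_neg_apply, norm_neg]
      exact hC'

end SymbolFam

end Symbols

/-! ### Fourier decay of symbols and the momentum weight -/

section Fourier

variable {d : ℕ} {ι E : Type*} [NormedAddCommGroup E] [NormedSpace ℂ E]

/-- The Fourier transform for the inner product `η`. -/
def ft (η : Matrix (Fin d) (Fin d) ℝ) (f : RVec d → E) (x : RVec d) : E :=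
  ∫ p : RVec d, Complex.exp (-(pairing η p x : ℂ) * Complex.I) • f p

lemma pairing_eq_inner (η : Matrix (Fin d) (Fin d) ℝ) (p x : RVec d) :
    pairing η p x = inner ℝ p (act η x) := by
  have h := Matrix.inner_toEuclideanCLM η p x
  rw [act, h]
  simp [pairing, dotProduct, Matrix.mulVec, Finset.mul_sum, mul_assoc]

lemma act_eq (η : Matrix (Fin d) (Fin d) ℝ) :
    (act η : RVec d → RVec d) = Matrix.toEuclideanCLM (n := Fin d) (𝕜 := ℝ) η := rfl

lemma continuous_act (η : Matrix (Fin d) (Fin d) ℝ) :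
    Continuous (act η : RVec d → RVec d) :=
  (Matrix.toEuclideanCLM (n := Fin d) (𝕜 := ℝ) η).continuous

@[fun_prop]
lemma continuous_pairing {X : Type*} [TopologicalSpace X] (η : Matrix (Fin d) (Fin d) ℝ)
    {f g : X → RVec d} (hf : Continuous f) (hg : Continuous g) :
    Continuous fun t => pairing η (f t) (g t) := by
  simp only [pairing_eq_inner]
  exact hf.inner ((continuous_act η).comp hg)

lemma norm_exp_pairing (η : Matrix (Fin d) (Fin d) ℝ) (p x : RVec d) :
    ‖Complex.exp (-(pairing η p x : ℂ) * Complex.I)‖ = 1 := by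
  have := Complex.norm_exp_ofReal_mul_I (-(pairing η p x))
  push_cast at this
  exact this

lemma integrable_phase (η : Matrix (Fin d) (Fin d) ℝ) {f : RVec d → E} (hf : Integrable f)
    (x : RVec d) :
    Integrable fun p : RVec d => Complex.exp (-(pairing η p x : ℂ) * Complex.I) • f p :=
  hf.bdd_smul 1 (Continuous.aestronglyMeasurable (by fun_prop))
    (Eventually.of_forall fun p => (norm_exp_pairing η p x).le)

/-- Nondegeneracy makes `‖x‖` and `‖ηx‖` comparable, so decay of the Euclidean Fourier transform
carries over to that of an indefinite inner product. -/
lemma exists_norm_le_act {η : Matrix (Fin d) (Fin d) ℝ} (hη : η.det ≠ 0) :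
    ∃ c : ℝ, 0 ≤ c ∧ ∀ x : RVec d, ‖x‖ ≤ c * ‖act η x‖ := by
  refine ⟨‖Matrix.toEuclideanCLM (n := Fin d) (𝕜 := ℝ) η⁻¹‖, norm_nonneg _, fun x => ?_⟩
  have h : Matrix.toEuclideanCLM (n := Fin d) (𝕜 := ℝ) η⁻¹ (act η x) = x := by
    rw [act_eq, ← mul_apply_eq_comp, ← map_mul,
      Matrix.nonsing_inv_mul _ (isUnit_iff_ne_zero.2 hη), map_one]
    rfl
  conv_lhs => rw [← h]
  exact ContinuousLinearMap.le_opNorm _ _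

open scoped FourierTransform in
lemma ft_eq_fourier (η : Matrix (Fin d) (Fin d) ℝ) (f : RVec d → E) (x : RVec d) :
    ft η f x = 𝓕 f ((2 * Real.pi)⁻¹ • act η x) := by
  rw [Real.fourier_eq', ft]
  congr 1; funext p
  rw [pairing_eq_inner, inner_smul_right]
  have : -2 * Real.pi * ((2 * Real.pi)⁻¹ * inner ℝ p (act η x)) = - inner ℝ p (act η x) := by
    field_simp
  rw [this]
  push_cast
  rfl

lemma integrable_weight (d : ℕ) :
    Integrable fun x : RVec d => (1 + ‖x‖) ^ (-((d : ℤ) + 1)) := by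
  have h := integrable_one_add_norm (E := RVec d) (μ := volume) (r := (d : ℝ) + 1) (by simp)
  refine h.congr (Eventually.of_forall fun x => ?_)
  change (1 + ‖x‖) ^ (-((d : ℝ) + 1)) = (1 + ‖x‖) ^ (-((d : ℤ) + 1))
  rw [← Real.rpow_intCast]
  push_cast
  rfl

lemma SymbolFam.integrable {F : Type*} [NormedAddCommGroup F] [NormedSpace ℝ F] {n : ℤ}
    {f : ι → RVec d → F} (hf : SymbolFam n f)
    (hn : n ≤ -((d : ℤ) + 1)) (i : ι) : Integrable (f i) := by
  obtain ⟨C, -, hC⟩ := (hf.mono hn).norm_le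
  exact ((integrable_weight d).const_mul C).mono' (hf.contDiff i).continuous.aestronglyMeasurable
    (Eventually.of_forall fun p => hC i p)

lemma norm_ft_le (η : Matrix (Fin d) (Fin d) ℝ) (f : RVec d → E) (x : RVec d) :
    ‖ft η f x‖ ≤ ∫ p, ‖f p‖ := by
  refine (norm_integral_le_integral_norm _).trans_eq ?_
  congr 1; funext p
  rw [norm_smul, norm_exp_pairing, one_mul]

lemma continuous_ft (η : Matrix (Fin d) (Fin d) ℝ) {f : RVec d → E} (hf : Integrable f) :
    Continuous (ft η f) := by
  refine continuous_of_dominated (bound := fun p => ‖f p‖) (fun x => ?_) (fun x => ?_) hf.norm ?_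
  · exact (integrable_phase η hf x).1
  · exact Eventually.of_forall fun p => by rw [norm_smul, norm_exp_pairing, one_mul]
  · exact Eventually.of_forall fun p => by fun_prop

open scoped FourierTransform in
/-- The Fourier transforms of a family of symbols of sufficiently negative order decay
integrably, uniformly in the family. -/
lemma SymbolFam.ft_decay {η : Matrix (Fin d) (Fin d) ℝ} (hη : η.det ≠ 0) {f : ι → RVec d → E}
    (hf : SymbolFam (-((d : ℤ) + 1)) f) :
    ∃ C, 0 ≤ C ∧ ∀ i x, ‖ft η (f i) x‖ ≤ C * (1 + ‖x‖) ^ (-((d : ℤ) + 1)) := by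
  choose B hB0 hB using hf.bound
  set I := ∫ x : RVec d, (1 + ‖x‖) ^ (-((d : ℤ) + 1)) with hI
  have hI0 : 0 ≤ I := integral_nonneg fun x => by positivity
  have hint : ∀ i j, Integrable fun p => ‖iteratedFDeriv ℝ j (f i) p‖ := fun i j =>
    (((integrable_weight d).const_mul (B j)).mono'
      ((hf.contDiff i).continuous_iteratedFDeriv (m := j) (mod_cast le_top)).aestronglyMeasurable
      (Eventually.of_forall fun p => hB j i p)).norm
  have hle : ∀ i j, ∫ p, ‖iteratedFDeriv ℝ j (f i) p‖ ≤ B j * I := fun i j => by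
    rw [hI, ← integral_const_mul]
    exact integral_mono (hint i j) ((integrable_weight d).const_mul _) (hB j i)
  -- Powers of `w` become derivatives of `f i`. Every derivative has the integrable order `-(d +
  -- 1)`, so its `L¹` norm is bounded uniformly in `i`.
  have key : ∀ n : ℕ, ∃ D, 0 ≤ D ∧ ∀ i w, ‖w‖ ^ n * ‖𝓕 (f i) w‖ ≤ D := by
    intro n
    refine ⟨2 ^ n * ∑ q ∈ Finset.range (n + 1), B q * I, ?_, fun i w => ?_⟩
    · exact mul_nonneg (by positivity) (Finset.sum_nonneg fun q _ => mul_nonneg (hB0 q) hI0)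
    have h := Real.pow_mul_norm_iteratedFDeriv_fourier_le (K := 0) (N := ⊤) (f := f i)
      (hf.contDiff i) (fun k n hk _ => by
        have : k = 0 := by simpa using hk
        subst this
        simpa using hint i n) (k := 0) (n := n) le_rfl le_top w
    simp only [norm_iteratedFDeriv_zero, pow_zero, one_mul, Nat.cast_zero, mul_zero, zero_add,
      Finset.range_one, Finset.sum_product, Finset.sum_singleton] at h
    refine h.trans ?_
    gcongr with q
    exact hle i q
  obtain ⟨c, hc0, hc⟩ := exists_norm_le_act hη
  obtain ⟨D, hD0, hD⟩ := key 0
  obtain ⟨D', hD0', hD'⟩ := key (d + 1)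
  -- `2 ^ d` comes from `(1 + t)^(d+1) ≤ 2^d (1 + t^(d+1))`, and `c * 2π` from `‖x‖ ≤ c ‖ηx‖` with
  -- `w = (2π)⁻¹ ηx`. Only the moments `0` and `d + 1` are needed.
  refine ⟨2 ^ d * (D + (c * (2 * Real.pi)) ^ (d + 1) * D'), by positivity, fun i x => ?_⟩
  rw [ft_eq_fourier, zpow_neg, ← div_eq_mul_inv, le_div_iff₀ (by positivity)]
  set w := (2 * Real.pi)⁻¹ • act η x with hw
  have hx : ‖x‖ ≤ c * (2 * Real.pi) * ‖w‖ := by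
    refine (hc x).trans_eq ?_
    rw [hw, norm_smul, Real.norm_of_nonneg (by positivity)]
    field_simp
  have h1 := hD i w
  have h2 := hD' i w
  have h3 : (1 + ‖x‖) ^ ((d : ℤ) + 1) ≤ 2 ^ d * (1 + ‖x‖ ^ (d + 1)) := by
    have := add_pow_le (zero_le_one (α := ℝ)) (norm_nonneg x) (d + 1)
    rw [one_pow, Nat.add_sub_cancel] at this
    exact_mod_cast this
  have h4 : ‖x‖ ^ (d + 1) ≤ (c * (2 * Real.pi)) ^ (d + 1) * ‖w‖ ^ (d + 1) := by
    rw [← mul_pow]; gcongr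
  calc ‖𝓕 (f i) w‖ * (1 + ‖x‖) ^ ((d : ℤ) + 1)
      ≤ ‖𝓕 (f i) w‖ * (2 ^ d * (1 + (c * (2 * Real.pi)) ^ (d + 1) * ‖w‖ ^ (d + 1))) := by
        gcongr
        refine h3.trans ?_
        gcongr
    _ = 2 ^ d * (‖w‖ ^ 0 * ‖𝓕 (f i) w‖
          + (c * (2 * Real.pi)) ^ (d + 1) * (‖w‖ ^ (d + 1) * ‖𝓕 (f i) w‖)) := by ring
    _ ≤ _ := by gcongr

/-- The function `1 + |P|^2` on the spectrum. -/
def momSq (η : Matrix (Fin d) (Fin d) ℝ) (p : RVec d) : ℝ :=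
  1 + ∑ j, pairing η p (basisVec j) ^ 2

lemma pairing_basisVec (η : Matrix (Fin d) (Fin d) ℝ) (p : RVec d) (j : Fin d) :
    pairing η p (basisVec j) = act η.transpose p j := by
  simp [pairing, basisVec, act, Matrix.ofLp_toEuclideanCLM, Matrix.mulVec, dotProduct, mul_comm,
    PiLp.single_apply]

lemma momSq_lower {η : Matrix (Fin d) (Fin d) ℝ} (hη : η.det ≠ 0) :
    ∃ c : ℝ, 0 < c ∧ ∀ p, c * (1 + ‖p‖) ^ (2 : ℤ) ≤ momSq η p := by
  obtain ⟨c, hc0, hc⟩ := exists_norm_le_act (η := η.transpose) (by rwa [Matrix.det_transpose])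
  -- From `(1 + ‖p‖)^2 ≤ 2 (1 + ‖p‖^2)` and `‖p‖ ≤ c ‖ηᵀp‖`, where `ηᵀp` is the vector of momenta.
  refine ⟨(2 * (1 + c ^ 2))⁻¹, by positivity, fun p => ?_⟩
  have h : momSq η p = 1 + ‖act η.transpose p‖ ^ 2 := by
    simp [momSq, pairing_basisVec, EuclideanSpace.norm_sq_eq]
  rw [inv_mul_le_iff₀ (by positivity), h]
  have h1 : ‖p‖ ^ 2 ≤ c ^ 2 * ‖act η.transpose p‖ ^ 2 := by
    rw [← mul_pow]; gcongr; exact hc p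
  norm_cast
  nlinarith [sq_nonneg (1 - ‖p‖), sq_nonneg c, sq_nonneg ‖act η.transpose p‖]

lemma momSq_pos (η : Matrix (Fin d) (Fin d) ℝ) (p : RVec d) : 0 < momSq η p := by
  have : 0 ≤ ∑ j, pairing η p (basisVec j) ^ 2 := Finset.sum_nonneg fun _ _ => sq_nonneg _
  unfold momSq; linarith

/-- The `j`-th momentum coordinate as a linear form. -/
def mom (η : Matrix (Fin d) (Fin d) ℝ) (j : Fin d) : RVec d →L[ℝ] ℝ :=
  (EuclideanSpace.proj j : RVec d →L[ℝ] ℝ) ∘L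
    Matrix.toEuclideanCLM (n := Fin d) (𝕜 := ℝ) η.transpose

lemma mom_apply (η : Matrix (Fin d) (Fin d) ℝ) (j : Fin d) (p : RVec d) :
    mom η j p = pairing η p (basisVec j) := by
  rw [pairing_basisVec]; rfl

lemma symbolFam_mom (η : Matrix (Fin d) (Fin d) ℝ) (j : Fin d) :
    SymbolFam 1 fun (_ : ι) p => ((pairing η p (basisVec j) : ℝ) : ℂ) := by
  simp only [← mom_apply]
  exact (SymbolFam.linear (mom η j)).clm Complex.ofRealCLM

lemma symbolFam_momSq (η : Matrix (Fin d) (Fin d) ℝ) :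
    SymbolFam (2 : ℕ) fun (_ : ι) p => momSq η p := by
  have h0 : SymbolFam (2 : ℕ) fun (_ : ι) (_ : RVec d) => (1 : ℝ) :=
    (SymbolFam.const (M := 1) fun _ => by simp).mono (by simp)
  have h1 : ∀ s : Finset (Fin d), SymbolFam (2 : ℕ) fun (_ : ι) (p : RVec d) =>
      1 + ∑ j ∈ s, pairing η p (basisVec j) ^ 2 := by
    intro s
    induction s using Finset.induction_on with
    | empty => simpa using h0
    | insert j s hj ih =>
      have h2 := (SymbolFam.linear (ι := ι) (mom η j)).bilinear (ContinuousLinearMap.mul ℝ ℝ)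
        (SymbolFam.linear (mom η j))
      have h3 := h2.add ih
      simp only [Finset.sum_insert hj]
      convert h3 using 3 with i p
      · norm_num
      rw [ContinuousLinearMap.mul_apply', mom_apply]; ring
  exact h1 Finset.univ

lemma symbolFam_momSq_inv {η : Matrix (Fin d) (Fin d) ℝ} (hη : η.det ≠ 0) :
    SymbolFam (-2) fun (_ : ι) p => (((momSq η p)⁻¹ : ℝ) : ℂ) := by
  obtain ⟨c, hc0, hc⟩ := momSq_lower hη
  exact ((symbolFam_momSq η).inv (ι := ι) hc0 hc).clm Complex.ofRealCLM

lemma symbolFam_momSq_inv_pow {η : Matrix (Fin d) (Fin d) ℝ} (hη : η.det ≠ 0) (k : ℕ) :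
    SymbolFam (-2 * k) fun (_ : ι) p => (((momSq η p)⁻¹ : ℝ) : ℂ) ^ k := by
  induction k with
  | zero => simpa using (SymbolFam.const (M := 1) fun _ => by simp)
  | succ k ih =>
    have := ih.mul_complex (symbolFam_momSq_inv hη)
    simp only [pow_succ]
    convert this using 1
    push_cast; ring

end Fourier

/-! ### Absolute convergence and limits of spectral integrals -/

section SpectralBounds

variable {d : ℕ} {ι H : Type*} [NormedAddCommGroup H] [InnerProductSpace ℂ H]

lemma spectralIntegral_eq (U : TranslationRep d H) (η : Matrix (Fin d) (Fin d) ℝ)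
    (g : RVec d → H) :
    spectralIntegral U η g = (|η.det| / (2 * Real.pi) ^ d) • ∫ x, U x (ft η g x) := rfl

lemma ft_const_smul (η : Matrix (Fin d) (Fin d) ℝ) (c : ℂ) (g : RVec d → H) (x : RVec d) :
    ft η (fun p => c • g p) x = c • ft η g x := by
  simp only [ft, smul_comm _ c, integral_smul]

lemma ft_add (η : Matrix (Fin d) (Fin d) ℝ) {g g' : RVec d → H} (hg : Integrable g)
    (hg' : Integrable g') (x : RVec d) :
    ft η (fun p => g p + g' p) x = ft η g x + ft η g' x := by
  simp only [ft, smul_add]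
  exact integral_add (integrable_phase η hg x) (integrable_phase η hg' x)

lemma spectralIntegral_const_smul (U : TranslationRep d H) (η : Matrix (Fin d) (Fin d) ℝ) (c : ℂ)
    (g : RVec d → H) :
    spectralIntegral U η (fun p => c • g p) = c • spectralIntegral U η g := by
  simp only [spectralIntegral_eq, ft_const_smul, map_smul, integral_smul]
  rw [smul_comm]

variable {η : Matrix (Fin d) (Fin d) ℝ}

namespace SymbolFam

lemma continuous_apply_ft (U : TranslationRep d H) {n : ℤ} {f : ι → RVec d → H}
    (hf : SymbolFam n f) (hn : n ≤ -((d : ℤ) + 1)) (i : ι) :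
    Continuous fun x => U x (ft η (f i) x) :=
  continuous_apply U continuous_id (continuous_ft η (hf.integrable hn i))

lemma integrable_apply_ft (hη : η.det ≠ 0) (U : TranslationRep d H) {n : ℤ}
    {f : ι → RVec d → H} (hf : SymbolFam n f) (hn : n ≤ -((d : ℤ) + 1)) (i : ι) :
    Integrable fun x => U x (ft η (f i) x) := by
  obtain ⟨C, -, hC⟩ := (hf.mono hn).ft_decay hη
  exact ((integrable_weight d).const_mul C).mono'
    (hf.continuous_apply_ft U hn i).aestronglyMeasurable
    (Eventually.of_forall fun x => by rw [LinearIsometryEquiv.norm_map]; exact hC i x)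

lemma norm_spectralIntegral_le (hη : η.det ≠ 0) (U : TranslationRep d H) {n : ℤ}
    {f : ι → RVec d → H} (hf : SymbolFam n f) (hn : n ≤ -((d : ℤ) + 1)) :
    ∃ C, 0 ≤ C ∧ ∀ i, ‖spectralIntegral U η (f i)‖ ≤ C := by
  obtain ⟨C, h0, hC⟩ := (hf.mono hn).ft_decay hη
  have hI0 : 0 ≤ ∫ x : RVec d, (1 + ‖x‖) ^ (-((d : ℤ) + 1)) :=
    integral_nonneg fun x => by positivity
  refine ⟨|η.det| / (2 * Real.pi) ^ d * (C * ∫ x : RVec d, (1 + ‖x‖) ^ (-((d : ℤ) + 1))),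
    by positivity, fun i => ?_⟩
  rw [spectralIntegral_eq, norm_smul, Real.norm_of_nonneg (by positivity)]
  gcongr
  rw [← integral_const_mul]
  refine norm_integral_le_of_norm_le ((integrable_weight d).const_mul C)
    (Eventually.of_forall fun x => ?_)
  rw [LinearIsometryEquiv.norm_map]
  exact hC i x

/-- Dominated convergence twice: in `p`, by the symbol bound, for the Fourier transforms, then in
`x`, by their uniform decay. Pointwise convergence of the symbols themselves is enough. -/
lemma tendsto_spectralIntegral (hη : η.det ≠ 0) (U : TranslationRep d H) {n : ℤ}
    {f : ι → RVec d → H} (hf : SymbolFam n f) (hn : n ≤ -((d : ℤ) + 1)) {l : Filter ι}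
    [l.IsCountablyGenerated] {g : RVec d → H} (h : ∀ p, Tendsto (fun i => f i p) l (𝓝 (g p))) :
    Tendsto (fun i => spectralIntegral U η (f i)) l (𝓝 (spectralIntegral U η g)) := by
  obtain ⟨C, -, hC⟩ := (hf.mono hn).ft_decay hη
  obtain ⟨D, -, hD⟩ := (hf.mono hn).norm_le
  have h1 : ∀ x, Tendsto (fun i => ft η (f i) x) l (𝓝 (ft η g x)) := by
    intro x
    refine tendsto_integral_filter_of_dominated_convergence
      (fun p => D * (1 + ‖p‖) ^ (-((d : ℤ) + 1))) ?_ ?_ ((integrable_weight d).const_mul D) ?_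
    · exact Eventually.of_forall fun i => (integrable_phase η (hf.integrable hn i) x).1
    · refine Eventually.of_forall fun i => Eventually.of_forall fun p => ?_
      rw [norm_smul, norm_exp_pairing, one_mul]
      exact hD i p
    · exact Eventually.of_forall fun p => (h p).const_smul _
  simp only [spectralIntegral_eq]
  refine Tendsto.const_smul (tendsto_integral_filter_of_dominated_convergence
      (fun x => C * (1 + ‖x‖) ^ (-((d : ℤ) + 1))) ?_ ?_ ((integrable_weight d).const_mul C) ?_) _
  · exact Eventually.of_forall fun i => (hf.continuous_apply_ft U hn i).aestronglyMeasurable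
  · refine Eventually.of_forall fun i => Eventually.of_forall fun x => ?_
    rw [LinearIsometryEquiv.norm_map]
    exact hC i x
  · exact Eventually.of_forall fun x => ((U x).continuous.tendsto _).comp (h1 x)

lemma spectralIntegral_add (hη : η.det ≠ 0) (U : TranslationRep d H) {n : ℤ}
    {f g : ι → RVec d → H} (hf : SymbolFam n f) (hg : SymbolFam n g) (hn : n ≤ -((d : ℤ) + 1))
    (i : ι) :
    spectralIntegral U η (fun p => f i p + g i p)
      = spectralIntegral U η (f i) + spectralIntegral U η (g i) := by
  simp only [spectralIntegral_eq, ft_add η (hf.integrable hn i) (hg.integrable hn i), map_add]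
  rw [integral_add (hf.integrable_apply_ft hη U hn i) (hg.integrable_apply_ft hη U hn i), smul_add]

lemma zero {F : Type*} [NormedAddCommGroup F] [NormedSpace ℝ F] (n : ℤ) :
    SymbolFam (d := d) n fun (_ : ι) _ => (0 : F) :=
  ⟨fun _ => contDiff_const, fun j => ⟨0, le_rfl, fun i p => by
    rw [show (fun _ : RVec d => (0 : F)) = 0 from rfl, iteratedFDeriv_zero]; simp⟩⟩

lemma sum {F κ : Type*} [NormedAddCommGroup F] [NormedSpace ℝ F] {n : ℤ} (s : Finset κ)
    {f : κ → ι → RVec d → F} (hf : ∀ k, SymbolFam n (f k)) :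
    SymbolFam n fun i p => ∑ k ∈ s, f k i p := by
  classical
  induction s using Finset.induction_on with
  | empty => simpa using zero n
  | insert k s hk ih =>
    simp only [Finset.sum_insert hk]
    exact (hf k).add ih

lemma spectralIntegral_sum {κ : Type*} (hη : η.det ≠ 0) (U : TranslationRep d H) {n : ℤ}
    (s : Finset κ) {f : κ → ι → RVec d → H} (hf : ∀ k, SymbolFam n (f k))
    (hn : n ≤ -((d : ℤ) + 1)) (i : ι) :
    spectralIntegral U η (fun p => ∑ k ∈ s, f k i p)
      = ∑ k ∈ s, spectralIntegral U η (f k i) := by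
  classical
  induction s using Finset.induction_on with
  | empty => simp [spectralIntegral]
  | insert k s hk ih =>
    simp only [Finset.sum_insert hk]
    rw [(hf k).spectralIntegral_add hη U (sum s hf) hn i, ih]

end SymbolFam

lemma apply_spectralIntegral [CompleteSpace H] (U : TranslationRep d H) {g : RVec d → H}
    (hg : Integrable g) (h : Integrable fun x => U x (ft η g x)) (y : RVec d) :
    U y (spectralIntegral U η g) = spectralIntegral U η fun p => U y (g p) := by
  have e : ∀ x, ft η (fun p => U y (g p)) x = U y (ft η g x) := by
    intro x
    rw [ft, ft, apply_integral U y (integrable_phase η hg x)]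
    simp only [map_smul]
  have e2 : U y (spectralIntegral U η g) = (|η.det| / (2 * Real.pi) ^ d) •
      U y (∫ x, U x (ft η g x)) := ((opU U y).restrictScalars ℝ).map_smul _ _
  rw [e2, apply_integral U y h, spectralIntegral_eq]
  simp only [e, apply_comm U y]

end SpectralBounds

/-! ### Trading momenta for generators -/

section IntegrationByParts

variable {d : ℕ} {H : Type*} [NormedAddCommGroup H] [InnerProductSpace ℂ H]
variable {η : Matrix (Fin d) (Fin d) ℝ}

lemma pairing_add_smul (η : Matrix (Fin d) (Fin d) ℝ) (p x y : RVec d) (t : ℝ) :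
    pairing η p (x + t • y) = pairing η p x + t * pairing η p y := by
  simp only [pairing_eq_inner, act_eq, map_add, map_smul, inner_add_right, inner_smul_right]

lemma hasDerivAt_orbit_line (U : TranslationRep d H) (ψ : smoothVectors U) (j : Fin d)
    (x : RVec d) (t : ℝ) :
    HasDerivAt (fun s : ℝ => U (x + s • basisVec j) (ψ : H))
      (Complex.I • U (x + t • basisVec j) (generator U j ψ : H)) t := by
  rw [← fderiv_orbit_basisVec]
  have h1 := ((contDiff_orbit U ψ).differentiable (by simp) (x + t • basisVec j)).hasFDerivAt
  have h2 : HasDerivAt (fun s : ℝ => x + s • basisVec j) (basisVec j) t := by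
    simpa using ((hasDerivAt_id t).smul_const (basisVec j)).const_add x
  exact h1.comp_hasDerivAt t h2

/-- Integration by parts in the spectral integral: the generator acts as multiplication by the
momentum. -/
lemma spectralIntegral_generator [CompleteSpace H] (hη : η.det ≠ 0) (U : TranslationRep d H) (j : Fin d)
    {h : RVec d → ℂ} {V : RVec d → smoothVectors U} {n : ℤ} (hn : n ≤ -((d : ℤ) + 1))
    (h0 : SymbolFam n fun (_ : Unit) p => h p • (V p : H))
    (h1 : SymbolFam n fun (_ : Unit) p =>
      (h p * ((pairing η p (basisVec j) : ℝ) : ℂ)) • (V p : H))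
    (h2 : SymbolFam n fun (_ : Unit) p => h p • (generator U j (V p) : H)) :
    spectralIntegral U η (fun p => (h p * ((pairing η p (basisVec j) : ℝ) : ℂ)) • (V p : H))
      = spectralIntegral U η (fun p => h p • (generator U j (V p) : H)) := by
  set f0 : RVec d → H := fun p => h p • (V p : H) with hf0
  set f1 : RVec d → H := fun p => (h p * ((pairing η p (basisVec j) : ℝ) : ℂ)) • (V p : H) with hf1
  set f2 : RVec d → H := fun p => h p • (generator U j (V p) : H) with hf2
  have i0 : Integrable f0 := h0.integrable hn ()
  have i1 : Integrable f1 := h1.integrable hn ()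
  have i2 : Integrable f2 := h2.integrable hn ()
  have J0 := h0.integrable_apply_ft hη U hn ()
  have J1 := h1.integrable_apply_ft hη U hn ()
  have J2 := h2.integrable_apply_ft hη U hn ()
  -- The derivative falls on `U(x)`, which yields `i P_j` on the integrand, and on the phase, which
  -- yields `-i p_j`.
  have hder : ∀ x, HasLineDerivAt ℝ (fun x => U x (ft η f0 x))
      (Complex.I • (U x (ft η f2 x) - U x (ft η f1 x))) x (basisVec j) := by
    intro x
    have e : ∀ t : ℝ, U (x + t • basisVec j) (ft η f0 (x + t • basisVec j)) =
        ∫ p, Complex.exp (-(pairing η p (x + t • basisVec j) : ℂ) * Complex.I) •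
          h p • U (x + t • basisVec j) (V p : H) := by
      intro t
      rw [ft, apply_integral U _ (integrable_phase η i0 _)]
      simp only [hf0, map_smul]
    have e' : Complex.I • (U x (ft η f2 x) - U x (ft η f1 x)) =
        ∫ p, Complex.exp (-(pairing η p (x + (0 : ℝ) • basisVec j) : ℂ) * Complex.I) •
          (Complex.I • U (x + (0 : ℝ) • basisVec j) (f2 p - f1 p)) := by
      simp only [zero_smul, add_zero, ft]
      rw [apply_integral U _ (integrable_phase η i2 _), apply_integral U _ (integrable_phase η i1 _),
        ← integral_sub, ← integral_smul]
      · congr 1; funext p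
        simp only [map_smul, map_sub, smul_sub]
        simp only [smul_comm Complex.I]
      · exact (opU U x).integrable_comp (integrable_phase η i2 _)
      · exact (opU U x).integrable_comp (integrable_phase η i1 _)
    rw [HasLineDerivAt, e']
    simp only [e]
    refine (hasDerivAt_integral_of_dominated_loc_of_deriv_le (s := Set.univ)
      (bound := fun p => ‖f2 p‖ + ‖f1 p‖)
      (F' := fun t p => Complex.exp (-(pairing η p (x + t • basisVec j) : ℂ) * Complex.I) •
          (Complex.I • U (x + t • basisVec j) (f2 p - f1 p)))
      Filter.univ_mem ?_ ?_ ?_ ?_ (i2.norm.add i1.norm) ?_).2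
    · refine Eventually.of_forall fun t => ?_
      have := ((opU U (x + t • basisVec j)).integrable_comp i0).1
      refine AEStronglyMeasurable.smul (Continuous.aestronglyMeasurable (by fun_prop)) ?_
      simpa [hf0] using this
    · have := ((opU U (x + (0 : ℝ) • basisVec j)).integrable_comp i0)
      simp only [hf0, opU_apply, map_smul] at this
      exact integrable_phase η this _
    · refine AEStronglyMeasurable.smul (Continuous.aestronglyMeasurable (by fun_prop)) ?_
      exact ((opU U (x + (0 : ℝ) • basisVec j)).integrable_comp (i2.sub i1)).1.const_smul _
    · refine Eventually.of_forall fun p t _ => ?_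
      rw [norm_smul, norm_exp_pairing, one_mul, norm_smul, Complex.norm_I, one_mul,
        LinearIsometryEquiv.norm_map]
      exact norm_sub_le _ _
    · refine Eventually.of_forall fun p t _ => ?_
      have d1 := hasDerivAt_orbit_line U (V p) j x t
      have d2 : HasDerivAt (fun s : ℝ =>
          Complex.exp (-(pairing η p (x + s • basisVec j) : ℂ) * Complex.I))
          (Complex.exp (-(pairing η p (x + t • basisVec j) : ℂ) * Complex.I) *
            (-(pairing η p (basisVec j) : ℂ) * Complex.I)) t := by
        refine HasDerivAt.cexp ?_
        simp only [pairing_add_smul]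
        push_cast
        have : HasDerivAt (fun s : ℝ => (s : ℂ)) 1 t := Complex.ofRealCLM.hasDerivAt
        have := (((this.mul_const (pairing η p (basisVec j) : ℂ)).const_add
          (pairing η p x : ℂ)).neg).mul_const Complex.I
        simpa using this
      have d3 := d2.smul (d1.const_smul (h p))
      refine HasDerivAt.congr_deriv (f' := _) (h := d3) ?_
      simp only [Pi.smul_apply, hf1, hf2, map_sub, map_smul, smul_sub, smul_smul]
      rw [sub_eq_add_neg, ← neg_smul]
      congr 2 <;> ring
  -- Integration by parts against the constant `1`: the integral of a directional derivative
  -- vanishes when the function and the derivative are integrable.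
  have hz := integral_bilinear_hasLineDerivAt_right_eq_neg_left_of_integrable
    (μ := (volume : Measure (RVec d))) (v := basisVec j)
    (B := (ContinuousLinearMap.lsmul ℝ ℝ : ℝ →L[ℝ] H →L[ℝ] H)) (f := fun _ => (1 : ℝ))
    (f' := fun _ => (0 : ℝ)) (g := fun x => U x (ft η f0 x))
    (g' := fun x => Complex.I • (U x (ft η f2 x) - U x (ft η f1 x)))
    (by simp) (by
      simp only [ContinuousLinearMap.lsmul_apply, one_smul]
      exact (J2.sub J1).smul Complex.I) (by simpa using J0)
    (fun x _ => by simpa using hasFDerivAt_const (1 : ℝ) x |>.hasLineDerivAt (basisVec j))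
    (fun x _ => hder x)
  simp only [ContinuousLinearMap.lsmul_apply, one_smul, zero_smul, integral_zero, neg_zero] at hz
  rw [integral_smul, smul_eq_zero_iff_right Complex.I_ne_zero, integral_sub J2 J1, sub_eq_zero] at hz
  rw [spectralIntegral_eq, spectralIntegral_eq, hz]

end IntegrationByParts

/-! ### Translates of smooth operators as symbols, and regularization by `1 + |P|^2` -/

section OrbitSymbols

variable {d : ℕ} {ι H : Type*} [NormedAddCommGroup H] [InnerProductSpace ℂ H]
variable {U : TranslationRep d H} {C : H →L[ℂ] H} {η : Matrix (Fin d) (Fin d) ℝ}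

/-- The action of a matrix as a continuous linear map. -/
def actL (Q : Matrix (Fin d) (Fin d) ℝ) : RVec d →L[ℝ] RVec d :=
  Matrix.toEuclideanCLM (n := Fin d) (𝕜 := ℝ) Q

@[simp] lemma actL_apply (Q : Matrix (Fin d) (Fin d) ℝ) (p : RVec d) : actL Q p = act Q p := rfl

lemma IsSmoothBdd.symbolFam_conjOp (hC : IsSmoothBdd U C) :
    SymbolFam 0 fun (_ : ι) x => conjOp U x C :=
  SymbolFam.of_covariant hC (conjIsom U) fun x y => by simp [conjOp_conjOp]

lemma SymbolFam.op_apply {n m : ℤ} {B : ι → RVec d → (H →L[ℂ] H)} {f : ι → RVec d → H}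
    (hB : SymbolFam n B) (hf : SymbolFam m f) : SymbolFam (n + m) fun i p => B i p (f i p) :=
  SymbolFam.bilinear realOp hB hf

lemma IsSmoothBdd.symbolFam_conjOp_act (hC : IsSmoothBdd U C) (Q : Matrix (Fin d) (Fin d) ℝ)
    (a : ι → RVec d) :
    SymbolFam 0 fun (i : ι) p => conjOp U (a i + act Q p) C :=
  (hC.symbolFam_conjOp (ι := Unit)).comp_affine (fun _ => ()) a (fun _ => actL Q)
    (c := ‖actL Q‖) fun _ => le_rfl

/-- The vectors `α_{Qp}(C) ψ` for a smooth bounded operator `C` and a smooth vector `ψ`. -/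
def IsSmoothBdd.conjVec (hC : IsSmoothBdd U C) (Q : Matrix (Fin d) (Fin d) ℝ)
    (ψ : smoothVectors U) (p : RVec d) : smoothVectors U :=
  (hC.conj (act Q p)).toEnd ψ

lemma IsSmoothBdd.coe_conjVec (hC : IsSmoothBdd U C) (Q : Matrix (Fin d) (Fin d) ℝ)
    (ψ : smoothVectors U) (p : RVec d) :
    (hC.conjVec Q ψ p : H) = conjOp U (act Q p) C ψ := rfl

lemma IsSmoothBdd.conjVec_eq (hC : IsSmoothBdd U C) (Q : Matrix (Fin d) (Fin d) ℝ)
    (ψ : smoothVectors U) (p : RVec d) :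
    hC.conjVec Q ψ p = translate U (act Q p) (hC.toEnd (translate U (-act Q p) ψ)) := rfl

lemma IsSmoothBdd.symbolFam_conjVec (hC : IsSmoothBdd U C) (Q : Matrix (Fin d) (Fin d) ℝ)
    (ψ : smoothVectors U) : SymbolFam 0 fun (_ : ι) p => (hC.conjVec Q ψ p : H) := by
  have h := (hC.symbolFam_conjOp_act (ι := ι) Q fun _ => 0).op_apply
    (SymbolFam.const (v := fun _ => (ψ : H)) (M := ‖(ψ : H)‖) fun _ => le_rfl)
  simpa only [zero_add, hC.coe_conjVec, add_zero] using h

/-- Generators commute with translations, so `[P_j, α_{Qp}(C)] = α_{Qp}([P_j, C])`, which is bounded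
in `p`. -/
lemma IsSmoothBdd.generator_conjVec (hC : IsSmoothBdd U C) (Q : Matrix (Fin d) (Fin d) ℝ)
    (j : Fin d) (ψ : smoothVectors U) (p : RVec d) :
    generator U j (hC.conjVec Q ψ p) = hC.conjVec Q (generator U j ψ) p +
      ((hC.fderiv (basisVec j)).smul (-Complex.I)).conjVec Q ψ p := by
  rw [hC.conjVec_eq, generator_translate, hC.generator_toEnd, generator_translate, map_add]
  rfl

lemma IsSmoothBdd.symbolFam_generator_conjVec (hC : IsSmoothBdd U C)
    (Q : Matrix (Fin d) (Fin d) ℝ) (j : Fin d) (ψ : smoothVectors U) :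
    SymbolFam 0 fun (_ : ι) p => (generator U j (hC.conjVec Q ψ p) : H) := by
  simp only [hC.generator_conjVec, Submodule.coe_add]
  exact (hC.symbolFam_conjVec _ _).add (IsSmoothBdd.symbolFam_conjVec _ _ _)

lemma IsSmoothBdd.symbolFam_generator_generator_conjVec (hC : IsSmoothBdd U C)
    (Q : Matrix (Fin d) (Fin d) ℝ) (j : Fin d) (ψ : smoothVectors U) :
    SymbolFam 0 fun (_ : ι) p => (generator U j (generator U j (hC.conjVec Q ψ p)) : H) := by
  simp only [hC.generator_conjVec Q j ψ, map_add, Submodule.coe_add]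
  exact (hC.symbolFam_generator_conjVec _ _ _).add (IsSmoothBdd.symbolFam_generator_conjVec _ _ _ _)

variable [CompleteSpace H]

/-- Two integrations by parts in each coordinate. Requiring every order `n` for `h` absorbs the
growing momentum factors that occur in between. -/
lemma spectralIntegral_onePlusPSq (hη : η.det ≠ 0) (U : TranslationRep d H)
    {V : RVec d → smoothVectors U} {h : RVec d → ℂ}
    (hV : SymbolFam 0 fun (_ : Unit) p => (V p : H))
    (hV1 : ∀ j, SymbolFam 0 fun (_ : Unit) p => (generator U j (V p) : H))
    (hV2 : ∀ j, SymbolFam 0 fun (_ : Unit) p => (generator U j (generator U j (V p)) : H))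
    (hh : ∀ n, SymbolFam n fun (_ : Unit) => h) :
    spectralIntegral U η (fun p => (h p * ((momSq η p : ℝ) : ℂ)) • (V p : H))
      = spectralIntegral U η (fun p => h p • (onePlusPSq U (V p) : H)) := by
  set N : ℤ := -((d : ℤ) + 1) with hN
  have hm : ∀ j, ∀ n, SymbolFam n fun (_ : Unit) p =>
      h p * ((pairing η p (basisVec j) : ℝ) : ℂ) := fun j n => by
    have := (hh (n - 1)).mul_complex (symbolFam_mom (ι := Unit) η j)
    rwa [sub_add_cancel] at this
  have hmm : ∀ j, ∀ n, SymbolFam n fun (_ : Unit) p =>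
      h p * ((pairing η p (basisVec j) : ℝ) : ℂ) * ((pairing η p (basisVec j) : ℝ) : ℂ) :=
    fun j n => by
      have := (hm j (n - 1)).mul_complex (symbolFam_mom (ι := Unit) η j)
      rwa [sub_add_cancel] at this
  have s0 : SymbolFam N fun (_ : Unit) p => h p • (V p : H) := by
    simpa using (hh N).smul_complex hV
  have s1 : ∀ j, SymbolFam N fun (_ : Unit) p =>
      (h p * ((pairing η p (basisVec j) : ℝ) : ℂ)) • (V p : H) := fun j => by
    simpa using (hm j N).smul_complex hV
  have s2 : ∀ j, SymbolFam N fun (_ : Unit) p =>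
      (h p * ((pairing η p (basisVec j) : ℝ) : ℂ) * ((pairing η p (basisVec j) : ℝ) : ℂ)) •
        (V p : H) := fun j => by
    simpa using (hmm j N).smul_complex hV
  have t0 : ∀ j, SymbolFam N fun (_ : Unit) p => h p • (generator U j (V p) : H) := fun j => by
    simpa using (hh N).smul_complex (hV1 j)
  have t1 : ∀ j, SymbolFam N fun (_ : Unit) p =>
      (h p * ((pairing η p (basisVec j) : ℝ) : ℂ)) • (generator U j (V p) : H) := fun j => by
    simpa using (hm j N).smul_complex (hV1 j)
  have u0 : ∀ j, SymbolFam N fun (_ : Unit) p =>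
      h p • (generator U j (generator U j (V p)) : H) := fun j => by
    simpa using (hh N).smul_complex (hV2 j)
  have e1 : (fun p => (h p * ((momSq η p : ℝ) : ℂ)) • (V p : H)) = fun p => h p • (V p : H) +
      ∑ j, (h p * ((pairing η p (basisVec j) : ℝ) : ℂ) * ((pairing η p (basisVec j) : ℝ) : ℂ)) •
        (V p : H) := by
    funext p
    rw [← Finset.sum_smul, ← add_smul]
    congr 1
    simp only [momSq, Complex.ofReal_add, Complex.ofReal_one, Complex.ofReal_sum, mul_add, mul_one,
      Finset.mul_sum, Complex.ofReal_mul, pow_two, mul_assoc]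
  have e2 : (fun p => h p • (onePlusPSq U (V p) : H)) = fun p => h p • (V p : H) +
      ∑ j, h p • (generator U j (generator U j (V p)) : H) := by
    funext p
    rw [coe_onePlusPSq, smul_add, Finset.smul_sum]
  rw [e1, e2, s0.spectralIntegral_add hη U (SymbolFam.sum Finset.univ s2) le_rfl (),
    s0.spectralIntegral_add hη U (SymbolFam.sum Finset.univ u0) le_rfl (),
    SymbolFam.spectralIntegral_sum hη U _ s2 le_rfl (),
    SymbolFam.spectralIntegral_sum hη U _ u0 le_rfl ()]
  congr 1
  refine Finset.sum_congr rfl fun j _ => ?_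
  rw [spectralIntegral_generator hη U j le_rfl (s1 j) (s2 j) (t1 j),
    spectralIntegral_generator hη U j le_rfl (t0 j) (t1 j) (u0 j)]

/-- Powers of `1 + |P|^2` regularize the spectral integral of `α_{Qp}(C) ψ`. -/
lemma IsSmoothBdd.exists_spectralIntegral_regularized (hη : η.det ≠ 0) (hC : IsSmoothBdd U C)
    (Q : Matrix (Fin d) (Fin d) ℝ) (k : ℕ) :
    ∃ (C' : H →L[ℂ] H), IsSmoothBdd U C' ∧ ∀ (h : RVec d → ℂ) (ψ : smoothVectors U),
      (∀ n, SymbolFam n fun (_ : Unit) => h) →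
      spectralIntegral U η (fun p => h p • conjOp U (act Q p) C ψ) =
        spectralIntegral U η (fun p => h p • (((momSq η p)⁻¹ : ℝ) : ℂ) ^ k •
          conjOp U (act Q p) C' ((onePlusPSq U ^ k) ψ : H)) := by
  induction k with
  | zero => exact ⟨C, hC, fun h ψ _ => by simp⟩
  | succ k ih =>
    obtain ⟨C', hC', hk⟩ := ih
    obtain ⟨C'', hC'', hk'⟩ := hC'.exists_onePlusPSq_comm
    refine ⟨C'', hC'', fun h ψ hh => ?_⟩
    rw [hk h ψ hh]
    set χ := (onePlusPSq U ^ k) ψ with hχ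
    have hh' : ∀ n, SymbolFam n fun (_ : Unit) p =>
        h p * (((momSq η p)⁻¹ : ℝ) : ℂ) ^ (k + 1) := fun n => by
      have := (hh (n - (-2 * (k + 1 : ℕ)))).mul_complex
        (symbolFam_momSq_inv_pow (ι := Unit) hη (k + 1))
      rwa [sub_add_cancel] at this
    -- The cutoff is taken to be `h` times `(1 + |p|^2)^(-(k+1))`; one factor `1 + |p|^2` restores
    -- the exponent `k` and is exchanged for the operator `1 + |P|^2` on the vector.
    have key := spectralIntegral_onePlusPSq hη U (V := hC'.conjVec Q χ)
      (hC'.symbolFam_conjVec _ _) (fun j => hC'.symbolFam_generator_conjVec _ j _)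
      (fun j => hC'.symbolFam_generator_generator_conjVec _ j _) hh'
    have e1 : ∀ p, (h p * (((momSq η p)⁻¹ : ℝ) : ℂ) ^ (k + 1) * ((momSq η p : ℝ) : ℂ)) •
        (hC'.conjVec Q χ p : H) = h p • (((momSq η p)⁻¹ : ℝ) : ℂ) ^ k •
          conjOp U (act Q p) C' (χ : H) := fun p => by
      have : ((momSq η p : ℝ) : ℂ) ≠ 0 := Complex.ofReal_ne_zero.2 (momSq_pos η p).ne'
      rw [smul_smul, hC'.coe_conjVec]
      congr 1
      rw [Complex.ofReal_inv, pow_succ, mul_assoc, mul_assoc, inv_mul_cancel₀ this, mul_one]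
    have e2 : ∀ p, (h p * (((momSq η p)⁻¹ : ℝ) : ℂ) ^ (k + 1)) •
        (onePlusPSq U (hC'.conjVec Q χ p) : H) = h p • (((momSq η p)⁻¹ : ℝ) : ℂ) ^ (k + 1) •
          conjOp U (act Q p) C'' ((onePlusPSq U ^ (k + 1)) ψ : H) := fun p => by
      rw [smul_smul, hC'.conjVec_eq, onePlusPSq_translate, coe_translate, hk',
        onePlusPSq_translate, pow_succ' (onePlusPSq U), Module.End.mul_apply]
      rfl
    simp only [e1, e2] at key
    exact key

end OrbitSymbols

/-! ### Weighted spectral integrals as bounded operators -/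

section WeightedOp

variable {d : ℕ} {ι H : Type*} [NormedAddCommGroup H] [InnerProductSpace ℂ H]
variable {U : TranslationRep d H} {η : Matrix (Fin d) (Fin d) ℝ}

/-- The weight `(1 + |p|^2)^{-(d+1)}` with respect to the momenta. -/
def weight (η : Matrix (Fin d) (Fin d) ℝ) (p : RVec d) : ℂ := (((momSq η p)⁻¹ : ℝ) : ℂ) ^ (d + 1)

lemma symbolFam_weight (hη : η.det ≠ 0) :
    SymbolFam (-((d : ℤ) + 1)) fun (_ : ι) => weight η :=
  (symbolFam_momSq_inv_pow hη (d + 1)).mono (by push_cast; linarith)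

/-- A spectral integral of bounded operators which is bounded in norm, uniformly in families of
symbols. -/
lemma SymbolFam.norm_weighted_le (hη : η.det ≠ 0) (U : TranslationRep d H)
    {b : ι → RVec d → (H →L[ℂ] H)} (hb : SymbolFam 0 b) {ρ : RVec d → ℂ}
    (hρ : SymbolFam (-((d : ℤ) + 1)) fun (_ : Unit) => ρ) :
    ∃ C, 0 ≤ C ∧ ∀ i v, ‖spectralIntegral U η fun p => ρ p • b i p v‖ ≤ C * ‖v‖ := by
  -- The normalized vector is made part of the index. Uniformity over the enlarged family is then a
  -- bound on the operator norm; for `v = 0` the normalization gives `0`.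
  have h1 : SymbolFam 0 fun (i : ι × H) (_ : RVec d) => ((‖i.2‖⁻¹ : ℝ) : ℂ) • i.2 := by
    refine SymbolFam.const (M := 1) fun i => ?_
    rw [norm_smul, Complex.norm_real, norm_inv, norm_norm]
    exact inv_mul_le_one
  have h2 := (hρ.reindex fun (_ : ι × H) => ()).smul_complex
    ((hb.reindex fun i : ι × H => i.1).op_apply h1)
  obtain ⟨C, h0, hC⟩ := h2.norm_spectralIntegral_le hη U (by simp)
  refine ⟨C, h0, fun i v => ?_⟩
  rcases eq_or_ne v 0 with rfl | hv
  · simp [spectralIntegral]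
  · have := hC (i, v)
    simp only [map_smul, smul_comm _ ((‖v‖⁻¹ : ℝ) : ℂ), spectralIntegral_const_smul] at this
    rw [norm_smul, Complex.norm_real, norm_inv, norm_norm,
      inv_mul_le_iff₀ (norm_pos_iff.2 hv)] at this
    rwa [mul_comm]

/-- The bounded operator `∫ dE(p) ρ(p) b(p)`. -/
def weightedOp (hη : η.det ≠ 0) (U : TranslationRep d H) {ρ : RVec d → ℂ}
    (hρ : SymbolFam (-((d : ℤ) + 1)) fun (_ : Unit) => ρ) {b : RVec d → (H →L[ℂ] H)}
    (hb : SymbolFam 0 fun (_ : Unit) => b) : H →L[ℂ] H :=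
  LinearMap.mkContinuousOfExistsBound
    { toFun := fun v => spectralIntegral U η fun p => ρ p • b p v
      map_add' := fun v w => by
        have hv : ∀ v : H, SymbolFam (-((d : ℤ) + 1)) fun (_ : Unit) p => ρ p • b p v := fun v => by
          simpa using hρ.smul_complex (hb.op_apply
            (SymbolFam.const (v := fun _ => v) (M := ‖v‖) fun _ => le_rfl))
        simp only [map_add, smul_add]
        exact (hv v).spectralIntegral_add hη U (hv w) le_rfl ()
      map_smul' := fun c v => by
        simp only [map_smul, smul_comm _ c, spectralIntegral_const_smul, RingHom.id_apply] }
    (let ⟨C, _, hC⟩ := hb.norm_weighted_le hη U hρ; ⟨C, fun v => hC () v⟩)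

lemma weightedOp_apply (hη : η.det ≠ 0) (U : TranslationRep d H) {ρ : RVec d → ℂ}
    (hρ : SymbolFam (-((d : ℤ) + 1)) fun (_ : Unit) => ρ) {b : RVec d → (H →L[ℂ] H)}
    (hb : SymbolFam 0 fun (_ : Unit) => b) (v : H) :
    weightedOp hη U hρ hb v = spectralIntegral U η fun p => ρ p • b p v := rfl

end WeightedOp

/-! ### Uniform Taylor remainders -/

section Taylor

variable {d : ℕ} {E : Type*} [NormedAddCommGroup E] [NormedSpace ℝ E]

lemma contDiff_taylorRemainder {a : RVec d → E} (ha : ContDiff ℝ ∞ a) (h : RVec d) :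
    ContDiff ℝ ∞ fun z => a (z + h) - a z - _root_.fderiv ℝ a z h :=
  ((ha.comp (contDiff_id.add contDiff_const)).sub ha).sub
    ((ha.fderiv_right (m := ∞) (by simp)).clm_apply contDiff_const)

/-- The derivatives of the first order Taylor remainder of a function with bounded derivatives
are quadratically small. -/
lemma SymbolFam.taylorRemainder {a : RVec d → E} (ha : SymbolFam 0 fun (_ : Unit) => a) (j : ℕ) :
    ∃ C, 0 ≤ C ∧ ∀ h z, ‖iteratedFDeriv ℝ j (fun z => a (z + h) - a z - _root_.fderiv ℝ a z h) z‖
      ≤ C * ‖h‖ ^ 2 := by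
  induction j generalizing E with
  | zero =>
    obtain ⟨M, hM0, hM⟩ := ha.fderiv.fderiv.norm_le
    simp only [zpow_zero, mul_one] at hM
    refine ⟨M, hM0, fun h z => ?_⟩
    rw [norm_iteratedFDeriv_zero]
    have hd : Differentiable ℝ a := (ha.contDiff ()).differentiable (by simp)
    have hd' : Differentiable ℝ (_root_.fderiv ℝ a) := (ha.fderiv.contDiff ()).differentiable (by simp)
    have h1 : ∀ y, ‖_root_.fderiv ℝ a y - _root_.fderiv ℝ a z‖ ≤ M * ‖y - z‖ := fun y =>
      Convex.norm_image_sub_le_of_norm_fderiv_le (𝕜 := ℝ) (s := Set.univ)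
        (fun x _ => hd' x) (fun x _ => hM () x) convex_univ (Set.mem_univ _) (Set.mem_univ _)
    have h2 := Convex.norm_image_sub_le_of_norm_hasFDerivWithin_le' (𝕜 := ℝ)
      (s := segment ℝ z (z + h)) (f := a) (f' := _root_.fderiv ℝ a) (φ := _root_.fderiv ℝ a z) (C := M * ‖h‖)
      (x := z) (y := z + h)
      (fun x _ => (hd x).hasFDerivAt.hasFDerivWithinAt) (fun x hx => (h1 x).trans (by
        gcongr
        have := norm_sub_le_of_mem_segment hx
        simpa using this)) (convex_segment _ _) (left_mem_segment _ _ _) (right_mem_segment _ _ _)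
    rw [add_sub_cancel_left] at h2
    exact h2.trans_eq (by ring)
  | succ j ih =>
    obtain ⟨C, hC0, hC⟩ := ih ha.fderiv
    refine ⟨C, hC0, fun h z => ?_⟩
    rw [← norm_iteratedFDeriv_fderiv]
    -- The derivative of the remainder of `a` is the remainder of the derivative of `a`, by symmetry
    -- of the second derivative; the induction therefore varies the target space.
    have e : _root_.fderiv ℝ (fun z => a (z + h) - a z - _root_.fderiv ℝ a z h) = fun z =>
        _root_.fderiv ℝ a (z + h) - _root_.fderiv ℝ a z - _root_.fderiv ℝ (_root_.fderiv ℝ a) z h := by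
      funext z
      have hd : Differentiable ℝ a := (ha.contDiff ()).differentiable (by simp)
      have hd' : Differentiable ℝ (_root_.fderiv ℝ a) := (ha.fderiv.contDiff ()).differentiable (by simp)
      have d1 : HasFDerivAt (fun z => a (z + h)) (_root_.fderiv ℝ a (z + h)) z := by
        have := (hd (z + h)).hasFDerivAt.comp z ((hasFDerivAt_id z).add_const h)
        rw [ContinuousLinearMap.comp_id] at this
        exact this
      have d3 := (hd' z).hasFDerivAt.clm_apply (hasFDerivAt_const h z)
      have d4 := ((d1.sub (hd z).hasFDerivAt).sub d3).fderiv
      change _root_.fderiv ℝ (fun z => a (z + h) - a z - _root_.fderiv ℝ a z h) z = _ at d4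
      rw [d4]
      ext v
      have hs := ((ha.contDiff ()).contDiffAt (x := z)).isSymmSndFDerivAt (n := ∞)
        (by rw [minSmoothness_of_isRCLikeNormedField]; exact WithTop.coe_le_coe.2 le_top)
      simp [hs.eq v h]
    rw [e]
    exact hC h z

/-- Uniformity in the increment `h` is the point: it turns the Taylor estimate into an operator-norm
bound after spectral integration. At `h = 0` the quotient is `0`. -/
lemma SymbolFam.taylorQuotient {a : RVec d → E} (ha : SymbolFam 0 fun (_ : Unit) => a) :
    SymbolFam 0 fun (h : RVec d) z => (‖h‖ ^ 2)⁻¹ • (a (z + h) - a z - _root_.fderiv ℝ a z h) := by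
  refine ⟨fun h => contDiff_const.smul (contDiff_taylorRemainder (ha.contDiff ()) h), fun j => ?_⟩
  obtain ⟨C, h0, hC⟩ := ha.taylorRemainder j
  refine ⟨C, h0, fun h z => ?_⟩
  rw [iteratedFDeriv_const_smul_apply', norm_smul, norm_inv, norm_pow, norm_norm, zpow_zero, mul_one]
  · rcases eq_or_ne h 0 with rfl | hh
    · simp [h0]
    · rw [inv_mul_le_iff₀ (by positivity), mul_comm]
      exact hC h z
  · exact ((contDiff_taylorRemainder (ha.contDiff ()) h).of_le
      (m := (j : WithTop ℕ∞)) (mod_cast le_top)).contDiffAt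

end Taylor

/-! ### Warped convolutions of smooth bounded operators -/

section Warp

variable {d : ℕ} {H : Type*} [NormedAddCommGroup H] [InnerProductSpace ℂ H]
variable {U : TranslationRep d H} {η : Matrix (Fin d) (Fin d) ℝ} {C : H →L[ℂ] H}

/-- The operator `∫ dE(p) ρ(p) α_{x + Qp}(C)`. -/
def IsSmoothBdd.weightedConj (hC : IsSmoothBdd U C) (hη : η.det ≠ 0)
    (Q : Matrix (Fin d) (Fin d) ℝ) {ρ : RVec d → ℂ}
    (hρ : SymbolFam (-((d : ℤ) + 1)) fun (_ : Unit) => ρ) (x : RVec d) : H →L[ℂ] H :=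
  weightedOp hη U hρ (hC.symbolFam_conjOp_act (ι := Unit) Q fun _ => x)

lemma IsSmoothBdd.weightedConj_apply (hC : IsSmoothBdd U C) (hη : η.det ≠ 0)
    (Q : Matrix (Fin d) (Fin d) ℝ) {ρ : RVec d → ℂ}
    (hρ : SymbolFam (-((d : ℤ) + 1)) fun (_ : Unit) => ρ) (x : RVec d) (v : H) :
    hC.weightedConj hη Q hρ x v =
      spectralIntegral U η fun p => ρ p • conjOp U (x + act Q p) C v := rfl

lemma SymbolFam.const_smul {ι : Type*} {n : ℤ} {f : ι → RVec d → H} (hf : SymbolFam n f) (c : ℂ) :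
    SymbolFam n fun i p => c • f i p :=
  hf.clm ((c • ContinuousLinearMap.id ℂ H).restrictScalars ℝ)

lemma symbolFam_smul_op {ι : Type*} {ρ : RVec d → ℂ}
    (hρ : SymbolFam (-((d : ℤ) + 1)) fun (_ : Unit) => ρ) {b : ι → RVec d → (H →L[ℂ] H)}
    (hb : SymbolFam 0 b) (v : H) :
    SymbolFam (-((d : ℤ) + 1)) fun (i : ι) p => ρ p • b i p v := by
  simpa using (hρ.reindex fun _ : ι => ()).smul_complex (hb.op_apply
    (SymbolFam.const (v := fun _ => v) (M := ‖v‖) fun _ => le_rfl))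

lemma IsSmoothBdd.symbolFam_smul_conjOp (hC : IsSmoothBdd U C) (Q : Matrix (Fin d) (Fin d) ℝ)
    {ρ : RVec d → ℂ} (hρ : SymbolFam (-((d : ℤ) + 1)) fun (_ : Unit) => ρ) (x : RVec d) (v : H) :
    SymbolFam (-((d : ℤ) + 1)) fun (_ : Unit) p => ρ p • conjOp U (x + act Q p) C v :=
  symbolFam_smul_op hρ (hC.symbolFam_conjOp_act (ι := Unit) Q fun _ => x) v

lemma IsSmoothBdd.conjOp_weightedConj [CompleteSpace H] (hC : IsSmoothBdd U C) (hη : η.det ≠ 0)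
    (Q : Matrix (Fin d) (Fin d) ℝ) {ρ : RVec d → ℂ}
    (hρ : SymbolFam (-((d : ℤ) + 1)) fun (_ : Unit) => ρ) (x : RVec d) :
    conjOp U x (hC.weightedConj hη Q hρ 0) = hC.weightedConj hη Q hρ x := by
  ext v
  have hs := hC.symbolFam_smul_conjOp Q hρ 0 (U (-x) v)
  rw [conjOp_apply, weightedConj_apply, weightedConj_apply,
    apply_spectralIntegral U (hs.integrable le_rfl ()) (hs.integrable_apply_ft hη U le_rfl ())]
  congr 1; funext p
  rw [map_smul, zero_add, ← conjOp_conjOp]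
  rfl

lemma IsSmoothBdd.fderiv_apply_eq_sum (hC : IsSmoothBdd U C) (z h : RVec d) :
    _root_.fderiv ℝ (fun y => conjOp U y C) z h
      = ∑ j, h j • conjOp U z (_root_.fderiv ℝ (fun y => conjOp U y C) 0 (basisVec j)) := by
  have e : h = ∑ j, h j • basisVec j := by
    have := ((EuclideanSpace.basisFun (Fin d) ℝ).sum_repr h).symm
    simpa [basisVec] using this
  conv_lhs => rw [e, map_sum]
  simp only [map_smul]
  simp only [hC.fderiv_conjOp z]

/-- The Taylor quotients of `α_x(C)`, evaluated at `x + Qp`, form one order-zero family in `h`.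
Their weighted spectral integrals are bounded in operator norm uniformly in `h`, so the remainder is
`O(‖h‖^2)` in norm and not only strongly. -/
lemma IsSmoothBdd.hasFDerivAt_weightedConj (hC : IsSmoothBdd U C) (hη : η.det ≠ 0)
    (Q : Matrix (Fin d) (Fin d) ℝ) {ρ : RVec d → ℂ}
    (hρ : SymbolFam (-((d : ℤ) + 1)) fun (_ : Unit) => ρ) (x : RVec d) :
    HasFDerivAt (hC.weightedConj hη Q hρ)
      (∑ j, (EuclideanSpace.proj j : RVec d →L[ℝ] ℝ).smulRight
        ((hC.fderiv (basisVec j)).weightedConj hη Q hρ x)) x := by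
  have hq := ((hC.symbolFam_conjOp (ι := Unit)).taylorQuotient.comp_affine (fun h => h)
    (fun _ : RVec d => x) (fun _ => actL Q) (c := ‖actL Q‖) fun _ => le_rfl)
  obtain ⟨M, hM0, hM⟩ := hq.norm_weighted_le hη U hρ
  have key : ∀ h : RVec d, ‖hC.weightedConj hη Q hρ (x + h) - hC.weightedConj hη Q hρ x -
      (∑ j, (EuclideanSpace.proj j : RVec d →L[ℝ] ℝ).smulRight
        ((hC.fderiv (basisVec j)).weightedConj hη Q hρ x)) h‖ ≤ M * ‖h‖ ^ 2 := by
    intro h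
    rcases eq_or_ne h 0 with rfl | hh
    · simp
    refine ContinuousLinearMap.opNorm_le_bound _ (by positivity) fun v => ?_
    have h1 := hM h v
    have h2 : (fun p => ρ p • ((‖h‖ ^ 2)⁻¹ • (conjOp U (x + actL Q p + h) C -
        conjOp U (x + actL Q p) C - _root_.fderiv ℝ (fun y => conjOp U y C) (x + actL Q p) h)) v)
        = fun p => (((‖h‖ ^ 2)⁻¹ : ℝ) : ℂ) • (ρ p • conjOp U (x + h + act Q p) C v +
          ((-1 : ℂ) • (ρ p • conjOp U (x + act Q p) C v) +
          ∑ j, ((-h j : ℝ) : ℂ) • (ρ p • conjOp U (x + act Q p)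
            (_root_.fderiv ℝ (fun y => conjOp U y C) 0 (basisVec j)) v))) := by
      funext p
      rw [hC.fderiv_apply_eq_sum, add_right_comm]
      simp only [smul_apply, sub_apply, sum_apply, actL_apply, Complex.ofReal_neg, neg_smul,
        Complex.coe_smul, Finset.sum_neg_distrib, smul_comm (ρ p), one_smul,
        smul_sub]
      rw [Finset.smul_sum]
      simp only [smul_comm (ρ p), smul_add, smul_neg]
      abel
    have sA := hC.symbolFam_smul_conjOp Q hρ (x + h) v
    have sB := (hC.symbolFam_smul_conjOp Q hρ x v).const_smul (-1)
    have sD := fun j => ((hC.fderiv (basisVec j)).symbolFam_smul_conjOp Q hρ x v).const_smul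
      ((-h j : ℝ) : ℂ)
    rw [h2, spectralIntegral_const_smul,
      sA.spectralIntegral_add hη U (sB.add (SymbolFam.sum Finset.univ sD)) le_rfl (),
      sB.spectralIntegral_add hη U (SymbolFam.sum Finset.univ sD) le_rfl (),
      SymbolFam.spectralIntegral_sum hη U _ sD le_rfl ()] at h1
    simp only [spectralIntegral_const_smul] at h1
    rw [norm_smul, Complex.norm_real, norm_inv, norm_pow, norm_norm,
      inv_mul_le_iff₀ (by positivity)] at h1
    refine le_trans (le_of_eq ?_) (h1.trans_eq (by ring))
    congr 1
    simp only [sub_apply, sum_apply, ContinuousLinearMap.smulRight_apply, smul_apply,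
      hC.weightedConj_apply, (hC.fderiv _).weightedConj_apply, PiLp.proj_apply,
      Complex.ofReal_neg, neg_smul, one_smul, Finset.sum_neg_distrib, Complex.coe_smul]
    abel
  rw [hasFDerivAt_iff_isLittleO_nhds_zero]
  refine (Asymptotics.IsBigO.of_bound M (g := fun h : RVec d => ‖h‖ ^ 2)
    (Eventually.of_forall fun h => ?_)).trans_isLittleO ?_
  · simpa using key h
  · exact Asymptotics.isLittleO_norm_pow_id one_lt_two

/-- The partial derivatives are operators of the same type with `C` replaced by its derivatives,
which closes the induction. -/
lemma IsSmoothBdd.contDiff_weightedConj (hη : η.det ≠ 0)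
    (Q : Matrix (Fin d) (Fin d) ℝ) {ρ : RVec d → ℂ}
    (hρ : SymbolFam (-((d : ℤ) + 1)) fun (_ : Unit) => ρ) (n : ℕ) (hC : IsSmoothBdd U C) :
    ContDiff ℝ n (hC.weightedConj hη Q hρ) := by
  induction n generalizing C with
  | zero =>
    rw [Nat.cast_zero, contDiff_zero]
    exact continuous_iff_continuousAt.2 fun x => (hC.hasFDerivAt_weightedConj hη Q hρ x).continuousAt
  | succ n ih =>
    rw [Nat.cast_succ, contDiff_succ_iff_hasFDerivAt]
    refine ⟨_, ?_, fun x => hC.hasFDerivAt_weightedConj hη Q hρ x⟩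
    exact ContDiff.sum fun j _ => contDiff_const.smulRight (ih _)

lemma IsSmoothBdd.isSmoothBdd_weightedConj [CompleteSpace H] (hC : IsSmoothBdd U C)
    (hη : η.det ≠ 0) (Q : Matrix (Fin d) (Fin d) ℝ) {ρ : RVec d → ℂ}
    (hρ : SymbolFam (-((d : ℤ) + 1)) fun (_ : Unit) => ρ) :
    IsSmoothBdd U (hC.weightedConj hη Q hρ 0) := by
  simp only [IsSmoothBdd, hC.conjOp_weightedConj]
  exact contDiff_infty.2 fun n => IsSmoothBdd.contDiff_weightedConj hη Q hρ n hC

/-- Rescaling of a test function. -/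
lemma exists_schwartz_rescale (χ : 𝓢(RVec d, ℂ)) {ε : ℝ} (hε : 0 < ε) :
    ∃ χ' : 𝓢(RVec d, ℂ), ∀ p, χ' p = χ (ε • p) :=
  ⟨SchwartzMap.compCLMOfContinuousLinearEquiv ℝ
    (ContinuousLinearEquiv.smulLeft (Units.mk0 ε hε.ne')) χ, fun _ => rfl⟩

lemma symbolFam_rescale (χ : 𝓢(RVec d, ℂ)) {ε : ℝ} (hε : 0 < ε) (n : ℤ) :
    SymbolFam n fun (_ : Unit) p => χ (ε • p) := by
  obtain ⟨χ', h⟩ := exists_schwartz_rescale χ hε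
  simpa only [h] using SymbolFam.schwartz (ι := Unit) n χ'

/-- Clamping the parameter to `[0, 1]` bounds the dilations uniformly while leaving small positive
`ε` unchanged. -/
lemma symbolFam_rescale_family (χ : 𝓢(RVec d, ℂ)) :
    SymbolFam 0 fun (ε : ℝ) p => χ ((max 0 (min ε 1)) • p) := by
  have := (SymbolFam.schwartz (ι := Unit) 0 χ).comp_affine (fun _ : ℝ => ()) (fun _ => 0)
    (fun ε => max 0 (min ε 1) • ContinuousLinearMap.id ℝ (RVec d)) (c := 1) (fun ε => by
      rw [norm_smul, Real.norm_of_nonneg (le_max_left _ _)]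
      exact mul_le_one₀ (max_le zero_le_one (min_le_right _ _)) (norm_nonneg _)
        ContinuousLinearMap.norm_id_le)
  simpa using this

/-- Removing a regularization in a spectral integral. -/
lemma tendsto_spectralIntegral_rescale (hη : η.det ≠ 0) (U : TranslationRep d H)
    {f : RVec d → H} (hf : SymbolFam (-((d : ℤ) + 1)) fun (_ : Unit) => f)
    {χ : 𝓢(RVec d, ℂ)} (hχ : χ 0 = 1) :
    Tendsto (fun ε : ℝ => spectralIntegral U η fun p => χ (ε • p) • f p) (𝓝[>] 0)
      (𝓝 (spectralIntegral U η f)) := by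
  have h1 := (symbolFam_rescale_family χ).smul_complex (hf.reindex fun _ : ℝ => ())
  have h2 : ∀ p, Tendsto (fun ε : ℝ => χ ((max 0 (min ε 1)) • p) • f p) (𝓝[>] 0) (𝓝 (f p)) := by
    intro p
    have : Continuous fun ε : ℝ => χ ((max 0 (min ε 1)) • p) • f p :=
      (χ.continuous.comp (by fun_prop)).smul continuous_const
    have := (this.tendsto 0).mono_left (nhdsWithin_le_nhds (s := Set.Ioi 0))
    simpa [hχ] using this
  refine (h1.tendsto_spectralIntegral hη U (by simp) h2).congr' ?_
  filter_upwards [Ioo_mem_nhdsGT (zero_lt_one (α := ℝ))] with ε hε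
  rw [min_eq_left hε.2.le, max_eq_right hε.1.le]

/-- The warped convolution of a smooth bounded operator exists on smooth vectors and is, up to a
power of `1 + |P|^2`, again a smooth bounded operator. -/
theorem IsSmoothBdd.exists_hasSpectralIntegral [CompleteSpace H] (hη : η.det ≠ 0)
    (hC : IsSmoothBdd U C) (Q : Matrix (Fin d) (Fin d) ℝ) :
    ∃ W : H →L[ℂ] H, IsSmoothBdd U W ∧ ∃ k : ℕ, ∀ ψ : smoothVectors U,
      HasSpectralIntegral U η (fun p => conjOp U (act Q p) C ψ) (W ((onePlusPSq U ^ k) ψ : H)) := by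
  -- With `d + 1` factors the weight has order `-2(d + 1)`, below the threshold `-(d + 1)` for
  -- absolute convergence.
  obtain ⟨C', hC', h⟩ := hC.exists_spectralIntegral_regularized hη Q (d + 1)
  have hw := symbolFam_weight (ι := Unit) hη
  refine ⟨hC'.weightedConj hη Q hw 0, hC'.isSmoothBdd_weightedConj hη Q hw, d + 1, fun ψ χ hχ => ?_⟩
  have hs : ∀ ε : ℝ, 0 < ε → SymbolFam (-((d : ℤ) + 1)) fun (_ : Unit) p =>
      χ (ε • p) • conjOp U (act Q p) C (ψ : H) := fun ε hε => by
    simpa using hC.symbolFam_smul_conjOp Q (symbolFam_rescale χ hε _) 0 (ψ : H)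
  refine ⟨fun ε hε => ⟨(hs ε hε).integrable le_rfl (), (hs ε hε).integrable_apply_ft hη U le_rfl ()⟩,
    ?_⟩
  rw [hC'.weightedConj_apply]
  simp only [zero_add]
  have hs' := hC'.symbolFam_smul_conjOp Q hw 0 ((onePlusPSq U ^ (d + 1)) ψ : H)
  simp only [zero_add] at hs'
  refine (tendsto_spectralIntegral_rescale hη U hs' hχ).congr' ?_
  filter_upwards [self_mem_nhdsWithin] with ε hε
  exact (h _ ψ fun n => symbolFam_rescale χ hε n).symm

end Warp

/-! ### Scalar spectral cutoffs -/

section Smearing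

variable {d : ℕ} {H : Type*} [NormedAddCommGroup H] [InnerProductSpace ℂ H]
variable {U : TranslationRep d H} {η : Matrix (Fin d) (Fin d) ℝ} {C : H →L[ℂ] H}

lemma conjOp_of_commute (h : ∀ x, ∀ ψ, C (U x ψ) = U x (C ψ)) (x : RVec d) :
    conjOp U x C = C := by
  ext ψ; rw [conjOp_apply, ← h, apply_neg_apply]

lemma onePlusPSq_toEnd_of_commute (h : ∀ x, ∀ ψ, C (U x ψ) = U x (C ψ)) (hC : IsSmoothBdd U C)
    (n : ℕ) (ψ : smoothVectors U) :
    (onePlusPSq U ^ n) (hC.toEnd ψ) = hC.toEnd ((onePlusPSq U ^ n) ψ) := by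
  have hg : ∀ j ψ, generator U j (hC.toEnd ψ) = hC.toEnd (generator U j ψ) := fun j ψ => by
    rw [hC.generator_toEnd]
    ext
    simp [conjOp_of_commute h]
  induction n with
  | zero => rfl
  | succ n ih =>
    rw [pow_succ', Module.End.mul_apply, ih, Module.End.mul_apply]
    ext
    rw [coe_onePlusPSq, IsSmoothBdd.coe_toEnd, IsSmoothBdd.coe_toEnd, coe_onePlusPSq, map_add,
      map_sum]
    simp [hg]

lemma ft_smul_const (η : Matrix (Fin d) (Fin d) ℝ) [CompleteSpace H] (k : RVec d → ℂ) (v : H)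
    (x : RVec d) : ft η (fun p => k p • v) x = ft η k x • v := by
  simp only [ft, ← smul_assoc]
  exact integral_smul_const _ _

lemma ft_rescale (η : Matrix (Fin d) (Fin d) ℝ) (k : RVec d → ℂ) {ε : ℝ} (hε : 0 < ε)
    (x : RVec d) :
    ft η (fun p => k (ε • p)) x = ((ε ^ d)⁻¹ : ℝ) • ft η k (ε⁻¹ • x) := by
  have h := Measure.integral_comp_smul (volume : Measure (RVec d))
    (fun p => Complex.exp (-(pairing η p (ε⁻¹ • x) : ℂ) * Complex.I) • k p) ε
  rw [finrank_euclideanSpace_fin, abs_of_pos (by positivity)] at h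
  rw [ft, ft, ← h]
  congr 1; funext p
  congr 4
  simp only [pairing_eq_inner, act_eq, map_smul, inner_smul_left, inner_smul_right]
  simp [hε.ne']

/-- Substituting `x ↦ εx` moves the scaling from the test function to the orbit, so that the limit
`ε ↘ 0` becomes strong continuity at the origin. -/
lemma spectralIntegral_rescale_smul_const [CompleteSpace H] (U : TranslationRep d H)
    (η : Matrix (Fin d) (Fin d) ℝ) (k : RVec d → ℂ) (v : H) {ε : ℝ} (hε : 0 < ε) :
    spectralIntegral U η (fun p => k (ε • p) • v) =
      (|η.det| / (2 * Real.pi) ^ d) • ∫ x, ft η k x • U (ε • x) v := by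
  rw [spectralIntegral_eq]
  congr 1
  have h := Measure.integral_comp_smul (volume : Measure (RVec d))
    (fun x => ft η k (ε⁻¹ • x) • U x v) ε
  rw [finrank_euclideanSpace_fin, abs_of_pos (by positivity)] at h
  simp only [inv_smul_smul₀ hε.ne'] at h
  rw [h, ← integral_smul]
  congr 1; funext x
  rw [ft_smul_const η (fun p => k (ε • p)), map_smul, ft_rescale η k hε, smul_assoc]

lemma tendsto_integral_smul_orbit (U : TranslationRep d H) {K : RVec d → ℂ} (hK : Integrable K)
    (v : H) :
    Tendsto (fun ε : ℝ => ∫ x, K x • U (ε • x) v) (𝓝[>] 0) (𝓝 (∫ x, K x • v)) := by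
  refine tendsto_integral_filter_of_dominated_convergence
    (fun x => ‖K x‖ * ‖v‖) ?_ ?_ (hK.norm.mul_const _) ?_
  · exact Eventually.of_forall fun ε => hK.1.smul
      ((U.continuous_orbit v).comp (continuous_const_smul ε)).aestronglyMeasurable
  · exact Eventually.of_forall fun ε => Eventually.of_forall fun x => by
      rw [norm_smul, LinearIsometryEquiv.norm_map]
  · refine Eventually.of_forall fun x => Tendsto.const_smul ?_ _
    have h1 : Continuous fun ε : ℝ => U (ε • x) v :=
      (U.continuous_orbit v).comp (continuous_id.smul continuous_const)
    have h2 := (h1.tendsto 0).mono_left (nhdsWithin_le_nhds (s := Set.Ioi 0))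
    rwa [zero_smul, map_zero_apply] at h2

/-- Scalar spectral integrals converge strongly to the identity when the regularization is
removed. -/
lemma tendsto_spectralIntegral_const [CompleteSpace H] (hη : IsGram η) (U : TranslationRep d H)
    {χ : 𝓢(RVec d, ℂ)} (hχ : χ 0 = 1) (v : H) :
    Tendsto (fun ε : ℝ => spectralIntegral U η fun p => χ (ε • p) • v) (𝓝[>] 0) (𝓝 v) := by
  obtain ⟨hint, hinv⟩ := fourier_inversion_pairing hη χ
  have h0 : (|η.det| / (2 * Real.pi) ^ d) • ∫ x, ft η χ x = (1 : ℂ) := by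
    have h1 := hinv 0
    simp only [pairing_eq_inner, inner_zero_left, Complex.ofReal_zero, zero_mul, Complex.exp_zero,
      one_smul, hχ] at h1
    simpa only [ft, pairing_eq_inner] using h1
  have hl := (tendsto_integral_smul_orbit U (K := ft η χ) hint v).const_smul
    (|η.det| / (2 * Real.pi) ^ d)
  rw [integral_smul_const, ← smul_assoc, h0, one_smul] at hl
  refine hl.congr' ?_
  filter_upwards [self_mem_nhdsWithin] with ε hε
  exact (spectralIntegral_rescale_smul_const U η χ v hε).symm

/-- Reality and evenness let the cutoff be used on both sides of the adjoint relation, which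
conjugates and reflects its arguments. -/
lemma exists_real_even_schwartz (d : ℕ) : ∃ χ : 𝓢(RVec d, ℂ), χ 0 = 1 ∧ (∀ x, χ (-x) = χ x) ∧
    ∀ x, (starRingEnd ℂ) (χ x) = χ x := by
  let b : ContDiffBump (0 : RVec d) := ⟨1, 2, one_pos, one_lt_two⟩
  have h1 : HasCompactSupport fun x => ((b x : ℝ) : ℂ) :=
    b.hasCompactSupport.comp_left (g := fun r : ℝ => (r : ℂ)) (by simp)
  have h2 : ContDiff ℝ ∞ fun x => ((b x : ℝ) : ℂ) :=
    Complex.ofRealCLM.contDiff.comp b.contDiff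
  refine ⟨h1.toSchwartzMap h2, ?_, fun x => ?_, fun x => ?_⟩
  · change ((b 0 : ℝ) : ℂ) = 1
    rw [b.one_of_mem_closedBall (by simp [b.rIn_pos.le])]
    simp
  · change ((b (-x) : ℝ) : ℂ) = ((b x : ℝ) : ℂ)
    rw [b.neg]
  · change (starRingEnd ℂ) ((b x : ℝ) : ℂ) = ((b x : ℝ) : ℂ)
    exact Complex.conj_ofReal _

end Smearing

/-! ### The kernel of the warped product and its conjugation symmetry -/

section Symmetry

variable {d : ℕ} {H : Type*} [NormedAddCommGroup H] [InnerProductSpace ℂ H]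
variable {U : TranslationRep d H} {η Q : Matrix (Fin d) (Fin d) ℝ}

lemma pairing_act_self (hQ : IsSkewFor η Q) (p : RVec d) : pairing η p (act Q p) = 0 := by
  have := hQ p p
  linarith

lemma pairing_add_right (η : Matrix (Fin d) (Fin d) ℝ) (p x y : RVec d) :
    pairing η p (x + y) = pairing η p x + pairing η p y := by
  simp only [pairing_eq_inner, act_eq, map_add, inner_add_right]

lemma pairing_neg_right (η : Matrix (Fin d) (Fin d) ℝ) (p x : RVec d) :
    pairing η p (-x) = -pairing η p x := by
  simp only [pairing_eq_inner, act_eq, map_neg, inner_neg_right]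

/-- The kernel `∫ dp dq e^{-i p x - i q y - i q Q p} h(p) k(q)`. -/
def warpKernel (η Q : Matrix (Fin d) (Fin d) ℝ) (h k : RVec d → ℂ) (z : RVec d × RVec d) : ℂ :=
  ft η (fun p => h p * ft η k (z.2 + act Q p)) z.1

/-- Both sides are double integrals of the same function after renaming `p` and `q`: conjugation
flips all phases, and `q Qp = -p Qq` compensates the exchange in the mixed term. Fubini finishes. -/
lemma warpKernel_conj (hQ : IsSkewFor η Q) {h k : RVec d → ℂ} (hh : Integrable h)
    (hk : Integrable k) (hh' : ∀ p, (starRingEnd ℂ) (h p) = h p)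
    (hk' : ∀ p, (starRingEnd ℂ) (k p) = k p) (x y : RVec d) :
    (starRingEnd ℂ) (warpKernel η Q k h (x, y)) = warpKernel η Q h k (-y, -x) := by
  have hc : ∀ a : ℝ, (starRingEnd ℂ) (Complex.exp (-(a : ℂ) * Complex.I))
      = Complex.exp ((a : ℂ) * Complex.I) := fun a => by
    rw [← Complex.exp_conj]; simp
  have e1 : (starRingEnd ℂ) (warpKernel η Q k h (x, y)) = ∫ p, ∫ q,
      Complex.exp (((pairing η p x + pairing η q y + pairing η q (act Q p) : ℝ) : ℂ) * Complex.I) *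
        (k p * h q) := by
    simp only [warpKernel, ft, smul_eq_mul]
    rw [← integral_conj]
    congr 1; funext p
    rw [← mul_assoc, ← integral_const_mul, ← integral_conj]
    congr 1; funext q
    simp only [map_mul, hc, hh', hk', pairing_add_right]
    push_cast
    simp only [add_mul, Complex.exp_add]
    ring
  have e2 : warpKernel η Q h k (-y, -x) = ∫ q, ∫ p,
      Complex.exp (((pairing η p x + pairing η q y + pairing η q (act Q p) : ℝ) : ℂ) * Complex.I) *
        (k p * h q) := by
    simp only [warpKernel, ft, smul_eq_mul]
    congr 1; funext q
    rw [← mul_assoc, ← integral_const_mul]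
    congr 1; funext p
    rw [pairing_add_right, pairing_neg_right, pairing_neg_right, hQ q p]
    push_cast
    rw [add_right_comm, add_comm, add_mul, Complex.exp_add]
    ring_nf
  rw [e1, e2]
  refine integral_integral_swap ?_
  have : Integrable (fun z : RVec d × RVec d => k z.1 * h z.2) (volume.prod volume) :=
    hk.mul_prod hh
  refine this.bdd_mul (c := 1) (Continuous.aestronglyMeasurable ?_) ?_
  · have := continuous_act Q
    fun_prop
  · exact Eventually.of_forall fun z => by rw [Complex.norm_exp_ofReal_mul_I]

end Symmetry

/-! ### Correlation functions and their oscillatory integrals -/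

section Correlation

variable {d : ℕ} {H : Type*} [NormedAddCommGroup H] [InnerProductSpace ℂ H]
variable {U : TranslationRep d H} {η Q : Matrix (Fin d) (Fin d) ℝ} {C : H →L[ℂ] H}
variable {h k : RVec d → ℂ}

instance isAddHaarMeasure_volume_prod :
    (volume : Measure (RVec d × RVec d)).IsAddHaarMeasure :=
  Measure.prod.instIsAddHaarMeasure volume volume

instance isNegInvariant_volume_prod :
    (volume : Measure (RVec d × RVec d)).IsNegInvariant :=
  ⟨((Measure.measurePreserving_neg (volume : Measure (RVec d))).prod
    (Measure.measurePreserving_neg (volume : Measure (RVec d)))).map_eq⟩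

/-- The correlation function `⟪φ, U(x) C U(y) ψ⟫`. -/
def corr (U : TranslationRep d H) (C : H →L[ℂ] H) (φ ψ : H) (z : RVec d × RVec d) : ℂ :=
  ⟪φ, U z.1 (C (U z.2 ψ))⟫_ℂ

/-- Antidiagonal shifts keep `x + y` fixed, so the dependence on `q` sits entirely in the smooth
orbit of `C`, although `φ` and `ψ` are arbitrary vectors. -/
lemma corr_shift (U : TranslationRep d H) (C : H →L[ℂ] H) (φ ψ : H) (z : RVec d × RVec d)
    (q : RVec d) :
    corr U C φ ψ (z + (q, -q)) = ⟪φ, conjOp U (z.1 + q) C (U (z.1 + z.2) ψ)⟫_ℂ := by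
  rw [conjOp_apply, ← U.map_add, corr]
  congr 5
  simp only [Prod.snd_add]
  abel

lemma continuous_corr (U : TranslationRep d H) (C : H →L[ℂ] H) (φ ψ : H) :
    Continuous (corr U C φ ψ) :=
  continuous_const.inner (continuous_apply U continuous_fst
    (C.continuous.comp (continuous_apply U continuous_snd continuous_const)))

lemma norm_corr_le (U : TranslationRep d H) (C : H →L[ℂ] H) (φ ψ : H) (z : RVec d × RVec d) :
    ‖corr U C φ ψ z‖ ≤ ‖φ‖ * (‖C‖ * ‖ψ‖) := by
  refine (norm_inner_le_norm _ _).trans ?_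
  rw [LinearIsometryEquiv.norm_map]
  gcongr
  exact (C.le_opNorm _).trans_eq (by rw [LinearIsometryEquiv.norm_map])

/-- The correlation function with a cutoff. -/
def cutoffCorr (U : TranslationRep d H) (C : H →L[ℂ] H) (φ ψ : H) (χ : 𝓢(RVec d, ℂ)) (s : ℝ)
    (z : RVec d × RVec d) : ℂ :=
  χ (s • z.1) * χ (s • z.2) * corr U C φ ψ z

lemma continuous_cutoffCorr (U : TranslationRep d H) (C : H →L[ℂ] H) (φ ψ : H)
    (χ : 𝓢(RVec d, ℂ)) {X : Type*} [TopologicalSpace X] {s : X → ℝ} {z : X → RVec d × RVec d}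
    (hs : Continuous s) (hz : Continuous z) :
    Continuous fun t => cutoffCorr U C φ ψ χ (s t) (z t) := by
  have h1 := continuous_corr U C φ ψ
  have h2 := χ.continuous
  unfold cutoffCorr
  fun_prop

lemma integrable_cutoffCorr (U : TranslationRep d H) (C : H →L[ℂ] H) (φ ψ : H)
    (χ : 𝓢(RVec d, ℂ)) {s : ℝ} (hs : 0 < s) :
    Integrable (cutoffCorr U C φ ψ χ s) := by
  obtain ⟨χ', hχ'⟩ := exists_schwartz_rescale χ hs
  have h1 : Integrable fun z : RVec d × RVec d => χ (s • z.1) * χ (s • z.2) := by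
    simp only [← hχ']
    exact χ'.integrable.mul_prod χ'.integrable
  exact h1.mul_bdd (c := ‖φ‖ * (‖C‖ * ‖ψ‖)) (continuous_corr U C φ ψ).aestronglyMeasurable
    (Eventually.of_forall fun z => norm_corr_le U C φ ψ z)

/-- The Fourier transform of a product with a function which is translated along the
antidiagonal. -/
def twisted (η Q : Matrix (Fin d) (Fin d) ℝ) (h k : RVec d → ℂ) (Θ : RVec d × RVec d → ℂ)
    (z : RVec d × RVec d) : ℂ :=
  ft η k z.2 * ft η (fun p => h p * Θ (z + (act Q p, -act Q p))) z.1

/-- After Fubini, translating `z` by `(Qp, -Qp)` moves the shift from `Θ` to the transform of `k`;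
the phase `e^{-ipx}` is unaffected since `p Qp = 0`. Integrability of `Θ` justifies the exchange,
which is why the correlation function needs a cutoff. -/
lemma integral_twisted (hQ : IsSkewFor η Q) (hh : Integrable h) (hhc : Continuous h)
    (hk : Integrable k) {Θ : RVec d × RVec d → ℂ} (hΘ : Integrable Θ) (hΘc : Continuous Θ) :
    ∫ z, twisted η Q h k Θ z = ∫ z, Θ z * warpKernel η Q h k z := by
  have hkc := continuous_ft η hk
  have hQc := continuous_act Q
  set K : RVec d × RVec d → RVec d → ℂ := fun z p =>
    Complex.exp (-(pairing η p z.1 : ℂ) * Complex.I) * ft η k z.2 *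
      (h p * Θ (z + (act Q p, -act Q p))) with hK
  set K' : RVec d × RVec d → RVec d → ℂ := fun z p =>
    Complex.exp (-(pairing η p z.1 : ℂ) * Complex.I) * ft η k (z.2 + act Q p) *
      (h p * Θ z) with hK'
  have iK : Integrable (Function.uncurry K) (volume.prod volume) := by
    have h0 : Integrable (fun w : (RVec d × RVec d) × RVec d =>
        h w.2 * Θ (w.1 + (act Q w.2, -act Q w.2))) (volume.prod volume) := by
      refine (integrable_prod_iff' (Continuous.aestronglyMeasurable (by fun_prop))).2 ⟨?_, ?_⟩
      · exact Eventually.of_forall fun p =>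
          (hΘ.comp_add_right (act Q p, -act Q p)).const_mul (h p)
      · have : ∀ p, ∫ z, ‖h p * Θ (z + (act Q p, -act Q p))‖ = ‖h p‖ * ∫ z, ‖Θ z‖ := by
          intro p
          simp only [norm_mul, integral_const_mul]
          rw [integral_add_right_eq_self (fun z => ‖Θ z‖)]
        simp only [this]
        exact hh.norm.mul_const _
    refine h0.bdd_mul (c := ∫ p, ‖k p‖) (Continuous.aestronglyMeasurable (by fun_prop)) ?_
    refine Eventually.of_forall fun w => ?_
    rw [norm_mul, norm_exp_pairing, one_mul]
    exact norm_ft_le η k _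
  have iK' : Integrable (Function.uncurry K') (volume.prod volume) := by
    have h0 : Integrable (fun w : (RVec d × RVec d) × RVec d => h w.2 * Θ w.1)
        (volume.prod volume) := by
      simpa only [mul_comm] using hΘ.mul_prod hh
    refine h0.bdd_mul (c := ∫ p, ‖k p‖) (Continuous.aestronglyMeasurable (by fun_prop)) ?_
    refine Eventually.of_forall fun w => ?_
    rw [norm_mul, norm_exp_pairing, one_mul]
    exact norm_ft_le η k _
  have e1 : ∀ z, twisted η Q h k Θ z = ∫ p, K z p := fun z => by
    rw [twisted, ft, ft, ← ft, ← integral_const_mul]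
    congr 1; funext p
    simp only [hK, smul_eq_mul, ft]
    ring
  have e2 : ∀ z, Θ z * warpKernel η Q h k z = ∫ p, K' z p := fun z => by
    rw [warpKernel, ft, ← integral_const_mul]
    congr 1; funext p
    simp only [hK', smul_eq_mul]
    ring
  have e3 : ∀ p, ∫ z, K z p = ∫ z, K' z p := fun p => by
    rw [← integral_sub_right_eq_self (fun z => K z p) ((act Q p, -act Q p) : RVec d × RVec d)]
    congr 1; funext z
    simp only [hK, hK', sub_add_cancel, Prod.fst_sub, Prod.snd_sub, sub_neg_eq_add]
    rw [sub_eq_add_neg z.1, pairing_add_right, pairing_neg_right, pairing_act_self hQ, neg_zero,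
      add_zero]
  simp only [e1, e2]
  rw [integral_integral_swap iK, integral_integral_swap iK']
  simp only [e3]

lemma IsSmoothBdd.symbolFam_corr (hC : IsSmoothBdd U C) (Q : Matrix (Fin d) (Fin d) ℝ) (φ ψ : H) :
    SymbolFam 0 fun (z : RVec d × RVec d) p => corr U C φ ψ (z + (act Q p, -act Q p)) := by
  simp only [corr_shift]
  have h1 := (hC.symbolFam_conjOp_act Q (fun z : RVec d × RVec d => z.1)).op_apply
    (SymbolFam.const (v := fun z : RVec d × RVec d => U (z.1 + z.2) ψ) (M := ‖ψ‖)
      fun z => ((U _).norm_map ψ).le)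
  exact h1.clm ((innerSL ℂ φ).restrictScalars ℝ)

/-- The bounds are uniform in the cutoff parameter up to and including `0`, where the cutoff
disappears. -/
lemma IsSmoothBdd.symbolFam_cutoffCorr (hC : IsSmoothBdd U C) (Q : Matrix (Fin d) (Fin d) ℝ)
    (φ ψ : H) (χ : 𝓢(RVec d, ℂ)) :
    SymbolFam 0 fun (i : (RVec d × RVec d) × Set.Icc (0 : ℝ) 1) p =>
      cutoffCorr U C φ ψ χ i.2 (i.1 + (act Q p, -act Q p)) := by
  have h1 : ∀ (a : (RVec d × RVec d) × Set.Icc (0 : ℝ) 1 → RVec d) (M : RVec d →L[ℝ] RVec d),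
      SymbolFam 0 fun (i : (RVec d × RVec d) × Set.Icc (0 : ℝ) 1) p =>
        χ ((i.2 : ℝ) • (a i + M p)) := fun a M => by
    have := (SymbolFam.schwartz (ι := Unit) 0 χ).comp_affine
      (fun _ : (RVec d × RVec d) × Set.Icc (0 : ℝ) 1 => ()) (fun i => (i.2 : ℝ) • a i)
      (fun i => (i.2 : ℝ) • M) (c := ‖M‖) fun i => by
        rw [norm_smul, Real.norm_of_nonneg i.2.2.1]
        exact mul_le_of_le_one_left (norm_nonneg _) i.2.2.2
    simpa [smul_add] using this
  have h2 := ((h1 (fun i => i.1.1) (actL Q)).mul_complex (h1 (fun i => i.1.2) (-actL Q))).mul_complex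
    ((hC.symbolFam_corr Q φ ψ).reindex fun i : (RVec d × RVec d) × Set.Icc (0 : ℝ) 1 => i.1)
  simpa [cutoffCorr] using h2

/-- A uniform integrable bound on the twisted transforms of the cutoff correlation functions. -/
lemma IsSmoothBdd.exists_twisted_bound (hη : η.det ≠ 0) (hC : IsSmoothBdd U C)
    (Q : Matrix (Fin d) (Fin d) ℝ) (φ ψ : H) (χ : 𝓢(RVec d, ℂ))
    (hh : ∀ n, SymbolFam n fun (_ : Unit) => h) (hk : ∀ n, SymbolFam n fun (_ : Unit) => k) :
    ∃ b : RVec d × RVec d → ℝ, Integrable b ∧ ∀ s ∈ Set.Icc (0 : ℝ) 1, ∀ z,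
      ‖twisted η Q h k (cutoffCorr U C φ ψ χ s) z‖ ≤ b z := by
  have h1 := ((hh (-((d : ℤ) + 1))).reindex
    fun _ : (RVec d × RVec d) × Set.Icc (0 : ℝ) 1 => ()).mul_complex
    (hC.symbolFam_cutoffCorr Q φ ψ χ)
  rw [add_zero] at h1
  obtain ⟨A, hA0, hA⟩ := h1.ft_decay hη
  obtain ⟨B, hB0, hB⟩ := (hk _).ft_decay hη
  refine ⟨fun z => (A * (1 + ‖z.1‖) ^ (-((d : ℤ) + 1))) * (B * (1 + ‖z.2‖) ^ (-((d : ℤ) + 1))),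
    ((integrable_weight d).const_mul A).mul_prod ((integrable_weight d).const_mul B),
    fun s hs z => ?_⟩
  rw [twisted, norm_mul, mul_comm]
  exact mul_le_mul (hA (z, ⟨s, hs⟩) z.1) (hB () z.2) (norm_nonneg _) (by positivity)

lemma continuous_ft_param {X : Type*} [TopologicalSpace X] [FirstCountableTopology X]
    (η : Matrix (Fin d) (Fin d) ℝ) {g : X → RVec d → ℂ} {b : RVec d → ℝ} (hb : Integrable b)
    (hg : ∀ t, AEStronglyMeasurable (g t)) (hgb : ∀ t p, ‖g t p‖ ≤ b p)
    (hgc : ∀ p, Continuous fun t => g t p) {y : X → RVec d} (hy : Continuous y) :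
    Continuous fun t => ft η (g t) (y t) := by
  refine continuous_of_dominated (bound := b) (fun t => ?_) (fun t => ?_) hb ?_
  · exact (integrable_phase η (hb.mono' (hg t) (Eventually.of_forall (hgb t))) _).1
  · exact Eventually.of_forall fun p => by
      rw [norm_smul, norm_exp_pairing, one_mul]; exact hgb _ _
  · refine Eventually.of_forall fun p => ?_
    have := hgc p
    fun_prop

lemma continuous_twisted (U : TranslationRep d H) (C : H →L[ℂ] H) (η Q : Matrix (Fin d) (Fin d) ℝ)
    (φ ψ : H) (χ : 𝓢(RVec d, ℂ)) (hh : Integrable h) (hk : Integrable k) :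
    Continuous fun t : ℝ × (RVec d × RVec d) =>
      twisted η Q h k (cutoffCorr U C φ ψ χ t.1) t.2 := by
  obtain ⟨M, hM⟩ : ∃ M, ∀ x, ‖χ x‖ ≤ M := ⟨_, fun x => χ.norm_le_seminorm ℝ x⟩
  have hM0 : 0 ≤ M := (norm_nonneg _).trans (hM 0)
  have hb : ∀ s z, ‖cutoffCorr U C φ ψ χ s z‖ ≤ M * M * (‖φ‖ * (‖C‖ * ‖ψ‖)) := fun s z => by
    rw [cutoffCorr, norm_mul, norm_mul]
    gcongr
    · exact hM _
    · exact hM _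
    · exact norm_corr_le U C φ ψ z
  refine ((continuous_ft η hk).comp (continuous_snd.comp continuous_snd)).mul ?_
  have hbd : ∀ s z p, ‖h p * cutoffCorr U C φ ψ χ s z‖ ≤ ‖h p‖ * (M * M * (‖φ‖ * (‖C‖ * ‖ψ‖))) :=
    fun s z p => by rw [norm_mul]; gcongr; exact hb _ _
  have hQc := continuous_act Q
  refine continuous_ft_param η (hh.norm.mul_const (M * M * (‖φ‖ * (‖C‖ * ‖ψ‖))))
    (fun t => hh.1.mul (Continuous.aestronglyMeasurable ?_)) (fun t p => hbd _ _ _) (fun p => ?_)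
    (continuous_fst.comp continuous_snd)
  · exact continuous_cutoffCorr U C φ ψ χ continuous_const
      (continuous_const.add (hQc.prodMk hQc.neg))
  · exact continuous_const.mul (continuous_cutoffCorr U C φ ψ χ continuous_fst
      (continuous_snd.add continuous_const))

lemma cutoffCorr_zero (U : TranslationRep d H) (C : H →L[ℂ] H) (φ ψ : H) {χ : 𝓢(RVec d, ℂ)}
    (hχ : χ 0 = 1) : cutoffCorr U C φ ψ χ 0 = corr U C φ ψ := by
  funext z
  simp [cutoffCorr, hχ]

lemma IsSmoothBdd.tendsto_integral_twisted (hη : η.det ≠ 0) (hC : IsSmoothBdd U C)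
    (Q : Matrix (Fin d) (Fin d) ℝ) (φ ψ : H) {χ : 𝓢(RVec d, ℂ)} (hχ : χ 0 = 1)
    (hh : ∀ n, SymbolFam n fun (_ : Unit) => h) (hk : ∀ n, SymbolFam n fun (_ : Unit) => k) :
    Tendsto (fun s : ℝ => ∫ z, twisted η Q h k (cutoffCorr U C φ ψ χ s) z) (𝓝[>] 0)
      (𝓝 (∫ z, twisted η Q h k (corr U C φ ψ) z)) := by
  obtain ⟨b, hb, hle⟩ := hC.exists_twisted_bound hη Q φ ψ χ hh hk
  have hc := continuous_twisted U C η Q φ ψ χ ((hh _).integrable le_rfl ())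
    ((hk _).integrable le_rfl ())
  refine tendsto_integral_filter_of_dominated_convergence b ?_ ?_ hb ?_
  · exact Eventually.of_forall fun s =>
      (hc.comp (continuous_const.prodMk continuous_id)).aestronglyMeasurable
  · filter_upwards [Ioo_mem_nhdsGT (zero_lt_one (α := ℝ))] with s hs
    exact Eventually.of_forall fun z => hle s ⟨hs.1.le, hs.2.le⟩ z
  · refine Eventually.of_forall fun z => ?_
    have h1 := ((hc.comp (continuous_id.prodMk continuous_const :
      Continuous fun s : ℝ => (s, z))).tendsto 0).mono_left (nhdsWithin_le_nhds (s := Set.Ioi 0))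
    simpa only [Function.comp_def, id, cutoffCorr_zero U C φ ψ hχ] using h1

lemma corr_adjoint [CompleteSpace H] (U : TranslationRep d H) (C : H →L[ℂ] H) (φ ψ : H)
    (x y : RVec d) :
    (starRingEnd ℂ) (corr U C.adjoint ψ φ (x, y)) = corr U C φ ψ (-y, -x) := by
  rw [corr, corr, inner_conj_symm, inner_apply_left, ContinuousLinearMap.adjoint_inner_left,
    inner_apply_left]

/-- The correlation function, the cutoff and the kernel are each compatible with conjugation and
`(x, y) ↦ (-y, -x)`, a substitution that preserves the measure. -/
lemma integral_cutoffCorr_warpKernel_conj [CompleteSpace H] (U : TranslationRep d H)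
    (C : H →L[ℂ] H) (hQ : IsSkewFor η Q) (hh : Integrable h)
    (hk : Integrable k) (hh' : ∀ p, (starRingEnd ℂ) (h p) = h p)
    (hk' : ∀ p, (starRingEnd ℂ) (k p) = k p) (φ ψ : H) {χ : 𝓢(RVec d, ℂ)}
    (hχ : ∀ x, χ (-x) = χ x) (hχ' : ∀ x, (starRingEnd ℂ) (χ x) = χ x) (s : ℝ) :
    (starRingEnd ℂ) (∫ z, cutoffCorr U C.adjoint ψ φ χ s z * warpKernel η Q k h z)
      = ∫ z, cutoffCorr U C φ ψ χ s z * warpKernel η Q h k z := by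
  have e : ∀ z : RVec d × RVec d,
      (starRingEnd ℂ) (cutoffCorr U C.adjoint ψ φ χ s z * warpKernel η Q k h z) =
        cutoffCorr U C φ ψ χ s (-z.swap) * warpKernel η Q h k (-z.swap) := fun z => by
    rw [map_mul, ← Prod.mk.eta (p := z), warpKernel_conj hQ hh hk hh' hk']
    simp only [cutoffCorr, map_mul, hχ', corr_adjoint, Prod.swap_prod_mk, Prod.neg_mk, smul_neg, hχ]
    ring
  rw [← integral_conj]
  simp only [e]
  have h1 := integral_prod_swap (μ := (volume : Measure (RVec d))) (ν := (volume : Measure (RVec d)))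
    (fun z => cutoffCorr U C φ ψ χ s (-z) * warpKernel η Q h k (-z))
  exact h1.trans (integral_neg_eq_self
    (fun z => cutoffCorr U C φ ψ χ s z * warpKernel η Q h k z) volume)

end Correlation

/-! ### The adjoint relation with momentum cutoffs -/

section Pairing

variable {d : ℕ} {H : Type*} [NormedAddCommGroup H] [InnerProductSpace ℂ H] [CompleteSpace H]
variable {U : TranslationRep d H} {η Q : Matrix (Fin d) (Fin d) ℝ} {C : H →L[ℂ] H}
variable {h k : RVec d → ℂ}

lemma IsSmoothBdd.inner_spectralIntegral_eq (hη : η.det ≠ 0) (hC : IsSmoothBdd U C)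
    (Q : Matrix (Fin d) (Fin d) ℝ) (φ ψ : H)
    (hh : ∀ n, SymbolFam n fun (_ : Unit) => h) (hk : ∀ n, SymbolFam n fun (_ : Unit) => k) :
    ⟪φ, spectralIntegral U η fun p => h p • conjOp U (act Q p) C
        (spectralIntegral U η fun q => k q • ψ)⟫_ℂ =
      (|η.det| / (2 * Real.pi) ^ d) • (|η.det| / (2 * Real.pi) ^ d) •
        ∫ z, twisted η Q h k (corr U C φ ψ) z := by
  set c := |η.det| / (2 * Real.pi) ^ d with hc
  have hhi := (hh _).integrable le_rfl ()
  have hki := (hk _).integrable le_rfl ()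
  have hhc : Continuous h := ((hh 0).contDiff ()).continuous
  have hQc := continuous_act Q
  obtain ⟨χ, hχ, -, -⟩ := exists_real_even_schwartz d
  have htw : Integrable (twisted η Q h k (corr U C φ ψ)) := by
    obtain ⟨b, hb, hle⟩ := hC.exists_twisted_bound hη Q φ ψ χ hh hk
    have hcont := continuous_twisted U C η Q φ ψ χ hhi hki
    rw [← cutoffCorr_zero U C φ ψ hχ]
    exact hb.mono' (hcont.comp (continuous_const.prodMk continuous_id)).aestronglyMeasurable
      (Eventually.of_forall fun z => hle 0 ⟨le_rfl, zero_le_one⟩ z)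
  have hkft : Integrable (ft η k) := by
    obtain ⟨B, -, hB⟩ := (hk _).ft_decay hη
    exact ((integrable_weight d).const_mul B).mono' (continuous_ft η hki).aestronglyMeasurable
      (Eventually.of_forall fun y => hB () y)
  set S := spectralIntegral U η fun q => k q • ψ with hS
  have hS' : S = c • ∫ y, ft η k y • U y ψ := by
    rw [hS, spectralIntegral_eq]
    simp only [ft_smul_const, map_smul]
    rfl
  have iS : Integrable fun y => ft η k y • U y ψ :=
    hkft.smul_bdd (C := ‖ψ‖) (U.continuous_orbit ψ).aestronglyMeasurable
      (Eventually.of_forall fun y => ((U y).norm_map ψ).le)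
  have hf := hC.symbolFam_smul_conjOp Q (hh (-((d : ℤ) + 1))) 0 S
  simp only [zero_add] at hf
  have i1 := hf.integrable le_rfl ()
  have i2 := hf.integrable_apply_ft hη U le_rfl ()
  -- `U(x) α_{Qp}(C) U(y) = U(x + Qp) C U(y - Qp)`, which is where the antidiagonal shift comes
  -- from.
  have e1 : ∀ x p, ⟪φ, U x (conjOp U (act Q p) C S)⟫_ℂ =
      c • ∫ y, ft η k y * corr U C φ ψ ((x, y) + (act Q p, -act Q p)) := by
    intro x p
    have h1 : ∀ v, ⟪φ, U x (conjOp U (act Q p) C v)⟫_ℂ =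
        ((innerSL ℂ φ) ∘L (opU U x) ∘L (conjOp U (act Q p) C)) v := fun v => rfl
    rw [h1, hS', ContinuousLinearMap.map_smul_of_tower, ← ContinuousLinearMap.integral_comp_comm _ iS]
    congr 2; funext y
    rw [map_smul, smul_eq_mul, ← h1, corr]
    congr 1
    simp only [conjOp_apply, ← U.map_add (-act Q p), Prod.fst_add, Prod.snd_add]
    rw [U.map_add x, add_comm y]
  have e2 : ∀ x, ⟪φ, U x (ft η (fun p => h p • conjOp U (act Q p) C S) x)⟫_ℂ =
      c • ∫ y, twisted η Q h k (corr U C φ ψ) (x, y) := by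
    intro x
    have h1 : ∀ v, ⟪φ, U x v⟫_ℂ = ((innerSL ℂ φ) ∘L (opU U x)) v := fun v => rfl
    have iF : Integrable (Function.uncurry fun (p y : RVec d) =>
        Complex.exp (-(pairing η p x : ℂ) * Complex.I) * corr U C φ ψ ((x, y) + (act Q p, -act Q p)) *
          (h p * ft η k y)) (volume.prod volume) := by
      refine (hhi.mul_prod hkft).bdd_mul (c := ‖φ‖ * (‖C‖ * ‖ψ‖))
        (Continuous.aestronglyMeasurable ?_) ?_
      · have := continuous_corr U C φ ψ
        fun_prop
      · refine Eventually.of_forall fun w => ?_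
        rw [norm_mul, norm_exp_pairing, one_mul]
        exact norm_corr_le U C φ ψ _
    rw [h1, ft, ← ContinuousLinearMap.integral_comp_comm _ (integrable_phase η i1 x)]
    simp only [map_smul, ← h1, inner_smul_right, e1]
    have e3 : ∀ p, Complex.exp (-(pairing η p x : ℂ) * Complex.I) * (h p *
        c • ∫ y, ft η k y * corr U C φ ψ ((x, y) + (act Q p, -act Q p))) =
        c • ∫ y, Complex.exp (-(pairing η p x : ℂ) * Complex.I) *
          corr U C φ ψ ((x, y) + (act Q p, -act Q p)) * (h p * ft η k y) := fun p => by
      rw [mul_smul_comm, mul_smul_comm, ← mul_assoc, ← integral_const_mul]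
      congr 2; funext y
      ring
    simp only [e3]
    rw [integral_smul, integral_integral_swap iF]
    congr 2; funext y
    rw [twisted, ft, ft, ← ft, ← integral_const_mul]
    congr 1; funext p
    simp only [smul_eq_mul, ft]
    ring
  rw [spectralIntegral_eq, inner_smul_right_eq_smul, ← integral_inner i2]
  simp only [e2]
  rw [integral_smul]
  congr 2
  exact (integral_prod _ htw).symm

/-- The regularized form of the adjoint relation for warped convolutions. -/
theorem IsSmoothBdd.inner_spectralIntegral_adjoint (hη : η.det ≠ 0) (hC : IsSmoothBdd U C)
    (hQ : IsSkewFor η Q) (φ ψ : H)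
    (hh : ∀ n, SymbolFam n fun (_ : Unit) => h) (hk : ∀ n, SymbolFam n fun (_ : Unit) => k)
    (hh' : ∀ p, (starRingEnd ℂ) (h p) = h p) (hk' : ∀ p, (starRingEnd ℂ) (k p) = k p) :
    ⟪φ, spectralIntegral U η fun p => h p • conjOp U (act Q p) C
        (spectralIntegral U η fun q => k q • ψ)⟫_ℂ =
      ⟪spectralIntegral U η fun p => k p • conjOp U (act Q p) C.adjoint
        (spectralIntegral U η fun q => h q • φ), ψ⟫_ℂ := by
  have hhi := (hh _).integrable le_rfl ()
  have hki := (hk _).integrable le_rfl ()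
  obtain ⟨χ, hχ, hev, hre⟩ := exists_real_even_schwartz d
  rw [← inner_conj_symm (spectralIntegral U η _) ψ, hC.inner_spectralIntegral_eq hη Q φ ψ hh hk,
    hC.adjoint.inner_spectralIntegral_eq hη Q ψ φ hk hh]
  -- The kernel form is available only with the position cutoff `s > 0`. The symmetry is proved
  -- there, and `s ↘ 0` is taken in the twisted form, which has an integrable bound uniform in `s`.
  have key : (starRingEnd ℂ) (∫ z, twisted η Q k h (corr U C.adjoint ψ φ) z) =
      ∫ z, twisted η Q h k (corr U C φ ψ) z := by
    refine tendsto_nhds_unique ((Complex.continuous_conj.tendsto _).comp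
      (hC.adjoint.tendsto_integral_twisted hη Q ψ φ hχ hk hh))
      ((hC.tendsto_integral_twisted hη Q φ ψ hχ hh hk).congr' ?_)
    filter_upwards [self_mem_nhdsWithin] with s hs
    have hcont : ∀ (C : H →L[ℂ] H) (φ ψ : H), Continuous (cutoffCorr U C φ ψ χ s) :=
      fun C φ ψ => continuous_cutoffCorr U C φ ψ χ continuous_const continuous_id
    rw [Function.comp_apply, integral_twisted hQ hki ((hk 0).contDiff ()).continuous hhi
        (integrable_cutoffCorr U _ _ _ χ hs) (hcont _ _ _),
      integral_cutoffCorr_warpKernel_conj U C hQ hhi hki hh' hk' φ ψ hev hre,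
      integral_twisted hQ hhi ((hh 0).contDiff ()).continuous hki
        (integrable_cutoffCorr U _ _ _ χ hs) (hcont _ _ _)]
  simp only [Complex.real_smul, map_mul, Complex.conj_ofReal, key]

end Pairing

/-! ### The adjoint relation for smooth bounded operators -/

section BoundedAdjoint

variable {d : ℕ} {H : Type*} [NormedAddCommGroup H] [InnerProductSpace ℂ H] [CompleteSpace H]
variable {U : TranslationRep d H} {η Q : Matrix (Fin d) (Fin d) ℝ} {C : H →L[ℂ] H}

/-- Warped convolution intertwines adjoints, for smooth bounded operators. -/
theorem IsSmoothBdd.inner_hasSpectralIntegral_adjoint (hη : IsGram η) (hC : IsSmoothBdd U C)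
    (hQ : IsSkewFor η Q) (φ ψ : smoothVectors U) {v w : H}
    (hv : HasSpectralIntegral U η (fun p => conjOp U (act Q p) C ψ) v)
    (hw : HasSpectralIntegral U η (fun p => conjOp U (act Q p) C.adjoint φ) w) :
    ⟪(φ : H), v⟫_ℂ = ⟪w, (ψ : H)⟫_ℂ := by
  obtain ⟨W, -, k, hWk⟩ := hC.exists_hasSpectralIntegral hη.2 Q
  obtain ⟨χ, hχ, -, hre⟩ := exists_real_even_schwartz d
  have hone : SymbolFam 0 fun (_ : Unit) (_ : RVec d) => (1 : H →L[ℂ] H) :=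
    SymbolFam.const (M := ‖(1 : H →L[ℂ] H)‖) fun _ => le_rfl
  -- First limit: `δ` is fixed and `ε ↘ 0`. The cutoff `S` at scale `δ` commutes with translations,
  -- so `S ψ` is smooth and its warped image is `W` applied to `S (1 + |P|^2)^k ψ`; on the other
  -- side the cutoff on `φ` disappears by continuity of a bounded operator.
  have key : ∀ δ : ℝ, 0 < δ →
      ⟪(φ : H), W (spectralIntegral U η fun p => χ (δ • p) • ((onePlusPSq U ^ k) ψ : H))⟫_ℂ =
        ⟪spectralIntegral U η fun p => χ (δ • p) • conjOp U (act Q p) C.adjoint φ, (ψ : H)⟫_ℂ := by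
    intro δ hδ
    have hρ := symbolFam_rescale χ hδ (-((d : ℤ) + 1))
    set S := weightedOp hη.2 U hρ hone with hS
    have hcomm : ∀ x ψ, S (U x ψ) = U x (S ψ) := fun x ψ => by
      have hs : SymbolFam (-((d : ℤ) + 1)) fun (_ : Unit) p => χ (δ • p) • ψ :=
        symbolFam_smul_op hρ hone ψ
      simp only [hS, weightedOp_apply, one_apply_eq_self]
      rw [apply_spectralIntegral U
        (hs.integrable le_rfl ()) (hs.integrable_apply_ft hη.2 U le_rfl ())]
      simp only [map_smul]
    have hSsm : IsSmoothBdd U S := IsSmoothBdd.of_commute hcomm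
    have h1 := (hWk (hSsm.toEnd ψ) χ hχ).2
    rw [onePlusPSq_toEnd_of_commute hcomm hSsm, IsSmoothBdd.coe_toEnd,
      IsSmoothBdd.coe_toEnd] at h1
    have h2 : Tendsto (fun ε : ℝ => ⟪spectralIntegral U η fun p => χ (δ • p) •
        conjOp U (act Q p) C.adjoint (spectralIntegral U η fun q => χ (ε • q) • (φ : H)),
        (ψ : H)⟫_ℂ) (𝓝[>] 0) (𝓝 ⟪spectralIntegral U η fun p => χ (δ • p) •
          conjOp U (act Q p) C.adjoint φ, (ψ : H)⟫_ℂ) := by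
      have hb := hC.adjoint.symbolFam_conjOp_act (ι := Unit) Q fun _ => 0
      simp only [zero_add] at hb
      exact (((weightedOp hη.2 U hρ hb).continuous.tendsto _).comp
        (tendsto_spectralIntegral_const hη U hχ (φ : H))).inner tendsto_const_nhds
    refine tendsto_nhds_unique (tendsto_const_nhds.inner h1) (h2.congr' ?_)
    filter_upwards [self_mem_nhdsWithin] with ε hε
    exact (hC.inner_spectralIntegral_adjoint hη.2 hQ (φ : H) (ψ : H)
      (fun n => symbolFam_rescale χ hε n) (fun n => symbolFam_rescale χ hδ n)
      (fun _ => hre _) (fun _ => hre _)).symm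
  rw [hv.unique (hWk ψ)]
  -- Second limit, `δ ↘ 0`: the left side converges because `W` is bounded and scalar cutoffs tend
  -- strongly to the identity, the right side by the definition of `w`.
  refine tendsto_nhds_unique (tendsto_const_nhds.inner ((W.continuous.tendsto _).comp
    (tendsto_spectralIntegral_const hη U hχ ((onePlusPSq U ^ k) ψ : H))))
    (((hw χ hχ).2.inner tendsto_const_nhds).congr' ?_)
  filter_upwards [self_mem_nhdsWithin] with δ hδ
  exact (key δ hδ).symm

lemma inner_spectralIntegral_of_integrable {g : RVec d → H} (hg : Integrable g)
    (hg' : Integrable fun x => U x (ft η g x)) (φ : H) :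
    ⟪φ, spectralIntegral U η g⟫_ℂ = (|η.det| / (2 * Real.pi) ^ d) •
      ∫ x, ∫ p, Complex.exp (-(pairing η p x : ℂ) * Complex.I) * ⟪φ, U x (g p)⟫_ℂ := by
  rw [spectralIntegral_eq, inner_smul_right_eq_smul, ← integral_inner hg']
  congr 2; funext x
  have h1 : ∀ v, ⟪φ, U x v⟫_ℂ = ((innerSL ℂ φ) ∘L (opU U x)) v := fun v => rfl
  rw [h1, ft, ← ContinuousLinearMap.integral_comp_comm _ (integrable_phase η hg x)]
  simp only [map_smul, ← h1, inner_smul_right]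

/-- An unbounded operator cannot be pulled out of the integral directly. In matrix elements with
smooth vectors it passes to the other side for each `x` and `p`, as it is symmetric and commutes
with `U(x)`. -/
lemma HasSpectralIntegral.inner_onePlusPSq_pow {V : RVec d → smoothVectors U} {m : ℕ} {u v : H}
    (hu : HasSpectralIntegral U η (fun p => (V p : H)) u)
    (hv : HasSpectralIntegral U η (fun p => ((onePlusPSq U ^ m) (V p) : H)) v)
    (ψ : smoothVectors U) : ⟪(ψ : H), v⟫_ℂ = ⟪((onePlusPSq U ^ m) ψ : H), u⟫_ℂ := by
  obtain ⟨χ, hχ, -, -⟩ := exists_real_even_schwartz d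
  obtain ⟨iu, tu⟩ := hu χ hχ
  obtain ⟨iv, tv⟩ := hv χ hχ
  refine tendsto_nhds_unique (tendsto_const_nhds.inner tv)
    ((tendsto_const_nhds.inner tu).congr' ?_)
  filter_upwards [self_mem_nhdsWithin] with ε hε
  rw [inner_spectralIntegral_of_integrable (iu ε hε).1 (iu ε hε).2,
    inner_spectralIntegral_of_integrable (iv ε hε).1 (iv ε hε).2]
  congr 2; funext x; congr 1; funext p
  rw [(U x).map_smul, (U x).map_smul, inner_smul_right, inner_smul_right, ← coe_translate, ← coe_translate,
    ← onePlusPSq_pow_translate, WarpedConvolution.inner_onePlusPSq_pow]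

end BoundedAdjoint

/-! ### Warped convolutions and adjoints in `𝔉` -/

section UnboundedOperators

variable {d : ℕ} {H : Type*} [NormedAddCommGroup H] [InnerProductSpace ℂ H]
variable {U : TranslationRep d H} {η Q : Matrix (Fin d) (Fin d) ℝ} {C : H →L[ℂ] H}
variable {F G : H →ₗ.[ℂ] H} {m : ℕ}

lemma alpha_apply_of_eq (hF : smoothVectors U ≤ F.domain)
    (hFC : ∀ ψ : smoothVectors U, F ⟨ψ, hF ψ.2⟩ = C ((onePlusPSq U ^ m) ψ : H)) (x : RVec d)
    (ψ : smoothVectors U) :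
    alpha U x F ⟨ψ, mem_alpha_domain U hF x ψ⟩ = conjOp U x C ((onePlusPSq U ^ m) ψ : H) := by
  refine (congrArg (U x) (hFC (translate U (-x) ψ))).trans ?_
  rw [onePlusPSq_pow_translate, conjOp_apply, coe_translate]

lemma hasWarp_of_eq (hF : smoothVectors U ≤ F.domain)
    (hFC : ∀ ψ : smoothVectors U, F ⟨ψ, hF ψ.2⟩ = C ((onePlusPSq U ^ m) ψ : H))
    (ψ : smoothVectors U) {v : H} (hv : HasSpectralIntegral U η
      (fun p => conjOp U (act Q p) C ((onePlusPSq U ^ m) ψ : H)) v) : HasWarp U η Q F ψ v := by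
  refine ⟨_, fun p => ?_, hv⟩
  rw [← alpha_apply_of_eq hF hFC]
  exact LinearPMap.mem_graph _ ⟨(ψ : H), mem_alpha_domain U hF (act Q p) ψ⟩

lemma HasWarp.warp_apply {ψ v : H} (h : HasWarp U η Q F ψ v) (hψ : ψ ∈ (warp U η Q F).domain) :
    warp U η Q F ⟨ψ, hψ⟩ = v :=
  HasWarp.unique (Exists.choose_spec hψ.2) h

variable [CompleteSpace H]

/-- The warped convolution of a smooth operator is defined on all smooth vectors and is again
smooth. -/
theorem IsSmoothOp.warp (hη : η.det ≠ 0) (hF : IsSmoothOp U F) (Q : Matrix (Fin d) (Fin d) ℝ) :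
    (warp U η Q F).domain = smoothVectors U ∧ IsSmoothOp U (warp U η Q F) := by
  obtain ⟨hd, m, C, hC, hFC⟩ := (isSmoothOp_iff U _).1 hF
  obtain ⟨W, hW, k, hWk⟩ := hC.exists_hasSpectralIntegral hη Q
  have h1 : ∀ ψ : smoothVectors U,
      HasWarp U η Q F ψ (W ((onePlusPSq U ^ (k + m)) ψ : H)) := fun ψ => by
    rw [pow_add, Module.End.mul_apply]
    exact hasWarp_of_eq hd hFC ψ (hWk _)
  have h2 : (WarpedConvolution.warp U η Q F).domain = smoothVectors U :=
    le_antisymm (fun ψ h => h.1) fun ψ h => ⟨h, _, h1 ⟨ψ, h⟩⟩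
  exact ⟨h2, (isSmoothOp_iff U _).2 ⟨h2.ge, k + m, W, hW, fun ψ => (h1 ψ).warp_apply _⟩⟩

/-- An operator which is formally adjoint to a smooth operator on the smooth vectors is smooth. -/
theorem IsSmoothOp.of_formalAdjoint (hF : IsSmoothOp U F) (hG : smoothVectors U ≤ G.domain)
    (hadj : ∀ φ ψ : smoothVectors U,
      ⟪G ⟨φ, hG φ.2⟩, (ψ : H)⟫_ℂ = ⟪(φ : H), F ⟨ψ, hF.domain_le ψ.2⟩⟫_ℂ) :
    IsSmoothOp U G := by
  obtain ⟨hd, m, C, hC, hFC⟩ := (isSmoothOp_iff U _).1 hF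
  -- On `𝒟` the formal adjoint of `C (1 + |P|^2)^m` is `(1 + |P|^2)^m` times the adjoint of `C`;
  -- commuting the power to the right restores the normal form.
  obtain ⟨C', hC', h⟩ := hC.adjoint.exists_onePlusPSq_pow_comm m
  refine (isSmoothOp_iff U _).2 ⟨hG, m, C', hC', fun φ => ?_⟩
  refine (dense_smoothVectors U).eq_of_inner_left (𝕜 := ℂ) fun ψ hψ => ?_
  rw [hadj φ ⟨ψ, hψ⟩, hFC ⟨ψ, hψ⟩, ← h, inner_onePlusPSq_pow U m _ ⟨ψ, hψ⟩, IsSmoothBdd.coe_toEnd,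
    ContinuousLinearMap.adjoint_inner_left]

/-- Warped convolution preserves formal adjoints on the smooth vectors. -/
theorem IsSmoothOp.inner_warp (hη : IsGram η) (hQ : IsSkewFor η Q) (hF : IsSmoothOp U F)
    (hG : smoothVectors U ≤ G.domain)
    (hadj : ∀ φ ψ : smoothVectors U,
      ⟪G ⟨φ, hG φ.2⟩, (ψ : H)⟫_ℂ = ⟪(φ : H), F ⟨ψ, hF.domain_le ψ.2⟩⟫_ℂ)
    (φ : (WarpedConvolution.warp U η Q G).domain) (ψ : (WarpedConvolution.warp U η Q F).domain) :
    ⟪WarpedConvolution.warp U η Q G φ, (ψ : H)⟫_ℂ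
      = ⟪(φ : H), WarpedConvolution.warp U η Q F ψ⟫_ℂ := by
  obtain ⟨hd, m, C, hC, hFC⟩ := (isSmoothOp_iff U _).1 hF
  obtain ⟨C', hC', h⟩ := hC.adjoint.exists_onePlusPSq_pow_comm m
  have hGC : ∀ φ : smoothVectors U, G ⟨φ, hG φ.2⟩ = C' ((onePlusPSq U ^ m) φ : H) := fun φ => by
    refine (dense_smoothVectors U).eq_of_inner_left (𝕜 := ℂ) fun ψ hψ => ?_
    rw [hadj φ ⟨ψ, hψ⟩, hFC ⟨ψ, hψ⟩, ← h, inner_onePlusPSq_pow U m _ ⟨ψ, hψ⟩,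
      IsSmoothBdd.coe_toEnd, ContinuousLinearMap.adjoint_inner_left]
  obtain ⟨W, -, k, hWk⟩ := hC.exists_hasSpectralIntegral hη.2 Q
  obtain ⟨W', -, k', hWk'⟩ := hC'.exists_hasSpectralIntegral hη.2 Q
  obtain ⟨X, -, l, hX⟩ := hC.adjoint.exists_hasSpectralIntegral hη.2 Q
  set φ' : smoothVectors U := ⟨φ, φ.2.1⟩ with hφ'
  set ψ' : smoothVectors U := ⟨ψ, ψ.2.1⟩ with hψ'
  have hF' := hasWarp_of_eq hd hFC ψ' (hWk _)
  have hG' := hasWarp_of_eq hG hGC φ' (hWk' _)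
  -- The integrand for `G` is rewritten as `(1 + |P|^2)^m` acting on the integrand for the adjoint
  -- of `C`, so the power can be transferred to `ψ'` and the bounded case applied.
  have e1 : (fun p => conjOp U (act Q p) C' ((onePlusPSq U ^ m) φ' : H)) =
      fun p => ((onePlusPSq U ^ m) (hC.adjoint.conjVec Q φ' p) : H) := by
    funext p
    rw [IsSmoothBdd.conjVec_eq, onePlusPSq_pow_translate, coe_translate, h,
      onePlusPSq_pow_translate]
    rfl
  have h1 := hWk' ((onePlusPSq U ^ m) φ')
  rw [e1] at h1
  have h2 := HasSpectralIntegral.inner_onePlusPSq_pow (hX φ') h1 ψ'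
  have h3 := hC.inner_hasSpectralIntegral_adjoint hη hQ φ' _ (hWk ((onePlusPSq U ^ m) ψ')) (hX φ')
  have eF : WarpedConvolution.warp U η Q F ψ = _ := hF'.warp_apply ψ.2
  have eG : WarpedConvolution.warp U η Q G φ = _ := hG'.warp_apply φ.2
  rw [eF, eG]
  refine Eq.trans ?_ h3.symm
  rw [← inner_conj_symm, ← inner_conj_symm (X _)]
  exact congrArg _ h2

theorem IsSmoothOp.warp_le_adjoint (hη : IsGram η) (hQ : IsSkewFor η Q) (hF : IsSmoothOp U F)
    (hG : smoothVectors U ≤ G.domain)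
    (hadj : ∀ φ ψ : smoothVectors U,
      ⟪G ⟨φ, hG φ.2⟩, (ψ : H)⟫_ℂ = ⟪(φ : H), F ⟨ψ, hF.domain_le ψ.2⟩⟫_ℂ) :
    WarpedConvolution.warp U η Q G ≤ (WarpedConvolution.warp U η Q F).adjoint := by
  refine LinearPMap.IsFormalAdjoint.le_adjoint ?_ fun ψ φ => ?_
  · rw [(hF.warp hη.2 Q).1]
    exact dense_smoothVectors U
  · rw [← inner_conj_symm, ← hF.inner_warp hη hQ hG hadj, inner_conj_symm]

lemma IsSmoothOp.dense_domain (hF : IsSmoothOp U F) : Dense (F.domain : Set H) :=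
  (dense_smoothVectors U).mono hF.domain_le

/-- The adjoint of `C` maps `𝒟` into `𝒟`, where `(1 + |P|^2)^m` can act; this supplies the vector
representing `ψ ↦ ⟪φ, Fψ⟫`. -/
lemma IsSmoothOp.le_adjoint_domRestrict (hF : IsSmoothOp U F) :
    smoothVectors U ≤ (F.domRestrict (smoothVectors U)).adjoint.domain := by
  obtain ⟨hd, m, C, hC, hFC⟩ := (isSmoothOp_iff U _).1 hF
  intro φ hφ
  refine LinearPMap.mem_adjoint_domain_of_exists φ
    ⟨((onePlusPSq U ^ m) (hC.adjoint.toEnd ⟨φ, hφ⟩) : H), fun ψ => ?_⟩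
  have e : F.domRestrict (smoothVectors U) ψ = C ((onePlusPSq U ^ m) ⟨ψ, ψ.2.1⟩ : H) :=
    hFC ⟨ψ, ψ.2.1⟩
  rw [e, inner_onePlusPSq_pow U m _ ⟨ψ, ψ.2.1⟩, IsSmoothBdd.coe_toEnd,
    ContinuousLinearMap.adjoint_inner_left]

/-- Formal adjoints of smooth operators on the smooth vectors are smooth, and their warped
convolutions are contained in the adjoint of the warped convolution. -/
theorem IsSmoothOp.warp_formalAdjoint (hη : IsGram η) (hQ : IsSkewFor η Q) (hF : IsSmoothOp U F)
    (hG : smoothVectors U ≤ G.domain)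
    (hadj : ∀ φ ψ : smoothVectors U,
      ⟪G ⟨φ, hG φ.2⟩, (ψ : H)⟫_ℂ = ⟪(φ : H), F ⟨ψ, hF.domain_le ψ.2⟩⟫_ℂ) :
    IsSmoothOp U G ∧ (WarpedConvolution.warp U η Q G).domain = smoothVectors U ∧
      WarpedConvolution.warp U η Q G ≤ (WarpedConvolution.warp U η Q F).adjoint :=
  have h := hF.of_formalAdjoint hG hadj
  ⟨h, (h.warp hη.2 Q).1, hF.warp_le_adjoint hη hQ hG hadj⟩

theorem IsSmoothOp.warp_adjoint (hη : IsGram η) (hQ : IsSkewFor η Q) (hF : IsSmoothOp U F)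
    (h : smoothVectors U ≤ F.adjoint.domain) :
    IsSmoothOp U F.adjoint ∧ (WarpedConvolution.warp U η Q F.adjoint).domain = smoothVectors U ∧
      WarpedConvolution.warp U η Q F.adjoint ≤ (WarpedConvolution.warp U η Q F).adjoint :=
  hF.warp_formalAdjoint hη hQ h fun φ ψ =>
    LinearPMap.adjoint_isFormalAdjoint hF.dense_domain ⟨φ, h φ.2⟩ ⟨ψ, hF.domain_le ψ.2⟩

theorem IsSmoothOp.warp_adjoint_domRestrict (hη : IsGram η) (hQ : IsSkewFor η Q)
    (hF : IsSmoothOp U F) :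
    IsSmoothOp U (F.domRestrict (smoothVectors U)).adjoint ∧
      (WarpedConvolution.warp U η Q (F.domRestrict (smoothVectors U)).adjoint).domain =
        smoothVectors U ∧
      WarpedConvolution.warp U η Q (F.domRestrict (smoothVectors U)).adjoint ≤
        (WarpedConvolution.warp U η Q F).adjoint := by
  have hd : Dense ((F.domRestrict (smoothVectors U)).domain : Set H) :=
    (dense_smoothVectors U).mono fun v hv => ⟨hv, hF.domain_le hv⟩
  exact hF.warp_formalAdjoint hη hQ hF.le_adjoint_domRestrict fun φ ψ =>
    LinearPMap.adjoint_isFormalAdjoint hd ⟨φ, hF.le_adjoint_domRestrict φ.2⟩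
      ⟨ψ, ψ.2, hF.domain_le ψ.2⟩

end UnboundedOperators

/-! ### Algebras of smooth operators and their deformation -/

section Algebra

variable {d : ℕ} {H : Type*} [NormedAddCommGroup H] [InnerProductSpace ℂ H] [CompleteSpace H]
variable {U : TranslationRep d H} {η Q : Matrix (Fin d) (Fin d) ℝ} {F : H →ₗ.[ℂ] H}
variable {A B : Module.End ℂ (smoothVectors U)}

lemma isSmoothOp_opOf_iff : IsSmoothOp U (opOf U A) ↔
    ∃ m C, IsSmoothBdd U C ∧ ∀ ψ : smoothVectors U, (A ψ : H) = C ((onePlusPSq U ^ m) ψ : H) := by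
  rw [isSmoothOp_iff U]
  exact ⟨fun ⟨_, m, C, hC, h⟩ => ⟨m, C, hC, h⟩, fun ⟨m, C, hC, h⟩ => ⟨le_rfl, m, C, hC, h⟩⟩

/-- Smooth operators with domain `𝒟` map `𝒟` into itself. -/
lemma IsSmoothOp.exists_opOf_eq (hF : IsSmoothOp U F) (hd : F.domain = smoothVectors U) :
    ∃ T, opOf U T = F := by
  obtain ⟨h, m, C, hC, hFC⟩ := (isSmoothOp_iff U _).1 hF
  refine ⟨hC.toEnd * onePlusPSq U ^ m, LinearPMap.ext hd.symm fun ψ hψ _ => ?_⟩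
  exact (hFC ⟨ψ, hψ⟩).symm

lemma isSmoothOp_opOf_algebraMap (U : TranslationRep d H) (c : ℂ) :
    IsSmoothOp U (opOf U (algebraMap ℂ _ c)) := by
  refine isSmoothOp_opOf_iff.2 ⟨0, c • 1, (IsSmoothBdd.of_commute fun x ψ => rfl).smul c,
    fun ψ => ?_⟩
  simp [Module.algebraMap_end_apply]

/-- With `A₀ = 1 + |P|^2`, the product `C A₀^m D A₀^n` equals `C D' A₀^(m+n)` once `A₀^m` is moved
through `D`. -/
lemma IsSmoothOp.opOf_mul (hA : IsSmoothOp U (opOf U A)) (hB : IsSmoothOp U (opOf U B)) :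
    IsSmoothOp U (opOf U (A * B)) := by
  obtain ⟨m, C, hC, h⟩ := isSmoothOp_opOf_iff.1 hA
  obtain ⟨n, D, hD, h'⟩ := isSmoothOp_opOf_iff.1 hB
  obtain ⟨D', hD', h''⟩ := hD.exists_onePlusPSq_pow_comm m
  refine isSmoothOp_opOf_iff.2 ⟨m + n, C * D', hC.mul hD', fun ψ => ?_⟩
  have e : B ψ = hD.toEnd ((onePlusPSq U ^ n) ψ) := Subtype.ext (h' ψ)
  rw [Module.End.mul_apply, h, e, h'', pow_add, Module.End.mul_apply]
  rfl

/-- Different exponents are brought to the common value `n + m` by absorbing inverse powers of `1 +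
|P|^2` into the bounded factors. -/
lemma IsSmoothOp.opOf_add (hA : IsSmoothOp U (opOf U A)) (hB : IsSmoothOp U (opOf U B)) :
    IsSmoothOp U (opOf U (A + B)) := by
  obtain ⟨m, C, hC, h⟩ := isSmoothOp_opOf_iff.1 hA
  obtain ⟨n, D, hD, h'⟩ := isSmoothOp_opOf_iff.1 hB
  obtain ⟨K, hK, hKm⟩ := exists_onePlusPSq_inverse U m
  obtain ⟨L, hL, hLn⟩ := exists_onePlusPSq_inverse U n
  refine isSmoothOp_opOf_iff.2 ⟨n + m, C * L + D * K, (hC.mul hL).add (hD.mul hK), fun ψ => ?_⟩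
  have e1 : L ((onePlusPSq U ^ (n + m)) ψ : H) = ((onePlusPSq U ^ m) ψ : H) := by
    rw [pow_add, Module.End.mul_apply, hLn]
  have e2 : K ((onePlusPSq U ^ (n + m)) ψ : H) = ((onePlusPSq U ^ n) ψ : H) := by
    rw [add_comm, pow_add, Module.End.mul_apply, hKm]
  rw [LinearMap.add_apply, Submodule.coe_add, h, h', add_apply, mul_apply_eq_comp,
    mul_apply_eq_comp, e1, e2]

lemma opOf_le_adjoint_iff : opOf U B ≤ (opOf U A).adjoint ↔
    ∀ φ ψ : smoothVectors U, ⟪(B φ : H), (ψ : H)⟫_ℂ = ⟪(φ : H), (A ψ : H)⟫_ℂ := by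
  have hd : Dense ((opOf U A).domain : Set H) := dense_smoothVectors U
  constructor
  · intro h φ ψ
    have h1 : (B φ : H) = (opOf U A).adjoint ⟨φ, h.1 φ.2⟩ :=
      h.2 (x := φ) (y := ⟨φ, h.1 φ.2⟩) rfl
    rw [h1]
    exact LinearPMap.adjoint_isFormalAdjoint hd ⟨φ, h.1 φ.2⟩ ψ
  · intro h
    refine LinearPMap.IsFormalAdjoint.le_adjoint hd fun ψ φ => ?_
    have := h φ ψ
    rw [← inner_conj_symm, ← inner_conj_symm (φ : H)] at this
    exact (star_injective this).symm

lemma warp_mem_deformedAlgebra (hη : η.det ≠ 0)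
    {𝔄 : Subalgebra ℂ (Module.End ℂ (smoothVectors U))} (h𝔄 : IsSmoothStarAlgebra U 𝔄)
    (Q : Matrix (Fin d) (Fin d) ℝ) (hA : A ∈ 𝔄) :
    ∃ T ∈ deformedAlgebra U η Q 𝔄, opOf U T = warp U η Q (opOf U A) := by
  obtain ⟨h1, h2⟩ := (h𝔄.smooth A hA).warp hη Q
  obtain ⟨T, hT⟩ := h2.exists_opOf_eq h1
  exact ⟨T, Algebra.subset_adjoin ⟨A, hA, hT⟩, hT⟩

/-- The deformation of a smooth `*`-algebra is a smooth `*`-algebra. -/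
theorem IsSmoothStarAlgebra.deformedAlgebra (hη : IsGram η) (hQ : IsSkewFor η Q)
    {𝔄 : Subalgebra ℂ (Module.End ℂ (smoothVectors U))} (h𝔄 : IsSmoothStarAlgebra U 𝔄) :
    IsSmoothStarAlgebra U (deformedAlgebra U η Q 𝔄) := by
  refine ⟨fun T hT => ?_, fun T hT => ?_⟩
  · induction hT using Algebra.adjoin_induction with
    | mem T hT =>
      obtain ⟨A, hA, hT⟩ := hT
      rw [hT]
      exact ((h𝔄.smooth A hA).warp hη.2 Q).2
    | algebraMap c => exact isSmoothOp_opOf_algebraMap U c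
    | add A B _ _ hA hB => exact hA.opOf_add hB
    | mul A B _ _ hA hB => exact hA.opOf_mul hB
  · simp only [opOf_le_adjoint_iff]
    induction hT using Algebra.adjoin_induction with
    | mem T hT =>
      obtain ⟨A, hA, hT⟩ := hT
      obtain ⟨B, hB, hBA⟩ := h𝔄.star_mem A hA
      obtain ⟨T', hT', e⟩ := warp_mem_deformedAlgebra hη.2 h𝔄 Q hB
      refine ⟨T', hT', opOf_le_adjoint_iff.1 ?_⟩
      rw [hT, e]
      exact (h𝔄.smooth A hA).warp_le_adjoint hη hQ (G := opOf U B) le_rfl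
        (opOf_le_adjoint_iff.1 hBA)
    | algebraMap c =>
      refine ⟨algebraMap ℂ _ ((starRingEnd ℂ) c), Subalgebra.algebraMap_mem _ _, fun φ ψ => ?_⟩
      simp [Module.algebraMap_end_apply, mul_comm]
    | add A B _ _ hA hB =>
      obtain ⟨A', hA', h⟩ := hA
      obtain ⟨B', hB', h'⟩ := hB
      refine ⟨A' + B', add_mem hA' hB', fun φ ψ => ?_⟩
      simp [h, h']
    | mul A B _ _ hA hB =>
      obtain ⟨A', hA', h⟩ := hA
      obtain ⟨B', hB', h'⟩ := hB
      refine ⟨B' * A', mul_mem hB' hA', fun φ ψ => ?_⟩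
      rw [Module.End.mul_apply, Module.End.mul_apply, h', h]

end Algebra

/-! ### Skew symmetry of the Lorentz-transformed matrices -/

section Lorentz

variable {d : ℕ}

lemma isSkewFor_of_transpose {η Q : Matrix (Fin d) (Fin d) ℝ} (h : (η * Q).transpose = -(η * Q)) :
    IsSkewFor η Q := by
  have e : ∀ p q : RVec d, pairing η p (act Q q) = p.ofLp ⬝ᵥ (η * Q).mulVec q.ofLp := by
    intro p q
    rw [← Matrix.mulVec_mulVec]
    simp [pairing, act, Matrix.ofLp_toEuclideanCLM, dotProduct, Matrix.mulVec, Finset.mul_sum,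
      mul_assoc]
  intro p q
  rw [e, e, Matrix.dotProduct_mulVec, ← Matrix.mulVec_transpose, h, Matrix.neg_mulVec,
    neg_dotProduct, dotProduct_comm]

lemma isGram_lorentzForm (d : ℕ) : IsGram (lorentzForm d) := by
  refine ⟨Matrix.diagonal_transpose _, ?_⟩
  rw [lorentzForm, Matrix.det_diagonal, Finset.prod_ne_zero_iff]
  intro i _
  split_ifs <;> norm_num

/-- For a Lorentz matrix `ηΛ = Λ⁻ᵀη`, hence `η Λ Q_κ Λ⁻¹ = Λ⁻ᵀ (η Q_κ) Λ⁻¹` is a congruence of `η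
Q_κ`. The latter is antisymmetric because `η` has opposite signs at the indices `0` and `1`. -/
lemma isSkewFor_lorentz {Λ : Matrix (Fin d) (Fin d) ℝ} (hΛ : IsLorentz Λ) (κ : ℝ) :
    IsSkewFor (lorentzForm d) (Λ * Qmat d κ * Λ⁻¹) := by
  have hg := isGram_lorentzForm d
  have hdet : IsUnit Λ.det := by
    rw [isUnit_iff_ne_zero]
    intro h0
    have := congrArg Matrix.det hΛ
    rw [Matrix.det_mul, h0, mul_zero] at this
    exact hg.2 this.symm
  have h1 : lorentzForm d * Λ = Λ⁻¹.transpose * lorentzForm d := by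
    have h2 : Λ⁻¹.transpose * Λ.transpose = 1 := by
      rw [← Matrix.transpose_mul, Matrix.mul_nonsing_inv _ hdet, Matrix.transpose_one]
    conv_rhs => rw [← hΛ, Matrix.mul_assoc, ← Matrix.mul_assoc, h2, Matrix.one_mul]
  have h3 : (lorentzForm d * Qmat d κ).transpose = -(lorentzForm d * Qmat d κ) := by
    ext i j
    simp only [lorentzForm, Matrix.transpose_apply, Matrix.neg_apply, Matrix.diagonal_mul, Qmat]
    split_ifs <;> first | omega | simp
  refine isSkewFor_of_transpose ?_
  have h4 : lorentzForm d * (Λ * Qmat d κ * Λ⁻¹) =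
      Λ⁻¹.transpose * (lorentzForm d * Qmat d κ) * Λ⁻¹ := by
    simp only [← Matrix.mul_assoc, h1]
  rw [h4, Matrix.transpose_mul, Matrix.transpose_mul, h3, Matrix.transpose_transpose]
  simp only [Matrix.mul_neg, Matrix.neg_mul, Matrix.mul_assoc]

end Lorentz

end WarpedConvolution

end

theorem lemma2 {H : Type*} [NormedAddCommGroup H] [InnerProductSpace ℂ H] [CompleteSpace H]
    [TopologicalSpace.SeparableSpace H] {d : ℕ} (hd : 2 ≤ d)
    (U : WarpedConvolution.TranslationRep d H) :
    (∀ η Q : Matrix (Fin d) (Fin d) ℝ, WarpedConvolution.IsGram η →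
      WarpedConvolution.IsSkewFor η Q →
      ∀ F : H →ₗ.[ℂ] H, WarpedConvolution.IsSmoothOp U F →
        -- `F_Q` is defined on `𝒟` and belongs to `𝔉`
        ((WarpedConvolution.warp U η Q F).domain = WarpedConvolution.smoothVectors U ∧
          WarpedConvolution.IsSmoothOp U (WarpedConvolution.warp U η Q F)) ∧
        -- the adjoint `F*` of `F` as an operator on `𝒟` belongs to `𝔉`, and `(F*)_Q ⊂ (F_Q)*`
        (WarpedConvolution.IsSmoothOp U
            (F.domRestrict (WarpedConvolution.smoothVectors U)).adjoint ∧
          (WarpedConvolution.warp U η Q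
              (F.domRestrict (WarpedConvolution.smoothVectors U)).adjoint).domain =
            WarpedConvolution.smoothVectors U ∧
          WarpedConvolution.warp U η Q
              (F.domRestrict (WarpedConvolution.smoothVectors U)).adjoint ≤
            (WarpedConvolution.warp U η Q F).adjoint) ∧
        -- the same for the adjoint of `F` on its full domain, whenever this is defined on `𝒟`
        (WarpedConvolution.smoothVectors U ≤ F.adjoint.domain →
          WarpedConvolution.IsSmoothOp U F.adjoint ∧
          (WarpedConvolution.warp U η Q F.adjoint).domain = WarpedConvolution.smoothVectors U ∧
          WarpedConvolution.warp U η Q F.adjoint ≤ (WarpedConvolution.warp U η Q F).adjoint)) ∧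
    -- the deformed wedge algebras are *-algebras
    (∀ κ : ℝ, 0 < κ →
      ∀ 𝔄 : Set (WarpedConvolution.RVec d) →
          Subalgebra ℂ (Module.End ℂ (WarpedConvolution.smoothVectors U)),
      ∀ (Λ : Matrix (Fin d) (Fin d) ℝ) (a : WarpedConvolution.RVec d),
        WarpedConvolution.IsLorentz Λ →
        WarpedConvolution.IsSmoothStarAlgebra U (𝔄 (WarpedConvolution.wedge hd Λ a)) →
        -- every warped operator `A_Q`, `A ∈ 𝔄(𝒲)`, is an element of the deformed algebra
        (∀ A ∈ 𝔄 (WarpedConvolution.wedge hd Λ a),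
          ∃ T ∈ WarpedConvolution.deformedWedgeAlgebra hd U κ 𝔄 Λ a,
            WarpedConvolution.opOf U T =
              WarpedConvolution.warp U (WarpedConvolution.lorentzForm d)
                (Λ * WarpedConvolution.Qmat d κ * Λ⁻¹) (WarpedConvolution.opOf U A)) ∧
        WarpedConvolution.IsSmoothStarAlgebra U
          (WarpedConvolution.deformedWedgeAlgebra hd U κ 𝔄 Λ a)) := by
  exact
    ⟨fun _ Q hη hQ _ hF => ⟨hF.warp hη.2 Q, hF.warp_adjoint_domRestrict hη hQ,
        hF.warp_adjoint hη hQ⟩,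
      fun κ _ _ Λ a hΛ h𝔄 =>
        ⟨fun _ hA => WarpedConvolution.warp_mem_deformedAlgebra
            (WarpedConvolution.isGram_lorentzForm d).2 h𝔄 _ hA,
          h𝔄.deformedAlgebra (WarpedConvolution.isGram_lorentzForm d)
            (WarpedConvolution.isSkewFor_lorentz hΛ κ)⟩⟩
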